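/- **Setting.** Let $d\ge 1$. For $\alpha\in(0,2]$ let $(L^{(\alpha)}_t)_{t\ge0}$ be a $d$-dimensional rotationally invariant $\alpha$-stable Lévy process, normalized by $\mathbb E\,e^{i\xi\cdot L^{(\alpha)}_t}=e^{-t|\xi|^\alpha}$ (for $\alpha=2$: Brownian motion with generator $\Delta$). Let $\kappa_1>1$ and let $\sigma:[0,\infty)\to\mathbb R^{d\times d}$ be measurable with $$\kappa_1^{-1}|\xi|^2\le|\sigma(r)\xi|^2\le\kappa_1|\xi|^2\qquad\text{for all } r\ge0,\ \xi\in\mathbb R^d .$$ For $0\le s<u$ let $p^{(\alpha),\sigma}(s,u,\cdot)$ be the smooth density of the random variable $\int_s^u\sigma(r)\,dL^{(\alpha)}_r$; that this density exists is part of the assertion. (The integral of a step function $\sum_i A_i 1_{(r_i,r_{i+1}]}$ is $\sum_i A_i(L^{(\alpha)}_{r_{i+1}}-L^{(\alpha)}_{r_i})$, and the integral of $\sigma$ is the limit in probability of the integrals of step functions $\sigma_n$ with $\int_s^u\|\sigma_n(r)-\sigma(r)\|^\alpha dr\to0$.) For $k\ge0$, $\gamma_1,\gamma_2\in(0,2]$,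 $t>0$, $x\in\mathbb R^d$ put $$\varrho^{(k)}_{\gamma_1,\gamma_2}(t,x)=\min\Big\{t^{-(d+k)/\gamma_1},\ \frac{t}{|x|^{d+k+\gamma_2}}\Big\},\qquad \varrho_{\gamma_1,\gamma_2}=\varrho^{(0)}_{\gamma_1,\gamma_2},$$ with $t/0=\infty$, and $0^0=1$. **Theorem 4.7.** Let $T>0$ and $\alpha_0\in(0,2)$. There is a constant $c=c(d,T,\alpha_0,\kappa_1)>0$ such that for every $\sigma$ as above, every $\alpha\in[\alpha_0,2]$, all $0\le s<s+t\le T$ and all $x\in\mathbb R^d$: (i) $$\big|p^{(\alpha),\sigma}(s,s+t,x)-p^{(2),\sigma}(s,s+t,x)\big|\le c\,(2-\alpha)(1+|\ln t|)\big(1+t^{\frac{\alpha-2}{\alpha}}\big)\sum_{\gamma_1,\gamma_2\in\{\alpha,2\}}\varrho_{\gamma_1,\gamma_2}(t,x);$$ (ii) if moreover the matrix $\sigma(r)\sigma(r)^{*}$ is diagonal for every $r\ge0$, then for $k=1,2$ $$\big|\nabla^kp^{(\alpha),\sigma}(s,s+t,x)-\nabla^kp^{(2),\sigma}(s,s+t,x)\big|\le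 c\,(2-\alpha)(1+|\ln t|)\big(1+t^{\frac{\alpha-2}{\alpha}}\big)\sum_{k_1=1}^{k}\ \sum_{\gamma_1,\gamma_2\in\{\alpha,2\}}|x|^{2k_1-k}\varrho^{(2k_1)}_{\gamma_1,\gamma_2}(t,x).$$ -/

import Mathlib

open MeasureTheory ProbabilityTheory Filter Topology
open scoped NNReal ENNReal Matrix

namespace StableKernel

/-- `ℝᵈ` with the Euclidean norm. -/
abbrev E (d : ℕ) : Type := EuclideanSpace ℝ (Fin d)

/-- A `d`-dimensional rotationally invariant `α`-stable Lévy process `(L_t)_{t ≥ 0}`, with the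
normalization `𝔼 exp(i ξ · L_t) = exp(-t |ξ|^α)`: it starts at `0`, has independent and stationary
increments with this characteristic function, and has càdlàg paths almost surely. For `α = 2` this
is a Brownian motion with generator `Δ`. -/
structure IsStableProcess {d : ℕ} {Ω : Type*} [MeasurableSpace Ω] (α : ℝ) (L : ℝ≥0 → Ω → E d)
    (P : Measure Ω) : Prop where
  measurable : ∀ t, Measurable (L t)
  zero : ∀ᵐ ω ∂P, L 0 ω = 0
  indep : HasIndepIncrements L P
  charFun_increment : ∀ s t : ℝ≥0, s ≤ t → ∀ ξ : E d,
    charFun (P.map fun ω => L t ω - L s ω) ξ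
      = ((Real.exp (-(((t : ℝ) - s) * ‖ξ‖ ^ α)) : ℝ) : ℂ)
  cadlag : ∀ᵐ ω ∂P, ∀ t : ℝ≥0,
    ContinuousWithinAt (fun r => L r ω) (Set.Ici t) t ∧
      ∃ l : E d, Tendsto (fun r => L r ω) (𝓝[<] t) (𝓝 l)

/-- A deterministic matrix-valued step function `∑_{i < n} A_i 1_{(r_i, r_{i+1}]}` on `(s, t]`,
where `s = r_0 ≤ r_1 ≤ … ≤ r_n = t`. -/
structure StepIntegrand (d : ℕ) (s t : ℝ≥0) where
  n : ℕ
  node : ℕ → ℝ≥0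
  coeff : ℕ → Matrix (Fin d) (Fin d) ℝ
  mono : Monotone node
  node_zero : node 0 = s
  node_last : node n = t

/-- The step function itself. -/
noncomputable def StepIntegrand.eval {d : ℕ} {s t : ℝ≥0} (S : StepIntegrand d s t) (r : ℝ≥0) :
    Matrix (Fin d) (Fin d) ℝ :=
  ∑ i ∈ Finset.range S.n,
    (Set.Ioc (S.node i) (S.node (i + 1))).indicator (fun _ => S.coeff i) r

/-- The elementary integral `∑_{i < n} A_i (L_{r_{i+1}} - L_{r_i})` of a step function. -/
noncomputable def StepIntegrand.integral {d : ℕ} {s t : ℝ≥0} (S : StepIntegrand d s t)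
    {Ω : Type*} (L : ℝ≥0 → Ω → E d) (ω : Ω) : E d :=
  ∑ i ∈ Finset.range S.n,
    Matrix.toEuclideanCLM (𝕜 := ℝ) (S.coeff i) (L (S.node (i + 1)) ω - L (S.node i) ω)

/-- The random variable `Z` is (a version of) the stochastic integral `∫_s^t σ(r) dL_r` of the
deterministic function `σ` with respect to the `α`-stable process `L`: the limit in probability of
the elementary integrals of step functions `S_n` with `∫_s^t ‖S_n(r) - σ(r)‖^α dr → 0`. -/
def IsStableIntegral {d : ℕ} {Ω : Type*} [MeasurableSpace Ω] (α : ℝ) (L : ℝ≥0 → Ω → E d)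
    (P : Measure Ω) (σ : ℝ≥0 → Matrix (Fin d) (Fin d) ℝ) (s t : ℝ≥0) (Z : Ω → E d) : Prop :=
  AEMeasurable Z P ∧ ∃ S : ℕ → StepIntegrand d s t,
    Tendsto (fun n => ∫⁻ r in Set.Ioc (s : ℝ) (t : ℝ),
      ENNReal.ofReal
        (‖Matrix.toEuclideanCLM (𝕜 := ℝ) ((S n).eval r.toNNReal - σ r.toNNReal)‖ ^ α))
      atTop (𝓝 0) ∧
    TendstoInMeasure P (fun n => (S n).integral L) atTop Z

/-- `p` is the smooth density, with respect to Lebesgue measure, of the law of `Z`. -/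
structure IsSmoothDensity {d : ℕ} {Ω : Type*} [MeasurableSpace Ω] (P : Measure Ω) (Z : Ω → E d)
    (p : E d → ℝ) : Prop where
  smooth : ContDiff ℝ ((⊤ : ℕ∞) : WithTop ℕ∞) p
  nonneg : ∀ x, 0 ≤ p x
  map_eq : P.map Z = volume.withDensity fun x => ENNReal.ofReal (p x)

/-- There is at most one smooth density, so that `IsSmoothDensity` determines `p` pointwise. -/
theorem IsSmoothDensity.unique {d : ℕ} {Ω : Type*} [MeasurableSpace Ω] {P : Measure Ω}
    [IsFiniteMeasure P] {Z : Ω → E d} {p q : E d → ℝ} (hp : IsSmoothDensity P Z p)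
    (hq : IsSmoothDensity P Z q) : p = q := by
  have hpc := hp.smooth.continuous
  have hqc := hq.smooth.continuous
  have h1 : (fun x => ENNReal.ofReal (p x)) =ᵐ[volume] fun x => ENNReal.ofReal (q x) := by
    refine (withDensity_eq_iff_of_sigmaFinite (by fun_prop) (by fun_prop)).1 ?_
    rw [← hp.map_eq, ← hq.map_eq]
  refine (Continuous.ae_eq_iff_eq volume hpc hqc).1 ?_
  filter_upwards [h1] with x hx
  exact (ENNReal.ofReal_eq_ofReal_iff (hp.nonneg x) (hq.nonneg x)).1 hx

/-- `ϱ^{(k)}_{γ₁,γ₂}(t, x) = t^{-(d+k)/γ₁} ∧ (t / |x|^{d+k+γ₂})`, where `t / 0 = ∞`. -/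
noncomputable def rho {d : ℕ} (k γ₁ γ₂ t : ℝ) (x : E d) : ℝ :=
  open Classical in
  if x = 0 then t ^ (-(d + k) / γ₁)
  else min (t ^ (-(d + k) / γ₁)) (t / ‖x‖ ^ (d + k + γ₂))

/-- `∑_{γ₁, γ₂ ∈ {α, 2}} ϱ^{(k)}_{γ₁,γ₂}(t, x)`. -/
noncomputable def rhoSum {d : ℕ} (k α t : ℝ) (x : E d) : ℝ :=
  ∑ γ₁ ∈ ({α, 2} : Finset ℝ), ∑ γ₂ ∈ ({α, 2} : Finset ℝ), rho k γ₁ γ₂ t x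

/-- `(2 - α) (1 + |ln t|) (1 + t^{(α-2)/α})`. -/
noncomputable def rate (α t : ℝ) : ℝ :=
  (2 - α) * (1 + |Real.log t|) * (1 + t ^ ((α - 2) / α))

/-- The non-degeneracy condition `κ₁⁻¹ |ξ|² ≤ |σ(r) ξ|² ≤ κ₁ |ξ|²` for all `r ≥ 0`, `ξ ∈ ℝᵈ`. -/
def Nondegenerate {d : ℕ} (κ₁ : ℝ) (σ : ℝ≥0 → Matrix (Fin d) (Fin d) ℝ) : Prop :=
  ∀ (r : ℝ≥0) (ξ : E d),
    κ₁⁻¹ * ‖ξ‖ ^ 2 ≤ ‖Matrix.toEuclideanCLM (𝕜 := ℝ) (σ r) ξ‖ ^ 2 ∧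
      ‖Matrix.toEuclideanCLM (𝕜 := ℝ) (σ r) ξ‖ ^ 2 ≤ κ₁ * ‖ξ‖ ^ 2

end StableKernel

open StableKernel

/-! Write `Φ_α ξ = ∫ ‖A r ξ‖ ^ α` with `A r = 2π σ(r)ᵀ` (`phase`, `scaledAdj`); the factor 2π
matches the normalization of the Fourier transform. The stable integral has characteristic function
`exp (-Φ_α)` at `2πξ`, so its density is the Fourier transform of `exp (-Φ_α)`
(`isSmoothDensity_kernel`). The difference of the densities and its derivatives are then Fourier
integrals of `∏ ⟨ξ, v j⟩ (exp (-Φ_α) - exp (-Φ_2))`. These are bounded twice, and the minimum of the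
two bounds gives `rhoSum`.

Near bound, for all `x` (`exists_near_integral_le`): absolute values are taken inside the integral.
The factor `2 - α` is a mean value estimate in the exponent, `‖Y ^ (α/2) - Y‖ ≲ (2 - α)(1 + |log
ρ|)(ρ ^ α + ρ ^ 2)` for `‖Y‖ ~ ρ ^ 2`. Scaling by `t ^ (1/α)` and `t ^ (1/2)` does the rest.

Far bound, for `‖x‖ ≥ t ^ (1/α)` (`Elliptic.norm_integral_symbolDiff_le_farKernel`): `Φ_α` is not
smooth at the origin, so contours are deformed in place of integrating by parts. Frequency space is
sliced into lines `η + u e` with `e = x / ‖x‖` and `η ⟂ e`. On such a line `‖A r ξ‖ ^ 2` is a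
quadratic polynomial in `u`. Its values stay in a sector around the positive axis as long as `|Im
z|` is a small multiple of `√((Re z)² + ‖η‖²)`, so the power `α/2` extends holomorphically. The line
is moved to a hyperbola in the lower half plane, where, with `X = 2π‖x‖`, the factor `exp (-i X z)`
has modulus `exp (-X s ‖ξ‖)`: a radial weight that can be integrated over all lines and scaled by
`X`.

On the hyperbola the exponentials are expanded to first order. The linear term `Φ_α - Φ_2` alone
would produce a factor `log X`, which is unbounded for large `X`. But `Φ_2` is a polynomial along
the line, and its oscillatory integral over the hyperbola vanishes, since the contour can be folded
onto the imaginary axis. Hence `Φ_α - Φ_2` may be replaced by `Φ_α - X ^ (2 - α) Φ_2`, which by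
homogeneity equals `X ^ (-α)` times the difference at frequency `Xξ` and carries no `log X`. The
remainder is quadratic in the phases, and there the logarithm is absorbed (`farFactor_le`).

For the gradient the symbol is odd, which yields the extra factor `‖x‖` in the near bound. -/

namespace StableKernel

/-! ### Fractional powers of complex numbers in a sector -/

/-- `Y` lies in a fixed sector around the positive real axis and has modulus comparable to `ρ²`. -/
structure Sectorial (K ρ : ℝ) (Y : ℂ) : Prop where
  re_ge : ρ ^ 2 / K ≤ Y.re
  norm_le : ‖Y‖ ≤ K * ρ ^ 2

namespace Sectorial

variable {K ρ α : ℝ} {Y : ℂ}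

theorem re_pos (h : Sectorial K ρ Y) (hK : 1 ≤ K) (hρ : 0 < ρ) : 0 < Y.re :=
  lt_of_lt_of_le (by positivity) h.re_ge

theorem ne_zero (h : Sectorial K ρ Y) (hK : 1 ≤ K) (hρ : 0 < ρ) : Y ≠ 0 := by
  rintro rfl
  simpa using h.re_pos hK hρ

theorem le_norm (h : Sectorial K ρ Y) : ρ ^ 2 / K ≤ ‖Y‖ :=
  h.re_ge.trans (Complex.re_le_norm Y)

theorem smul (h : Sectorial K ρ Y) (X : ℝ) : Sectorial K (X * ρ) ((X ^ 2 : ℝ) * Y) := by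
  refine ⟨?_, ?_⟩
  · rw [Complex.re_ofReal_mul, mul_pow, mul_div_assoc]
    exact mul_le_mul_of_nonneg_left h.re_ge (sq_nonneg _)
  · rw [norm_mul, Complex.norm_real, Real.norm_of_nonneg (sq_nonneg X), mul_pow]
    nlinarith [mul_le_mul_of_nonneg_left h.norm_le (sq_nonneg X)]

theorem norm_cpow_le (h : Sectorial K ρ Y) (hK : 1 ≤ K) (hρ : 0 < ρ) (hα : 0 < α)
    (hα2 : α ≤ 2) : ‖Y ^ ((α / 2 : ℝ) : ℂ)‖ ≤ K * ρ ^ α := by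
  rw [Complex.norm_cpow_real]
  calc ‖Y‖ ^ (α / 2) ≤ (K * ρ ^ 2) ^ (α / 2) := by gcongr; exact h.norm_le
    _ = K ^ (α / 2) * ρ ^ α := by
      rw [Real.mul_rpow (by positivity) (by positivity), ← Real.rpow_natCast, ← Real.rpow_mul hρ.le]
      congr 2; push_cast; ring
    _ ≤ K * ρ ^ α := by
      gcongr
      calc K ^ (α / 2) ≤ K ^ (1 : ℝ) := Real.rpow_le_rpow_of_exponent_le hK (by linarith)
        _ = K := Real.rpow_one K

/-- Raising to a power `α/2 ≤ 1` shrinks the argument, so its cosine does not decrease, and `cos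
(arg Y) = Re Y / ‖Y‖ ≥ 1 / K ^ 2`. The third factor `K` is lost on the modulus. -/
theorem re_cpow_ge (h : Sectorial K ρ Y) (hK : 1 ≤ K) (hρ : 0 < ρ) (hα : 0 < α)
    (hα2 : α ≤ 2) : ρ ^ α / K ^ 3 ≤ (Y ^ ((α / 2 : ℝ) : ℂ)).re := by
  have hK0 : 0 < K := by linarith
  have hY := h.ne_zero hK hρ
  have hYn : 0 < ‖Y‖ := norm_pos_iff.2 hY
  have e1 : (Y ^ ((α / 2 : ℝ) : ℂ)).re = ‖Y‖ ^ (α / 2) * Real.cos (Y.arg * (α / 2)) := by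
    rw [Complex.cpow_def_of_ne_zero hY, Complex.exp_re, Complex.re_mul_ofReal,
      Complex.im_mul_ofReal, Complex.log_re, Complex.log_im, Real.rpow_def_of_pos hYn]
  have hcos : Real.cos Y.arg ≤ Real.cos (Y.arg * (α / 2)) := by
    rw [← Real.cos_abs Y.arg, ← Real.cos_abs (Y.arg * (α / 2))]
    refine Real.cos_le_cos_of_nonneg_of_le_pi (abs_nonneg _) (Complex.abs_arg_le_pi _) ?_
    rw [abs_mul, abs_of_pos (by positivity : 0 < α / 2)]
    exact mul_le_of_le_one_right (abs_nonneg _) (by linarith)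
  have hc : 1 / K ^ 2 ≤ Real.cos Y.arg := by
    rw [Complex.cos_arg hY, div_le_div_iff₀ (by positivity) hYn]
    have := h.re_ge
    rw [div_le_iff₀ hK0] at this
    nlinarith [h.norm_le]
  have hn : ρ ^ α / K ≤ ‖Y‖ ^ (α / 2) := by
    calc ρ ^ α / K ≤ ρ ^ α / K ^ (α / 2) := by
          gcongr
          calc K ^ (α / 2) ≤ K ^ (1 : ℝ) := Real.rpow_le_rpow_of_exponent_le hK (by linarith)
            _ = K := Real.rpow_one K
      _ = (ρ ^ 2 / K) ^ (α / 2) := by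
          rw [Real.div_rpow (by positivity) (by positivity), ← Real.rpow_natCast,
            ← Real.rpow_mul hρ.le]
          congr 2; push_cast; ring
      _ ≤ _ := by gcongr; exact h.le_norm
  rw [e1]
  calc ρ ^ α / K ^ 3 = (ρ ^ α / K) * (1 / K ^ 2) := by field_simp
    _ ≤ _ := by gcongr; exact hc.trans hcos

theorem abs_log_norm_le (h : Sectorial K ρ Y) (hK : 1 ≤ K) (hρ : 0 < ρ) :
    |Real.log ‖Y‖| ≤ 2 * |Real.log ρ| + K := by
  have hK0 : 0 < K := by linarith
  have hYn : 0 < ‖Y‖ := norm_pos_iff.2 (h.ne_zero hK hρ)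
  have hlK : Real.log K ≤ K := (Real.log_le_sub_one_of_pos hK0).trans (by linarith)
  have h1 := Real.log_le_log hYn h.norm_le
  have h2 := Real.log_le_log (by positivity) h.le_norm
  rw [Real.log_mul hK0.ne' (by positivity), Real.log_pow] at h1
  rw [Real.log_div (by positivity) hK0.ne', Real.log_pow] at h2
  push_cast at h1 h2
  rw [abs_le]
  constructor <;> linarith [neg_abs_le (Real.log ρ), le_abs_self (Real.log ρ)]

/-- This is where `2 - α` arises: the mean value inequality for `τ ↦ Y ^ τ = exp (τ log Y)` on
`[α/2, 1]`, an interval of length `(2 - α)/2`. The derivative is `Y ^ τ log Y`; an intermediate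
power of `‖Y‖` is at most the sum of the two extreme ones, and the argument contributes at most `π ≤
4` to the logarithm. -/
theorem norm_cpow_sub_le (h : Sectorial K ρ Y) (hK : 1 ≤ K) (hρ : 0 < ρ) (hα : 0 < α)
    (hα2 : α ≤ 2) : ‖Y ^ ((α / 2 : ℝ) : ℂ) - Y‖ ≤
      K * (K + 4) * (2 - α) * ((1 + |Real.log ρ|) * (ρ ^ α + ρ ^ 2)) := by
  have hY := h.ne_zero hK hρ
  have hYn : 0 < ‖Y‖ := norm_pos_iff.2 hY
  have hlog : ‖Complex.log Y‖ ≤ 2 * |Real.log ρ| + K + 4 := by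
    refine (Complex.norm_le_abs_re_add_abs_im _).trans ?_
    rw [Complex.log_re, Complex.log_im]
    linarith [h.abs_log_norm_le hK hρ, Complex.abs_arg_le_pi Y, Real.pi_le_four]
  have hd : ∀ τ ∈ Set.Icc (α / 2) 1, HasDerivWithinAt
      (fun τ : ℝ => Complex.exp (Complex.log Y * τ))
      (Complex.exp (Complex.log Y * τ) * Complex.log Y) (Set.Icc (α / 2) 1) τ := by
    intro τ _
    have h1 : HasDerivAt (fun z : ℂ => Complex.exp (Complex.log Y * z))
        (Complex.exp (Complex.log Y * τ) * Complex.log Y) (τ : ℂ) := by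
      have := ((hasDerivAt_id (τ : ℂ)).const_mul (Complex.log Y)).cexp
      simpa using this
    exact h1.comp_ofReal.hasDerivWithinAt
  have hb : ∀ τ ∈ Set.Ico (α / 2) 1, ‖Complex.exp (Complex.log Y * τ) * Complex.log Y‖ ≤
      (2 * |Real.log ρ| + K + 4) * (K * (ρ ^ α + ρ ^ 2)) := by
    intro τ hτ
    rw [norm_mul, mul_comm]
    gcongr
    rw [Complex.norm_exp, Complex.re_mul_ofReal, Complex.log_re, mul_comm, mul_comm τ,
      ← Real.rpow_def_of_pos hYn]
    have hA : ‖Y‖ ^ (α / 2) ≤ K * ρ ^ α := by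
      have := h.norm_cpow_le hK hρ hα hα2
      rwa [Complex.norm_cpow_real] at this
    rcases le_total ‖Y‖ 1 with h1 | h1
    · have := Real.rpow_le_rpow_of_exponent_ge hYn h1 hτ.1
      have h0 : 0 ≤ K * ρ ^ 2 := by positivity
      linarith
    · have := Real.rpow_le_rpow_of_exponent_le h1 hτ.2.le
      rw [Real.rpow_one] at this
      have h0 : 0 ≤ K * ρ ^ α := by positivity
      linarith [h.norm_le]
  have key := norm_image_sub_le_of_norm_deriv_le_segment' hd hb 1
    (Set.right_mem_Icc.2 (by linarith))
  have e1 : Complex.exp (Complex.log Y * (1 : ℝ)) = Y := by simp [Complex.exp_log hY]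
  rw [e1, ← Complex.cpow_def_of_ne_zero hY, norm_sub_rev] at key
  refine key.trans ?_
  have hS : 0 ≤ ρ ^ α + ρ ^ 2 := by positivity
  have h1 : (2 * |Real.log ρ| + K + 4) * (1 / 2) ≤ (K + 4) * (1 + |Real.log ρ|) := by
    nlinarith [abs_nonneg (Real.log ρ)]
  have h2 : 0 ≤ (2 - α) * (K * (ρ ^ α + ρ ^ 2)) := mul_nonneg (by linarith) (by positivity)
  calc _ = (2 * |Real.log ρ| + K + 4) * (1 / 2) * ((2 - α) * (K * (ρ ^ α + ρ ^ 2))) := by ring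
    _ ≤ (K + 4) * (1 + |Real.log ρ|) * ((2 - α) * (K * (ρ ^ α + ρ ^ 2))) := by gcongr
    _ = _ := by ring

/-- By homogeneity the left side is `X ^ (-α)` times the difference for `X ^ 2 * Y`. The logarithm
is then taken at `X * ρ`, which is harmless at the scale `ρ ~ 1 / X` where the far integral lives.
-/
theorem norm_cpow_sub_smul_le (h : Sectorial K ρ Y) (hK : 1 ≤ K) (hρ : 0 < ρ) (hα : 0 < α)
    (hα2 : α ≤ 2) {X : ℝ} (hX : 0 < X) :
    ‖Y ^ ((α / 2 : ℝ) : ℂ) - (X ^ (2 - α) : ℝ) * Y‖ ≤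
      K * (K + 4) * (2 - α) * X ^ (-α) *
        ((1 + |Real.log (X * ρ)|) * ((X * ρ) ^ α + (X * ρ) ^ 2)) := by
  have hs := (h.smul X).norm_cpow_sub_le hK (by positivity) hα hα2
  have e1 : ((X ^ 2 : ℝ) * Y) ^ ((α / 2 : ℝ) : ℂ) = (X ^ α : ℝ) * Y ^ ((α / 2 : ℝ) : ℂ) := by
    have hY := h.ne_zero hK hρ
    have hX2 : 0 < X ^ 2 := by positivity
    rw [Complex.cpow_def_of_ne_zero (mul_ne_zero (Complex.ofReal_ne_zero.2 hX2.ne') hY),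
      Complex.cpow_def_of_ne_zero hY, Complex.log_ofReal_mul hX2 hY, add_mul, Complex.exp_add,
      Real.rpow_def_of_pos hX, Complex.ofReal_exp, Real.log_pow]
    congr 2
    push_cast; ring
  have e2 : Y ^ ((α / 2 : ℝ) : ℂ) - (X ^ (2 - α) : ℝ) * Y =
      (X ^ (-α) : ℝ) * (((X ^ 2 : ℝ) * Y) ^ ((α / 2 : ℝ) : ℂ) - (X ^ 2 : ℝ) * Y) := by
    rw [e1, mul_sub, ← mul_assoc, ← mul_assoc, ← Complex.ofReal_mul, ← Complex.ofReal_mul,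
      ← Real.rpow_add hX, ← Real.rpow_natCast, ← Real.rpow_add hX]
    norm_num
    left
    congr 1; ring
  rw [e2, norm_mul, Complex.norm_real, Real.norm_of_nonneg (by positivity)]
  calc _ ≤ X ^ (-α) * _ := mul_le_mul_of_nonneg_left hs (by positivity)
    _ = _ := by ring

end Sectorial

/-! ### First and second order estimates for the exponential -/

theorem norm_one_sub_exp_neg_le {z : ℂ} (hz : 0 ≤ z.re) : ‖1 - Complex.exp (-z)‖ ≤ ‖z‖ := by
  have hconv : Convex ℝ {w : ℂ | 0 ≤ w.re} := convex_halfSpace_re_ge 0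
  have := hconv.norm_image_sub_le_of_norm_hasDerivWithin_le (𝕜 := ℂ)
    (f := fun w => 1 - Complex.exp (-w)) (f' := fun w => Complex.exp (-w)) (C := 1) (x := 0) (y := z)
    (fun w _ => by
      have := ((hasDerivAt_id w).neg.cexp).const_sub 1
      simpa using this.hasDerivWithinAt)
    (fun w hw => by
      rw [Complex.norm_exp, Complex.neg_re]
      exact Real.exp_le_one_iff.2 (by simpa using hw)) (by simp) hz
  simpa using this

/-- The second order remainder of `exp (-a)` is Lipschitz with constant `‖a‖ + ‖b‖`. -/
theorem norm_exp_neg_remainder_sub_le {a b : ℂ} (ha : 0 ≤ a.re) (hb : 0 ≤ b.re) :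
    ‖(Complex.exp (-a) - 1 + a) - (Complex.exp (-b) - 1 + b)‖ ≤ ‖a - b‖ * (‖a‖ + ‖b‖) := by
  have hconv : Convex ℝ ({w : ℂ | 0 ≤ w.re} ∩ Metric.closedBall 0 (‖a‖ + ‖b‖)) :=
    (convex_halfSpace_re_ge 0).inter (convex_closedBall _ _)
  have := hconv.norm_image_sub_le_of_norm_hasDerivWithin_le (𝕜 := ℂ)
    (f := fun w => Complex.exp (-w) - 1 + w) (f' := fun w => 1 - Complex.exp (-w))
    (C := ‖a‖ + ‖b‖) (x := b) (y := a)
    (fun w _ => by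
      have := (((hasDerivAt_id w).neg.cexp).sub_const 1).add (hasDerivAt_id w)
      simp only [Pi.neg_apply, id] at this
      refine (this.congr_deriv ?_).hasDerivWithinAt
      ring)
    (fun w hw => (norm_one_sub_exp_neg_le hw.1).trans (by simpa using hw.2))
    ⟨hb, by simp⟩ ⟨ha, by simp⟩
  rw [mul_comm]
  exact this

/-- The sum of both exponentials on the right lets each of them later be integrated at its own
scale. -/
theorem abs_exp_neg_sub_exp_neg_le (a b : ℝ) :
    |Real.exp (-a) - Real.exp (-b)| ≤ |a - b| * (Real.exp (-a) + Real.exp (-b)) := by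
  wlog h : a ≤ b generalizing a b
  · rw [abs_sub_comm, abs_sub_comm a, add_comm]
    exact this b a (le_of_not_ge h)
  have h1 : Real.exp (-b) ≤ Real.exp (-a) := Real.exp_le_exp.2 (by linarith)
  rw [abs_of_nonneg (by linarith), abs_of_nonpos (by linarith)]
  have h2 : Real.exp (-b) = Real.exp (-a) * Real.exp (-(b - a)) := by
    rw [← Real.exp_add]; congr 1; ring
  have h3 := Real.add_one_le_exp (-(b - a))
  have h4 := Real.exp_pos (-a)
  have h5 := Real.exp_pos (-b)
  nlinarith

end StableKernel

/-! ### Shifting horizontal lines, and substitutions of the real line -/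

namespace StableKernel

/-- The integrals of a holomorphic function along two horizontal lines agree if the function decays
quadratically in the strip between them. -/
theorem integral_horizontal_shift {G : ℂ → ℂ} {C y₁ y₂ : ℝ}
    (hG : ∀ z : ℂ, z.im ∈ Set.uIcc y₁ y₂ → DifferentiableAt ℂ G z)
    (hb : ∀ z : ℂ, z.im ∈ Set.uIcc y₁ y₂ → ‖G z‖ ≤ C * (1 + z.re ^ 2)⁻¹) :
    ∫ x : ℝ, G (x + y₁ * Complex.I) = ∫ x : ℝ, G (x + y₂ * Complex.I) := by
  have hint : ∀ y ∈ Set.uIcc y₁ y₂, Integrable fun x : ℝ => G (x + y * Complex.I) := by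
    intro y hy
    refine (integrable_inv_one_add_sq.const_mul C).mono' ?_ (ae_of_all _ fun x => ?_)
    · refine Continuous.aestronglyMeasurable (continuous_iff_continuousAt.2 fun x => ?_)
      exact ContinuousAt.comp (f := fun x : ℝ => (x + y * Complex.I : ℂ)) (g := G)
        (hG _ (by simpa using hy)).continuousAt (by fun_prop)
    · simpa using hb (x + y * Complex.I) (by simpa using hy)
  have lim : ∀ y ∈ Set.uIcc y₁ y₂, Tendsto (fun R : ℝ => ∫ x in (-R)..R, G (x + y * Complex.I))
      atTop (𝓝 (∫ x : ℝ, G (x + y * Complex.I))) := fun y hy =>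
    intervalIntegral_tendsto_integral (hint y hy) tendsto_neg_atTop_atBot tendsto_id
  have hsq : Tendsto (fun R : ℝ => C * (1 + R ^ 2)⁻¹ * |y₂ - y₁|) atTop (𝓝 0) := by
    have h1 : Tendsto (fun R : ℝ => (1 + R ^ 2)⁻¹) atTop (𝓝 0) :=
      tendsto_inv_atTop_zero.comp
        (tendsto_atTop_add_const_left _ _ (tendsto_pow_atTop two_ne_zero))
    simpa using (h1.const_mul C).mul_const |y₂ - y₁|
  have side : ∀ R : ℝ, ‖∫ y in y₁..y₂, G (R + y * Complex.I)‖ ≤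
      C * (1 + R ^ 2)⁻¹ * |y₂ - y₁| := by
    intro R
    refine intervalIntegral.norm_integral_le_of_norm_le_const fun y hy => ?_
    simpa using hb (R + y * Complex.I) (by simpa using Set.uIoc_subset_uIcc hy)
  have hs1 : Tendsto (fun R : ℝ => ∫ y in y₁..y₂, G ((R : ℝ) + y * Complex.I)) atTop (𝓝 0) :=
    squeeze_zero_norm side hsq
  have hs2 : Tendsto (fun R : ℝ => ∫ y in y₁..y₂, G ((-R : ℝ) + y * Complex.I)) atTop (𝓝 0) :=
    squeeze_zero_norm (fun R => by simpa using side (-R)) hsq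
  have hrect : ∀ R : ℝ, (∫ x in (-R)..R, G (x + y₁ * Complex.I)) -
      (∫ x in (-R)..R, G (x + y₂ * Complex.I)) +
      Complex.I • (∫ y in y₁..y₂, G ((R : ℝ) + y * Complex.I)) -
      Complex.I • (∫ y in y₁..y₂, G ((-R : ℝ) + y * Complex.I)) = 0 := by
    intro R
    have := Complex.integral_boundary_rect_eq_zero_of_differentiableOn G ⟨-R, y₁⟩ ⟨R, y₂⟩
      (fun z hz => (hG z (by simpa using hz.2)).differentiableWithinAt)
    simpa using this
  have hlim := (((lim y₁ Set.left_mem_uIcc).sub (lim y₂ Set.right_mem_uIcc)).add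
    (hs1.const_smul Complex.I)).sub (hs2.const_smul Complex.I)
  have h0 := tendsto_nhds_unique (hlim.congr hrect) tendsto_const_nhds
  simpa [sub_eq_zero] using h0

/-- After `u = m sinh x` the integrands decay like `1 / cosh x`; this turns it into the quadratic
decay asked for by `integral_horizontal_shift`. -/
theorem one_add_sq_div_four_le_cosh (x : ℝ) : (1 + x ^ 2) / 4 ≤ Real.cosh x := by
  rw [← Real.cosh_abs, Real.cosh_eq]
  have h1 := Real.quadratic_le_exp_of_nonneg (abs_nonneg x)
  have h2 := Real.exp_pos (-|x|)
  have h3 := abs_nonneg x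
  rw [sq_abs] at h1
  linarith

theorem integral_eq_integral_sinh {m : ℝ} (hm : 0 < m) (f : ℝ → ℂ) :
    ∫ u, f u = ∫ x : ℝ, f (m * Real.sinh x) * (m * Real.cosh x : ℝ) := by
  have himg : (fun x => m * Real.sinh x) '' Set.univ = Set.univ := by
    rw [Set.image_univ, Set.range_eq_univ]
    intro y
    obtain ⟨x, hx⟩ := Real.sinh_surjective (y / m)
    exact ⟨x, by simp only [hx]; field_simp⟩
  have := integral_image_eq_integral_abs_deriv_smul (s := Set.univ) MeasurableSet.univ
    (f := fun x => m * Real.sinh x) (f' := fun x => m * Real.cosh x)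
    (fun x _ => ((Real.hasDerivAt_sinh x).const_mul m).hasDerivWithinAt)
    (fun x _ y _ h => Real.sinh_injective (mul_left_cancel₀ hm.ne' h)) f
  rw [himg, Measure.restrict_univ] at this
  rw [this]
  refine integral_congr_ae (ae_of_all _ fun x => ?_)
  simp only [abs_of_pos (mul_pos hm (Real.cosh_pos x)), Complex.real_smul]
  ring

theorem integrable_exp_mul_comp_exp {f : ℝ → ℂ} (hf : Integrable f) :
    Integrable (fun x : ℝ => f (Real.exp x) * (Real.exp x : ℝ)) ∧
      ∫ u in Set.Ioi 0, f u = ∫ x : ℝ, f (Real.exp x) * (Real.exp x : ℝ) := by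
  have himg : Real.exp '' Set.univ = Set.Ioi 0 := by rw [Set.image_univ, Real.range_exp]
  have hd : ∀ x ∈ (Set.univ : Set ℝ), HasDerivWithinAt Real.exp (Real.exp x) Set.univ x :=
    fun x _ => (Real.hasDerivAt_exp x).hasDerivWithinAt
  have hcongr : (fun x => |Real.exp x| • f (Real.exp x)) =
      fun x => f (Real.exp x) * (Real.exp x : ℝ) := by
    funext x
    rw [abs_of_pos (Real.exp_pos x), Complex.real_smul, mul_comm]
  have h1 := integrableOn_image_iff_integrableOn_abs_deriv_smul MeasurableSet.univ hd
    Real.exp_injective.injOn f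
  have h2 := integral_image_eq_integral_abs_deriv_smul MeasurableSet.univ hd
    Real.exp_injective.injOn f
  rw [himg, hcongr, integrableOn_univ] at h1
  rw [himg, hcongr, Measure.restrict_univ] at h2
  exact ⟨h1.1 hf.integrableOn, h2⟩

/-- The line is cut at the origin. The left half is run through by `-exp (-x)`, so that both halves
are traversed from left to right and continue holomorphically over the same strip. -/
theorem integral_eq_integral_exp_add {f : ℝ → ℂ} (hf : Integrable f) :
    ∫ u, f u = ∫ x : ℝ, (f (Real.exp x) * (Real.exp x : ℝ) +
      f (-Real.exp (-x)) * (Real.exp (-x) : ℝ)) := by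
  have hp := integrable_exp_mul_comp_exp hf
  have hn := integrable_exp_mul_comp_exp hf.comp_neg
  have hn2 : ∫ u in Set.Iic 0, f u =
      ∫ x : ℝ, f (-Real.exp (-x)) * (Real.exp (-x) : ℝ) := by
    rw [integral_neg_eq_self (fun x : ℝ => f (-Real.exp x) * (Real.exp x : ℝ)), ← hn.2,
      integral_comp_neg_Ioi, neg_zero]
  rw [integral_add hp.1 hn.1.comp_neg, ← hp.2, ← hn2, ← Set.compl_Ioi, integral_add_compl₀ (by measurability) hf]

end StableKernel

/-! ### Hyperbolic contours and Cauchy's theorem for them -/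

namespace StableKernel

/-- A hyperbola (two rays if `m = 0`) in the lower half plane, parametrized by the real line. -/
noncomputable def contour (m θ u : ℝ) : ℂ :=
  u * Real.cos θ - √(u ^ 2 + m ^ 2) * Real.sin θ * Complex.I

/-- The derivative of `contour m θ`. -/
noncomputable def contourDeriv (m θ u : ℝ) : ℂ :=
  Real.cos θ - u / √(u ^ 2 + m ^ 2) * Real.sin θ * Complex.I

theorem contour_re (m θ u : ℝ) : (contour m θ u).re = u * Real.cos θ := by
  simp [contour, -Complex.ofReal_cos, -Complex.ofReal_sin]

theorem contour_im (m θ u : ℝ) :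
    (contour m θ u).im = -(√(u ^ 2 + m ^ 2) * Real.sin θ) := by
  simp [contour, -Complex.ofReal_cos, -Complex.ofReal_sin]

theorem norm_contour_le (m θ u : ℝ) : ‖contour m θ u‖ ≤ √(u ^ 2 + m ^ 2) := by
  rw [← Complex.re_add_im (contour m θ u), Complex.norm_add_mul_I, contour_re, contour_im]
  refine Real.sqrt_le_sqrt ?_
  rw [neg_sq, mul_pow, mul_pow, Real.sq_sqrt (by positivity)]
  nlinarith [Real.sin_sq_add_cos_sq θ, sq_nonneg (m * Real.cos θ), sq_nonneg (u * Real.cos θ)]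

theorem norm_contourDeriv_le (m θ u : ℝ) : ‖contourDeriv m θ u‖ ≤ 1 := by
  have h1 : contourDeriv m θ u =
      (Real.cos θ : ℝ) + (-(u / √(u ^ 2 + m ^ 2) * Real.sin θ) : ℝ) * Complex.I := by
    simp [contourDeriv, sub_eq_add_neg]
  have h2 : (u / √(u ^ 2 + m ^ 2)) ^ 2 ≤ 1 := by
    rw [div_pow, Real.sq_sqrt (by positivity)]
    exact div_le_one_of_le₀ (by nlinarith [sq_nonneg m]) (by positivity)
  rw [h1, Complex.norm_add_mul_I]
  refine Real.sqrt_le_one.2 ?_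
  rw [neg_sq, mul_pow]
  nlinarith [Real.sin_sq_add_cos_sq θ, sq_nonneg (Real.sin θ)]

theorem continuous_contour (m θ : ℝ) : Continuous (contour m θ) := by
  unfold contour
  fun_prop

theorem contour_zero_angle (m u : ℝ) : contour m 0 u = u := by simp [contour]

theorem contourDeriv_zero_angle (m u : ℝ) : contourDeriv m 0 u = 1 := by simp [contourDeriv]

theorem integrable_contour {m θ C : ℝ} {F : ℂ → ℂ}
    (hd : ∀ u : ℝ, 0 < u ^ 2 + m ^ 2 → DifferentiableAt ℂ F (contour m θ u))
    (hb : ∀ u : ℝ, 0 < u ^ 2 + m ^ 2 → ‖F (contour m θ u)‖ ≤ C * (1 + (u ^ 2 + m ^ 2))⁻¹) :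
    Integrable fun u => F (contour m θ u) * contourDeriv m θ u := by
  have hne : ∀ᵐ u : ℝ, u ≠ 0 := by simp [ae_iff]
  have hpos : ∀ u : ℝ, u ≠ 0 → 0 < u ^ 2 + m ^ 2 := fun u hu => by positivity
  refine (integrable_inv_one_add_sq.const_mul |C|).mono' ?_ ?_
  · have hc : ContinuousOn (fun u => F (contour m θ u) * contourDeriv m θ u) {0}ᶜ := by
      intro u hu
      have hu' := hpos u hu
      refine ContinuousAt.continuousWithinAt (ContinuousAt.mul ?_ ?_)
      · exact (hd u hu').continuousAt.comp (continuous_contour m θ).continuousAt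
      · unfold contourDeriv
        have h1 : ContinuousAt (fun u : ℝ => u / √(u ^ 2 + m ^ 2)) u :=
          ContinuousAt.div (by fun_prop) (by fun_prop) (Real.sqrt_pos.2 hu').ne'
        have h2 : ContinuousAt (fun u : ℝ => ((u / √(u ^ 2 + m ^ 2) : ℝ) : ℂ)) u :=
          Complex.continuous_ofReal.continuousAt.comp h1
        simp only [Complex.ofReal_div] at h2
        fun_prop
    have := hc.aestronglyMeasurable (μ := volume) (measurableSet_singleton (0 : ℝ)).compl
    rwa [Measure.restrict_eq_self_of_ae_mem (by simpa using hne)] at this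
  · filter_upwards [hne] with u hu
    rw [norm_mul]
    calc ‖F (contour m θ u)‖ * ‖contourDeriv m θ u‖
        ≤ ‖F (contour m θ u)‖ * 1 := by gcongr; exact norm_contourDeriv_le m θ u
      _ ≤ C * (1 + (u ^ 2 + m ^ 2))⁻¹ := by rw [mul_one]; exact hb u (hpos u hu)
      _ ≤ |C| * (1 + u ^ 2)⁻¹ := by
          gcongr
          · exact le_abs_self C
          · nlinarith [sq_nonneg m]

theorem sqrt_sinh_sq_add_sq {m : ℝ} (hm : 0 ≤ m) (x : ℝ) :
    √((m * Real.sinh x) ^ 2 + m ^ 2) = m * Real.cosh x := by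
  rw [← Real.sqrt_sq (mul_nonneg hm (Real.cosh_pos x).le)]
  congr 1
  nlinarith [Real.cosh_sq x]

/-- In the coordinate `u = m sinh x` the hyperbola of angle `θ` is the image of the horizontal line
`Im w = -θ` under `m sinh`. Turning the hyperbola is thus shifting a horizontal line. -/
theorem contour_sinh {m : ℝ} (hm : 0 ≤ m) (θ x : ℝ) :
    contour m θ (m * Real.sinh x) = m * Complex.sinh (x + (-θ : ℝ) * Complex.I) := by
  rw [contour, sqrt_sinh_sq_add_sq hm, Complex.sinh_add, Complex.sinh_mul_I, Complex.cosh_mul_I]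
  push_cast
  rw [Complex.cos_neg, Complex.sin_neg]
  ring

theorem contourDeriv_sinh {m : ℝ} (hm : 0 < m) (θ x : ℝ) :
    contourDeriv m θ (m * Real.sinh x) * (m * Real.cosh x : ℝ) =
      m * Complex.cosh (x + (-θ : ℝ) * Complex.I) := by
  have h1 : (Complex.cosh x) ≠ 0 := by
    rw [← Complex.ofReal_cosh]
    exact_mod_cast (Real.cosh_pos x).ne'
  have h2 : (m : ℂ) ≠ 0 := by exact_mod_cast hm.ne'
  rw [contourDeriv, sqrt_sinh_sq_add_sq hm.le, Complex.cosh_add, Complex.sinh_mul_I,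
    Complex.cosh_mul_I]
  push_cast
  rw [Complex.cos_neg, Complex.sin_neg]
  field_simp
  ring

theorem norm_cosh_le (z : ℂ) : ‖Complex.cosh z‖ ≤ Real.cosh z.re := by
  rw [Complex.cosh, Real.cosh_eq, norm_div, Complex.norm_ofNat]
  gcongr
  refine (norm_add_le _ _).trans_eq ?_
  rw [Complex.norm_exp, Complex.norm_exp, Complex.neg_re]

/-- For `m = 0` the right ray is the image of the line `Im w = -θ` under `exp`; the left ray is its
image under `w ↦ -exp (-w)`. -/
theorem contour_zero_exp (θ x : ℝ) :
    contour 0 θ (Real.exp x) = Complex.exp (x + (-θ : ℝ) * Complex.I) := by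
  rw [contour, Complex.exp_add, Complex.exp_mul_I]
  simp only [ne_eq, OfNat.ofNat_ne_zero, not_false_eq_true, zero_pow, add_zero,
    Real.sqrt_sq (Real.exp_pos x).le]
  push_cast
  rw [Complex.cos_neg, Complex.sin_neg]
  ring

theorem contour_zero_neg_exp (θ x : ℝ) :
    contour 0 θ (-Real.exp (-x)) = -Complex.exp (-(x + (-θ : ℝ) * Complex.I)) := by
  have e : -((x : ℂ) + (-θ : ℝ) * Complex.I) = (-x : ℂ) + θ * Complex.I := by push_cast; ring
  rw [contour, e, Complex.exp_add, Complex.exp_mul_I]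
  simp only [ne_eq, OfNat.ofNat_ne_zero, not_false_eq_true, zero_pow, add_zero, neg_sq,
    Real.sqrt_sq (Real.exp_pos _).le]
  push_cast
  ring

theorem contourDeriv_zero_exp (θ x : ℝ) :
    contourDeriv 0 θ (Real.exp x) * (Real.exp x : ℝ) =
      Complex.exp (x + (-θ : ℝ) * Complex.I) := by
  rw [contourDeriv, Complex.exp_add, Complex.exp_mul_I]
  simp only [ne_eq, OfNat.ofNat_ne_zero, not_false_eq_true, zero_pow, add_zero,
    Real.sqrt_sq (Real.exp_pos x).le]
  rw [div_self (by exact_mod_cast (Real.exp_pos x).ne')]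
  push_cast
  rw [Complex.cos_neg, Complex.sin_neg]
  ring

theorem contourDeriv_zero_neg_exp (θ x : ℝ) :
    contourDeriv 0 θ (-Real.exp (-x)) * (Real.exp (-x) : ℝ) =
      Complex.exp (-(x + (-θ : ℝ) * Complex.I)) := by
  have e : -((x : ℂ) + (-θ : ℝ) * Complex.I) = (-x : ℂ) + θ * Complex.I := by push_cast; ring
  rw [contourDeriv, e, Complex.exp_add, Complex.exp_mul_I]
  simp only [ne_eq, OfNat.ofNat_ne_zero, not_false_eq_true, zero_pow, add_zero, neg_sq,
    Real.sqrt_sq (Real.exp_pos _).le]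
  rw [Complex.ofReal_neg, neg_div, div_self (by exact_mod_cast (Real.exp_pos _).ne')]
  push_cast
  ring

variable {m θ₁ θ₂ C : ℝ} {F : ℂ → ℂ}

/-- The pulled back integrand `F (m sinh w) m cosh w` is bounded by a multiple of `1 / (m cosh (Re
w))`, so the horizontal shift applies. The constant `4 / m` blows up as `m → 0`, and the degenerate
hyperbola needs its own argument. -/
theorem integral_contour_eq_of_pos (hm : 0 < m) (hθ : θ₁ ≤ θ₂)
    (hd : ∀ θ ∈ Set.Icc θ₁ θ₂, ∀ u : ℝ, DifferentiableAt ℂ F (contour m θ u))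
    (hb : ∀ θ ∈ Set.Icc θ₁ θ₂, ∀ u : ℝ,
      ‖F (contour m θ u)‖ ≤ C * (1 + (u ^ 2 + m ^ 2))⁻¹) :
    ∫ u, F (contour m θ₁ u) * contourDeriv m θ₁ u =
      ∫ u, F (contour m θ₂ u) * contourDeriv m θ₂ u := by
  have hsub : ∀ θ : ℝ, ∫ u, F (contour m θ u) * contourDeriv m θ u =
      ∫ x : ℝ, (fun w : ℂ => F (m * Complex.sinh w) * (m * Complex.cosh w))
        (x + (-θ : ℝ) * Complex.I) := by
    intro θ
    rw [integral_eq_integral_sinh hm]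
    refine integral_congr_ae (ae_of_all _ fun x => ?_)
    simp only [mul_assoc, contourDeriv_sinh hm, contour_sinh hm.le]
  rw [hsub, hsub]
  have hstrip : ∀ z : ℂ, z.im ∈ Set.uIcc (-θ₁) (-θ₂) → ∃ θ ∈ Set.Icc θ₁ θ₂,
      z = z.re + (-θ : ℝ) * Complex.I := by
    intro z hz
    rw [Set.uIcc_of_ge (by linarith)] at hz
    exact ⟨-z.im, ⟨by linarith [hz.2], by linarith [hz.1]⟩, by simp⟩
  refine integral_horizontal_shift (G := fun w : ℂ => F (m * Complex.sinh w) * (m * Complex.cosh w))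
    (C := |C| * (4 / m)) (y₁ := -θ₁) (y₂ := -θ₂) (fun z hz => ?_) fun z hz => ?_
  · obtain ⟨θ, hθ', hz'⟩ := hstrip z hz
    have h1 : DifferentiableAt ℂ F (m * Complex.sinh z) := by
      rw [hz', ← contour_sinh hm.le]
      exact hd θ hθ' _
    refine DifferentiableAt.mul ?_ ?_
    · exact h1.comp z ((Complex.differentiable_sinh z).const_mul _)
    · exact (Complex.differentiable_cosh z).const_mul _
  · obtain ⟨θ, hθ', hz'⟩ := hstrip z hz
    have h1 : ‖F (m * Complex.sinh z)‖ ≤ C * (1 + ((m * Real.cosh z.re) ^ 2))⁻¹ := by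
      have := hb θ hθ' (m * Real.sinh z.re)
      rwa [contour_sinh hm.le, ← hz', ← Real.sq_sqrt (show 0 ≤ (m * Real.sinh z.re) ^ 2 + m ^ 2
        by positivity), sqrt_sinh_sq_add_sq hm.le] at this
    have hc := Real.cosh_pos z.re
    rw [norm_mul, norm_mul, Complex.norm_real, Real.norm_of_nonneg hm.le]
    calc _ ≤ (|C| * (1 + ((m * Real.cosh z.re) ^ 2))⁻¹) * (m * Real.cosh z.re) := by
          gcongr
          · exact h1.trans (by gcongr; exact le_abs_self C)
          · exact norm_cosh_le z
      _ ≤ |C| * (m * Real.cosh z.re)⁻¹ := by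
          rw [mul_assoc]
          gcongr
          rw [inv_mul_le_iff₀ (by positivity)]
          have : 0 < m * Real.cosh z.re := by positivity
          rw [← div_eq_mul_inv, le_div_iff₀ this]
          nlinarith
      _ ≤ |C| * (m * ((1 + z.re ^ 2) / 4))⁻¹ := by
          gcongr
          exact one_add_sq_div_four_le_cosh _
      _ = _ := by
          field_simp

/-- Here `F` may be singular at the vertex, which the exponential substitution sends to infinity.
The Jacobian provides decay at both ends, because `exp x / (1 + exp (2 x)) = 1 / (2 cosh x)`. -/
theorem integral_contour_eq_of_zero (hθ : θ₁ ≤ θ₂)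
    (hd : ∀ θ ∈ Set.Icc θ₁ θ₂, ∀ u : ℝ, u ≠ 0 → DifferentiableAt ℂ F (contour 0 θ u))
    (hb : ∀ θ ∈ Set.Icc θ₁ θ₂, ∀ u : ℝ, u ≠ 0 → ‖F (contour 0 θ u)‖ ≤ C * (1 + u ^ 2)⁻¹) :
    ∫ u, F (contour 0 θ₁ u) * contourDeriv 0 θ₁ u =
      ∫ u, F (contour 0 θ₂ u) * contourDeriv 0 θ₂ u := by
  have hsub : ∀ θ ∈ Set.Icc θ₁ θ₂, ∫ u, F (contour 0 θ u) * contourDeriv 0 θ u =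
      ∫ x : ℝ, (fun w : ℂ => F (Complex.exp w) * Complex.exp w +
        F (-Complex.exp (-w)) * Complex.exp (-w)) (x + (-θ : ℝ) * Complex.I) := by
    intro θ hθ'
    rw [integral_eq_integral_exp_add (integrable_contour (C := C)
      (fun u hu => hd θ hθ' u (by rintro rfl; simp at hu))
      (fun u hu => by simpa using hb θ hθ' u (by rintro rfl; simp at hu)))]
    refine integral_congr_ae (ae_of_all _ fun x => ?_)
    simp only [mul_assoc, contourDeriv_zero_exp, contour_zero_exp, contourDeriv_zero_neg_exp,
      contour_zero_neg_exp]
  rw [hsub _ (Set.left_mem_Icc.2 hθ), hsub _ (Set.right_mem_Icc.2 hθ)]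
  have hstrip : ∀ z : ℂ, z.im ∈ Set.uIcc (-θ₁) (-θ₂) → ∃ θ ∈ Set.Icc θ₁ θ₂,
      z = z.re + (-θ : ℝ) * Complex.I := by
    intro z hz
    rw [Set.uIcc_of_ge (by linarith)] at hz
    exact ⟨-z.im, ⟨by linarith [hz.2], by linarith [hz.1]⟩, by simp⟩
  have hexp : ∀ x : ℝ, (1 + Real.exp x ^ 2)⁻¹ * Real.exp x ≤ 2 * (1 + x ^ 2)⁻¹ := by
    intro x
    have h1 := one_add_sq_div_four_le_cosh x
    have h2 : (1 + Real.exp x ^ 2)⁻¹ * Real.exp x = (2 * Real.cosh x)⁻¹ := by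
      have := Real.exp_pos x
      rw [Real.cosh_eq, Real.exp_neg]
      field_simp
      ring
    rw [h2]
    calc (2 * Real.cosh x)⁻¹ ≤ (2 * ((1 + x ^ 2) / 4))⁻¹ := by gcongr
      _ = _ := by field_simp; norm_num
  refine integral_horizontal_shift (G := fun w : ℂ => F (Complex.exp w) * Complex.exp w +
    F (-Complex.exp (-w)) * Complex.exp (-w)) (C := |C| * 4) (y₁ := -θ₁) (y₂ := -θ₂) (fun z hz => ?_) fun z hz => ?_
  · obtain ⟨θ, hθ', hz'⟩ := hstrip z hz
    have h1 : DifferentiableAt ℂ F (Complex.exp z) := by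
      rw [hz', ← contour_zero_exp]
      exact hd θ hθ' _ (Real.exp_pos _).ne'
    have h2 : DifferentiableAt ℂ F (-Complex.exp (-z)) := by
      rw [hz', ← contour_zero_neg_exp]
      exact hd θ hθ' _ (neg_ne_zero.2 (Real.exp_pos _).ne')
    refine DifferentiableAt.add (DifferentiableAt.mul ?_ (by fun_prop))
      (DifferentiableAt.mul ?_ (by fun_prop))
    · exact h1.comp z (by fun_prop)
    · exact h2.comp z (by fun_prop)
  · obtain ⟨θ, hθ', hz'⟩ := hstrip z hz
    have h1 : ‖F (Complex.exp z)‖ ≤ C * (1 + Real.exp z.re ^ 2)⁻¹ := by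
      have := hb θ hθ' (Real.exp z.re) (Real.exp_pos _).ne'
      rwa [contour_zero_exp, ← hz'] at this
    have h2 : ‖F (-Complex.exp (-z))‖ ≤ C * (1 + Real.exp (-z.re) ^ 2)⁻¹ := by
      have := hb θ hθ' (-Real.exp (-z.re)) (neg_ne_zero.2 (Real.exp_pos _).ne')
      rwa [contour_zero_neg_exp, ← hz', neg_sq] at this
    have e1 := hexp z.re
    have e2 := hexp (-z.re)
    rw [neg_sq] at e2
    refine (norm_add_le _ _).trans ?_
    rw [norm_mul, norm_mul, Complex.norm_exp, Complex.norm_exp, Complex.neg_re]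
    calc _ ≤ |C| * (1 + Real.exp z.re ^ 2)⁻¹ * Real.exp z.re +
          |C| * (1 + Real.exp (-z.re) ^ 2)⁻¹ * Real.exp (-z.re) := by
          gcongr
          · exact h1.trans (by gcongr; exact le_abs_self C)
          · exact h2.trans (by gcongr; exact le_abs_self C)
      _ ≤ |C| * (2 * (1 + z.re ^ 2)⁻¹) + |C| * (2 * (1 + z.re ^ 2)⁻¹) := by
          rw [mul_assoc, mul_assoc]
          gcongr
      _ = _ := by ring

/-- Cauchy's theorem for the family of hyperbolas `contour m θ`. -/
theorem integral_contour_eq (hm : 0 ≤ m) (hθ : θ₁ ≤ θ₂)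
    (hd : ∀ θ ∈ Set.Icc θ₁ θ₂, ∀ u : ℝ, 0 < u ^ 2 + m ^ 2 →
      DifferentiableAt ℂ F (contour m θ u))
    (hb : ∀ θ ∈ Set.Icc θ₁ θ₂, ∀ u : ℝ, 0 < u ^ 2 + m ^ 2 →
      ‖F (contour m θ u)‖ ≤ C * (1 + (u ^ 2 + m ^ 2))⁻¹) :
    ∫ u, F (contour m θ₁ u) * contourDeriv m θ₁ u =
      ∫ u, F (contour m θ₂ u) * contourDeriv m θ₂ u := by
  rcases hm.eq_or_lt with rfl | hm
  · refine integral_contour_eq_of_zero (C := C) hθ (fun θ h u hu => hd θ h u (by positivity))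
      fun θ h u hu => ?_
    simpa using hb θ h u (by positivity)
  · exact integral_contour_eq_of_pos hm hθ (fun θ h u => hd θ h u (by positivity))
      fun θ h u => hb θ h u (by positivity)

/-- On the extreme contour, which runs through the imaginary axis twice in opposite directions,
every integral vanishes. -/
theorem integral_contour_pi_div_two (m : ℝ) (F : ℂ → ℂ) :
    ∫ u, F (contour m (Real.pi / 2) u) * contourDeriv m (Real.pi / 2) u = 0 := by
  have h : ∀ u, F (contour m (Real.pi / 2) (-u)) * contourDeriv m (Real.pi / 2) (-u) =
      -(F (contour m (Real.pi / 2) u) * contourDeriv m (Real.pi / 2) u) := by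
    intro u
    simp [contour, contourDeriv, neg_div]
  have h2 := integral_neg_eq_self
    (fun u => F (contour m (Real.pi / 2) u) * contourDeriv m (Real.pi / 2) u) volume
  simp only [h, integral_neg] at h2
  exact self_eq_neg.1 h2.symm

end StableKernel

/-! ### Elementary radial bounds, uniform in the exponent -/

namespace StableKernel

/-- Only `ρ ≥ 1` matters. There `n ≥ N / γ₀` gives `ρ ^ N ≤ (ρ ^ γ) ^ n` for all `γ ≥ γ₀` at once,
and `y ^ n / n! ≤ exp y` concludes. -/
theorem exists_pow_mul_exp_neg_rpow_le (N : ℕ) {c γ₀ : ℝ} (hc : 0 < c) (hγ₀ : 0 < γ₀) :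
    ∃ C : ℝ, 0 < C ∧ ∀ ρ : ℝ, 0 < ρ → ∀ γ : ℝ, γ₀ ≤ γ →
      (1 + ρ) ^ N * Real.exp (-(c * ρ ^ γ)) ≤ C := by
  set n := ⌈N / γ₀⌉₊ with hn
  have hnN : (N : ℝ) ≤ γ₀ * n := by
    have := Nat.le_ceil (N / γ₀)
    rw [← hn, div_le_iff₀ hγ₀] at this
    linarith
  refine ⟨2 ^ N + 2 ^ N * (n.factorial / c ^ n), by positivity, fun ρ hρ γ hγ => ?_⟩
  have hC1 : 0 ≤ (2 : ℝ) ^ N * (n.factorial / c ^ n) := by positivity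
  rcases le_total ρ 1 with h1 | h1
  · have : (1 + ρ) ^ N * Real.exp (-(c * ρ ^ γ)) ≤ 2 ^ N * 1 := by
      gcongr
      · linarith
      · exact Real.exp_le_one_iff.2 (by simp; positivity)
    linarith
  · have hx : 0 < c * ρ ^ γ := by positivity
    have hexp : Real.exp (-(c * ρ ^ γ)) ≤ n.factorial / (c * ρ ^ γ) ^ n := by
      rw [Real.exp_neg, ← inv_div]
      gcongr
      exact Real.pow_div_factorial_le_exp _ hx.le n
    have hpow : ρ ^ N ≤ (ρ ^ γ) ^ n := by
      rw [← Real.rpow_natCast, ← Real.rpow_natCast, ← Real.rpow_mul hρ.le]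
      refine Real.rpow_le_rpow_of_exponent_le h1 (hnN.trans ?_)
      gcongr
    have : (1 + ρ) ^ N * Real.exp (-(c * ρ ^ γ)) ≤
        (2 * ρ) ^ N * (n.factorial / (c * ρ ^ γ) ^ n) := by
      gcongr
      linarith
    refine this.trans ?_
    calc (2 * ρ) ^ N * (n.factorial / (c * ρ ^ γ) ^ n)
        = 2 ^ N * (n.factorial / c ^ n) * (ρ ^ N / (ρ ^ γ) ^ n) := by
          rw [mul_pow, mul_pow]; field_simp
      _ ≤ 2 ^ N * (n.factorial / c ^ n) * 1 := by
          gcongr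
          exact div_le_one_of_le₀ hpow (by positivity)
      _ ≤ _ := by linarith [pow_pos (zero_lt_two' ℝ) N]

/-- For `ρ ≤ 1` the logarithm is absorbed by `ρ ^ α`, since `|log ρ| ρ ^ α ≤ 1 / α ≤ 1 / α₀`; for `ρ
≥ 1` it is at most `ρ`. This is one of the places where `α` must stay away from `0`. -/
theorem one_add_abs_log_mul_le {α₀ α ρ : ℝ} (hα₀ : 0 < α₀) (hα : α₀ ≤ α) (hα2 : α ≤ 2)
    (hρ : 0 < ρ) :
    (1 + |Real.log ρ|) * (ρ ^ α + ρ ^ 2) ≤ (2 + 2 / α₀) * (1 + ρ) ^ 3 := by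
  have e2 : ρ ^ 2 = ρ ^ (2 : ℝ) := by norm_cast
  have h0 : 0 ≤ 2 / α₀ := by positivity
  rcases le_total ρ 1 with h1 | h1
  · have h2 : ρ ^ 2 ≤ ρ ^ α := by
      rw [e2]; exact Real.rpow_le_rpow_of_exponent_ge hρ h1 hα2
    have h3 : ρ ^ α ≤ 1 := Real.rpow_le_one hρ.le h1 (by linarith)
    have h4 := (Real.abs_log_mul_self_rpow_lt ρ α hρ h1 (by linarith)).le
    rw [abs_mul, abs_of_pos (Real.rpow_pos_of_pos hρ α)] at h4
    have h5 : 1 / α ≤ 1 / α₀ := by gcongr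
    have h6 : 1 ≤ (1 + ρ) ^ 3 := one_le_pow₀ (by linarith)
    calc (1 + |Real.log ρ|) * (ρ ^ α + ρ ^ 2) ≤ (1 + |Real.log ρ|) * (ρ ^ α + ρ ^ α) := by gcongr
      _ = 2 * (ρ ^ α + |Real.log ρ| * ρ ^ α) := by ring
      _ ≤ 2 * (1 + 1 / α₀) := by linarith
      _ = (2 + 2 / α₀) * 1 := by ring
      _ ≤ _ := by gcongr
  · have h2 : ρ ^ α ≤ ρ ^ 2 := by
      rw [e2]; exact Real.rpow_le_rpow_of_exponent_le h1 hα2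
    have h3 : |Real.log ρ| ≤ ρ := by
      rw [abs_of_nonneg (Real.log_nonneg h1)]
      linarith [Real.log_le_sub_one_of_pos hρ]
    calc (1 + |Real.log ρ|) * (ρ ^ α + ρ ^ 2) ≤ (1 + ρ) * (ρ ^ 2 + ρ ^ 2) := by gcongr
      _ = 2 * ((1 + ρ) * ρ ^ 2) := by ring
      _ ≤ (2 + 2 / α₀) * ((1 + ρ) * (1 + ρ) ^ 2) := by
          gcongr
          · linarith
          · linarith
      _ = _ := by ring

/-! ### Quadratic forms along complex lines -/

/-- A measurable family of linear maps, uniformly bounded with uniformly bounded inverses. -/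
structure Elliptic {d : ℕ} {ι : Type*} [MeasurableSpace ι] (K : ℝ) (A : ι → E d →L[ℝ] E d) :
    Prop where
  one_le : 1 ≤ K
  measurable : ∀ ξ, Measurable fun r => A r ξ
  lower : ∀ r ξ, ‖ξ‖ ≤ K * ‖A r ξ‖
  upper : ∀ r ξ, ‖A r ξ‖ ≤ K * ‖ξ‖

/-- The holomorphic extension of `u ↦ ‖B (η + u • e)‖ ^ 2`. -/
noncomputable def quadLine {d : ℕ} (B : E d →L[ℝ] E d) (η e : E d) (z : ℂ) : ℂ :=
  ((‖B η‖ ^ 2 : ℝ) : ℂ) + 2 * z * ((inner ℝ (B η) (B e) : ℝ) : ℂ) + z ^ 2 * ((‖B e‖ ^ 2 : ℝ) : ℂ)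

section QuadLine

variable {d : ℕ} {B : E d →L[ℝ] E d} {η e : E d} {K : ℝ}

theorem norm_add_smul_sq (he : ‖e‖ = 1) (hη : inner ℝ η e = 0) (u : ℝ) :
    ‖η + u • e‖ ^ 2 = u ^ 2 + ‖η‖ ^ 2 := by
  rw [norm_add_sq_real, inner_smul_right, hη, norm_smul, he]
  simp
  ring

theorem norm_map_add_smul_sq (a : ℝ) : ‖B (η + a • e)‖ ^ 2 =
    ‖B η‖ ^ 2 + 2 * a * inner ℝ (B η) (B e) + a ^ 2 * ‖B e‖ ^ 2 := by
  rw [map_add, map_smul, norm_add_sq_real, inner_smul_right, norm_smul, mul_pow,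
    Real.norm_eq_abs, sq_abs]
  ring

theorem quadLine_ofReal (u : ℝ) :
    quadLine B η e u = ((‖B (η + u • e)‖ ^ 2 : ℝ) : ℂ) := by
  rw [norm_map_add_smul_sq, quadLine]
  push_cast
  ring

theorem quadLine_re (z : ℂ) : (quadLine B η e z).re =
    ‖B (η + z.re • e)‖ ^ 2 - z.im ^ 2 * ‖B e‖ ^ 2 := by
  rw [norm_map_add_smul_sq, quadLine]
  simp only [Complex.add_re, Complex.ofReal_re, Complex.ofReal_im, Complex.mul_re,
    Complex.re_ofNat, Complex.im_ofNat, pow_two]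
  ring

theorem quadLine_im (z : ℂ) : (quadLine B η e z).im =
    2 * z.im * inner ℝ (B (η + z.re • e)) (B e) := by
  rw [map_add, map_smul, inner_add_left, inner_smul_left, real_inner_self_eq_norm_sq, quadLine]
  simp only [Complex.add_im, Complex.ofReal_im, Complex.ofReal_re, Complex.mul_im,
    Complex.re_ofNat, Complex.im_ofNat, pow_two, conj_trivial]
  ring

theorem norm_quadLine_le_sq (z : ℂ) :
    ‖quadLine B η e z‖ ≤ (‖B (η + z.re • e)‖ + |z.im| * ‖B e‖) ^ 2 := by
  refine (Complex.norm_le_abs_re_add_abs_im _).trans ?_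
  rw [quadLine_re, quadLine_im, abs_mul, abs_mul, abs_two]
  have h1 := abs_real_inner_le_norm (B (η + z.re • e)) (B e)
  have h2 : |‖B (η + z.re • e)‖ ^ 2 - z.im ^ 2 * ‖B e‖ ^ 2| ≤
      ‖B (η + z.re • e)‖ ^ 2 + z.im ^ 2 * ‖B e‖ ^ 2 := by
    rw [abs_le]
    constructor <;> nlinarith [sq_nonneg (‖B (η + z.re • e)‖), sq_nonneg (z.im * ‖B e‖)]
  have h3 := mul_le_mul_of_nonneg_left h1 (abs_nonneg z.im)
  have h4 : |z.im| ^ 2 = z.im ^ 2 := sq_abs _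
  nlinarith

theorem norm_quadLine_le (hB : ∀ ξ, ‖B ξ‖ ≤ K * ‖ξ‖) (he : ‖e‖ = 1)
    (hη : inner ℝ η e = 0) (z : ℂ) :
    ‖quadLine B η e z‖ ≤ 2 * K ^ 2 * (z.re ^ 2 + ‖η‖ ^ 2 + z.im ^ 2) := by
  refine (norm_quadLine_le_sq z).trans ?_
  rw [← norm_add_smul_sq he hη z.re]
  have h1 := hB (η + z.re • e)
  have h2 := hB e
  rw [he, mul_one] at h2
  calc (‖B (η + z.re • e)‖ + |z.im| * ‖B e‖) ^ 2
      ≤ (K * ‖η + z.re • e‖ + |z.im| * K) ^ 2 := by gcongr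
    _ = K ^ 2 * (‖η + z.re • e‖ + |z.im|) ^ 2 := by ring
    _ ≤ K ^ 2 * (2 * (‖η + z.re • e‖ ^ 2 + |z.im| ^ 2)) := by
        gcongr; exact add_sq_le
    _ = _ := by rw [sq_abs]; ring

/-- With `n = ‖η + (Re z) e‖`, the real part is `‖B (η + (Re z) e)‖ ^ 2 - (Im z) ^ 2 ‖B e‖ ^ 2`. The
first term is at least `n ^ 2 / K ^ 2`, and the opening `1 / (2 K ^ 2)` keeps the second below a
quarter of that. The radius `ρ` may range between `n` and `√2 n`, because on a contour the natural
radius is `√(u ^ 2 + ‖η‖ ^ 2)` while `Re z = u cos θ`. -/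
theorem sectorial_quadLine (hK : 1 ≤ K) (hl : ∀ ξ, ‖ξ‖ ≤ K * ‖B ξ‖)
    (hB : ∀ ξ, ‖B ξ‖ ≤ K * ‖ξ‖) (he : ‖e‖ = 1) (hη : inner ℝ η e = 0) {z : ℂ} {ρ : ℝ}
    (hz : z.im ^ 2 ≤ (1 / (2 * K ^ 2)) ^ 2 * (z.re ^ 2 + ‖η‖ ^ 2))
    (h1 : z.re ^ 2 + ‖η‖ ^ 2 ≤ ρ ^ 2) (h2 : ρ ^ 2 ≤ 2 * (z.re ^ 2 + ‖η‖ ^ 2)) :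
    Sectorial (4 * K ^ 2) ρ (quadLine B η e z) := by
  have hK0 : 0 < K := by linarith
  have hn := norm_add_smul_sq he hη z.re
  set n := ‖η + z.re • e‖ with hnd
  rw [← hn] at hz h1 h2
  have hKle : (1 / (2 * K ^ 2)) ^ 2 ≤ 1 := by
    rw [div_pow, one_pow]
    refine div_le_one_of_le₀ ?_ (by positivity)
    have : 1 ≤ K ^ 2 := one_le_pow₀ hK
    nlinarith
  constructor
  · rw [quadLine_re]
    have h3 := hl (η + z.re • e)
    have h4 := hB e
    rw [he, mul_one] at h4
    have h5 : n ^ 2 / K ^ 2 ≤ ‖B (η + z.re • e)‖ ^ 2 := by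
      rw [div_le_iff₀ (by positivity), ← mul_pow, mul_comm]
      exact pow_le_pow_left₀ (norm_nonneg _) h3 2
    have h6 : z.im ^ 2 * ‖B e‖ ^ 2 ≤ (1 / (2 * K ^ 2)) ^ 2 * n ^ 2 * K ^ 2 := by
      gcongr
    have h7 : (1 / (2 * K ^ 2)) ^ 2 * n ^ 2 * K ^ 2 = n ^ 2 / K ^ 2 / 4 := by
      field_simp; ring
    have h8 : ρ ^ 2 / (4 * K ^ 2) ≤ n ^ 2 / K ^ 2 / 2 := by
      rw [div_div, div_le_div_iff₀ (by positivity) (by positivity)]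
      nlinarith [sq_nonneg K]
    have h9 : 0 ≤ n ^ 2 / K ^ 2 := by positivity
    linarith
  · refine (norm_quadLine_le hB he hη z).trans ?_
    rw [← hn]
    have h10 : z.im ^ 2 ≤ n ^ 2 := hz.trans (mul_le_of_le_one_left (sq_nonneg _) hKle)
    nlinarith [sq_nonneg K]

theorem hasDerivAt_quadLine (z : ℂ) : HasDerivAt (quadLine B η e)
    (2 * ((inner ℝ (B η) (B e) : ℝ) : ℂ) + 2 * z * ((‖B e‖ ^ 2 : ℝ) : ℂ)) z := by
  unfold quadLine
  have h1 := (((hasDerivAt_id z).const_mul 2).mul_const ((inner ℝ (B η) (B e) : ℝ) : ℂ)).const_add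
    ((‖B η‖ ^ 2 : ℝ) : ℂ)
  have h2 := (hasDerivAt_pow 2 z).mul_const ((‖B e‖ ^ 2 : ℝ) : ℂ)
  refine (h1.add h2).congr_deriv ?_
  simp

theorem norm_deriv_quadLine_le (hK : 0 ≤ K) (hB : ∀ ξ, ‖B ξ‖ ≤ K * ‖ξ‖) (he : ‖e‖ = 1)
    (z : ℂ) : ‖2 * ((inner ℝ (B η) (B e) : ℝ) : ℂ) + 2 * z * ((‖B e‖ ^ 2 : ℝ) : ℂ)‖ ≤
      2 * K ^ 2 * (‖η‖ + ‖z‖) := by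
  have h1 := hB η
  have h2 := hB e
  rw [he, mul_one] at h2
  have h3 := abs_real_inner_le_norm (B η) (B e)
  refine (norm_add_le _ _).trans ?_
  rw [norm_mul, norm_mul, norm_mul, Complex.norm_ofNat, Complex.norm_real, Complex.norm_real,
    Real.norm_eq_abs, Real.norm_of_nonneg (sq_nonneg _)]
  calc 2 * |inner ℝ (B η) (B e)| + 2 * ‖z‖ * ‖B e‖ ^ 2
      ≤ 2 * (K * ‖η‖ * K) + 2 * ‖z‖ * K ^ 2 := by
        gcongr
        exact h3.trans (by gcongr)
    _ = _ := by ring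

end QuadLine

end StableKernel

/-! ### Holomorphic extension of the phase to a sector -/

namespace StableKernel

/-- The angle up to which the contours stay in the sector where `quadLine` has positive real
part. -/
noncomputable def sectorAngle (K : ℝ) : ℝ := Real.arctan (1 / (4 * K ^ 2))

theorem sectorAngle_pos {K : ℝ} (hK : 1 ≤ K) : 0 < sectorAngle K :=
  Real.arctan_pos.2 (by positivity)

theorem sectorAngle_lt_pi_div_two (K : ℝ) : sectorAngle K < Real.pi / 2 :=
  Real.arctan_lt_pi_div_two _

theorem sin_sectorAngle_pos {K : ℝ} (hK : 1 ≤ K) : 0 < Real.sin (sectorAngle K) :=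
  Real.sin_pos_of_pos_of_lt_pi (sectorAngle_pos hK)
    (by linarith [sectorAngle_lt_pi_div_two K, Real.pi_pos])

theorem sin_le_of_le_sectorAngle {K θ : ℝ} (hθ : θ ∈ Set.Icc 0 (sectorAngle K)) :
    0 ≤ Real.sin θ ∧ 0 < Real.cos θ ∧ Real.sin θ ≤ 1 / (4 * K ^ 2) * Real.cos θ := by
  have hlt := hθ.2.trans_lt (sectorAngle_lt_pi_div_two K)
  have hc : 0 < Real.cos θ := Real.cos_pos_of_mem_Ioo ⟨by linarith [hθ.1, Real.pi_pos], hlt⟩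
  refine ⟨Real.sin_nonneg_of_nonneg_of_le_pi hθ.1 (by linarith [Real.pi_pos]), hc, ?_⟩
  rw [← div_le_iff₀ hc, ← Real.tan_eq_sin_div_cos, ← Real.tan_arctan (1 / (4 * K ^ 2))]
  exact Real.strictMonoOn_tan.monotoneOn ⟨by linarith [hθ.1, Real.pi_pos], hlt⟩
    (Real.arctan_mem_Ioo _) hθ.2

variable {d : ℕ} {ι : Type*} [MeasurableSpace ι] {ν : Measure ι} {A : ι → E d →L[ℝ] E d}
  {K : ℝ} {η e : E d}

/-- An open set containing the real line (minus the origin if `η = 0`) on which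
`quadLine` has positive real part. -/
def lineSector (K : ℝ) (η : E d) : Set ℂ :=
  {z | z.im ^ 2 < (1 / (2 * K ^ 2)) ^ 2 * (z.re ^ 2 + ‖η‖ ^ 2)}

theorem isOpen_lineSector (K : ℝ) (η : E d) : IsOpen (lineSector K η) :=
  isOpen_lt (by fun_prop) (by fun_prop)

theorem pos_of_mem_lineSector {z : ℂ} (hz : z ∈ lineSector K η) : 0 < z.re ^ 2 + ‖η‖ ^ 2 := by
  by_contra h
  have h0 : z.re ^ 2 + ‖η‖ ^ 2 = 0 := le_antisymm (not_lt.1 h) (by positivity)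
  have hz' : z.im ^ 2 < (1 / (2 * K ^ 2)) ^ 2 * (z.re ^ 2 + ‖η‖ ^ 2) := hz
  rw [h0, mul_zero] at hz'
  exact absurd hz' (not_lt.2 (sq_nonneg _))

/-- The contours have `tan θ ≤ 1 / (4 K ^ 2)`, half the opening of `lineSector`. The spare factor
makes the inclusion strict, so they lie in an open set of holomorphy. -/
theorem contour_mem_lineSector (hK : 1 ≤ K) {θ u : ℝ} (hθ : θ ∈ Set.Icc 0 (sectorAngle K))
    (hu : 0 < u ^ 2 + ‖η‖ ^ 2) : contour ‖η‖ θ u ∈ lineSector K η := by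
  obtain ⟨hs, hc, hsc⟩ := sin_le_of_le_sectorAngle hθ
  have hK0 : 0 < K := by linarith
  simp only [lineSector, Set.mem_ofPred_eq, contour_re, contour_im]
  rw [neg_sq, mul_pow, Real.sq_sqrt hu.le]
  have h1 : Real.sin θ ^ 2 ≤ (1 / (4 * K ^ 2) * Real.cos θ) ^ 2 := pow_le_pow_left₀ hs hsc 2
  have h2 : Real.cos θ ^ 2 ≤ 1 := Real.cos_sq_le_one θ
  have h3 : Real.cos θ ^ 2 * (u ^ 2 + ‖η‖ ^ 2) ≤ (u * Real.cos θ) ^ 2 + ‖η‖ ^ 2 := by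
    nlinarith [sq_nonneg ‖η‖]
  calc (u ^ 2 + ‖η‖ ^ 2) * Real.sin θ ^ 2
      ≤ (u ^ 2 + ‖η‖ ^ 2) * (1 / (4 * K ^ 2) * Real.cos θ) ^ 2 := by gcongr
    _ = (1 / (2 * K ^ 2)) ^ 2 * (Real.cos θ ^ 2 * (u ^ 2 + ‖η‖ ^ 2)) / 4 := by
        field_simp; ring
    _ < (1 / (2 * K ^ 2)) ^ 2 * (Real.cos θ ^ 2 * (u ^ 2 + ‖η‖ ^ 2)) := by
        have : 0 < (1 / (2 * K ^ 2)) ^ 2 * (Real.cos θ ^ 2 * (u ^ 2 + ‖η‖ ^ 2)) := by positivity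
        linarith
    _ ≤ _ := by gcongr

theorem Elliptic.sectorial_contour (hA : Elliptic K A) (he : ‖e‖ = 1) (hη : inner ℝ η e = 0)
    {θ u : ℝ} (hθ : θ ∈ Set.Icc 0 (sectorAngle K)) (hu : 0 < u ^ 2 + ‖η‖ ^ 2) (r : ι) :
    Sectorial (4 * K ^ 2) √(u ^ 2 + ‖η‖ ^ 2) (quadLine (A r) η e (contour ‖η‖ θ u)) := by
  have hK := hA.one_le
  obtain ⟨hs, hc, hsc⟩ := sin_le_of_le_sectorAngle hθ
  have hmem : contour ‖η‖ θ u ∈ lineSector K η := contour_mem_lineSector hK hθ hu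
  refine sectorial_quadLine hK (hA.lower r) (hA.upper r) he hη (le_of_lt hmem) ?_ ?_
  · rw [Real.sq_sqrt hu.le, contour_re, mul_pow]
    nlinarith [Real.cos_sq_le_one θ, sq_nonneg u]
  · rw [Real.sq_sqrt hu.le, contour_re, mul_pow]
    -- Since `1 / (4 K ^ 2) ≤ 1`, the angle is at most `π / 4`, which makes the two radii comparable
    -- up to `√2`.
    have h1 : 1 / 2 ≤ Real.cos θ ^ 2 := by
      have h4 : 1 / (4 * K ^ 2) ≤ 1 := by
        refine div_le_one_of_le₀ ?_ (by positivity)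
        nlinarith
      have h5 : Real.sin θ ≤ Real.cos θ := hsc.trans (mul_le_of_le_one_left hc.le h4)
      nlinarith [Real.sin_sq_add_cos_sq θ]
    nlinarith [sq_nonneg u, sq_nonneg ‖η‖]

theorem Elliptic.sectorial_lineSector (hA : Elliptic K A) (he : ‖e‖ = 1)
    (hη : inner ℝ η e = 0) {z : ℂ} (hz : z ∈ lineSector K η) (r : ι) :
    Sectorial (4 * K ^ 2) √(z.re ^ 2 + ‖η‖ ^ 2) (quadLine (A r) η e z) := by
  have hu := pos_of_mem_lineSector hz
  refine sectorial_quadLine hA.one_le (hA.lower r) (hA.upper r) he hη (le_of_lt hz) ?_ ?_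
  · rw [Real.sq_sqrt hu.le]
  · rw [Real.sq_sqrt hu.le]; linarith

theorem Elliptic.measurable_quadLine (hA : Elliptic K A) (z : ℂ) :
    Measurable fun r => quadLine (A r) η e z := by
  have h1 := hA.measurable η
  have h2 := hA.measurable e
  unfold quadLine
  fun_prop

/-- The holomorphic extension of `u ↦ ∫ r, ‖A r (η + u • e)‖ ^ α ∂ν`. -/
noncomputable def phaseLine (ν : Measure ι) (A : ι → E d →L[ℝ] E d) (α : ℝ) (η e : E d)
    (z : ℂ) : ℂ :=
  ∫ r, quadLine (A r) η e z ^ ((α / 2 : ℝ) : ℂ) ∂ν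

theorem phaseLine_two (z : ℂ) : phaseLine ν A 2 η e z = ∫ r, quadLine (A r) η e z ∂ν := by
  simp [phaseLine]

section Bounds

variable [IsFiniteMeasure ν] {α ρ κ : ℝ} {z : ℂ}

theorem Elliptic.measurable_quadLine_cpow (hA : Elliptic K A) (z s : ℂ) :
    Measurable fun r => quadLine (A r) η e z ^ s :=
  (hA.measurable_quadLine z).pow_const s

theorem Elliptic.integrable_quadLine_cpow (hA : Elliptic K A) (hκ : 1 ≤ κ) (hρ : 0 < ρ)
    (hz : ∀ r, Sectorial κ ρ (quadLine (A r) η e z)) (hα : 0 < α) (hα2 : α ≤ 2) :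
    Integrable (fun r => quadLine (A r) η e z ^ ((α / 2 : ℝ) : ℂ)) ν :=
  Integrable.of_bound (hA.measurable_quadLine_cpow z _).aestronglyMeasurable (κ * ρ ^ α)
    (ae_of_all _ fun r => (hz r).norm_cpow_le hκ hρ hα hα2)

theorem norm_phaseLine_le (hκ : 1 ≤ κ) (hρ : 0 < ρ)
    (hz : ∀ r, Sectorial κ ρ (quadLine (A r) η e z)) (hα : 0 < α) (hα2 : α ≤ 2) :
    ‖phaseLine ν A α η e z‖ ≤ ν.real Set.univ * (κ * ρ ^ α) := by
  rw [mul_comm]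
  exact norm_integral_le_of_norm_le_const
    (ae_of_all _ fun r => (hz r).norm_cpow_le hκ hρ hα hα2)

theorem Elliptic.re_phaseLine_ge (hA : Elliptic K A) (hκ : 1 ≤ κ) (hρ : 0 < ρ)
    (hz : ∀ r, Sectorial κ ρ (quadLine (A r) η e z)) (hα : 0 < α) (hα2 : α ≤ 2) :
    ν.real Set.univ * (ρ ^ α / κ ^ 3) ≤ (phaseLine ν A α η e z).re := by
  have hi := hA.integrable_quadLine_cpow (ν := ν) hκ hρ hz hα hα2
  have h1 : (phaseLine ν A α η e z).re =
      ∫ r, (quadLine (A r) η e z ^ ((α / 2 : ℝ) : ℂ)).re ∂ν := (integral_re hi).symm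
  rw [h1, ← smul_eq_mul, ← integral_const]
  exact integral_mono (integrable_const _) hi.re fun r => (hz r).re_cpow_ge hκ hρ hα hα2

theorem Elliptic.norm_phaseLine_sub_smul_le (hA : Elliptic K A) (hκ : 1 ≤ κ) (hρ : 0 < ρ)
    (hz : ∀ r, Sectorial κ ρ (quadLine (A r) η e z)) (hα : 0 < α) (hα2 : α ≤ 2) {X : ℝ}
    (hX : 0 < X) :
    ‖phaseLine ν A α η e z - (X ^ (2 - α) : ℝ) * phaseLine ν A 2 η e z‖ ≤
      ν.real Set.univ * (κ * (κ + 4) * (2 - α) * X ^ (-α) *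
        ((1 + |Real.log (X * ρ)|) * ((X * ρ) ^ α + (X * ρ) ^ 2))) := by
  have hi2 : Integrable (fun r => quadLine (A r) η e z) ν := by
    simpa using hA.integrable_quadLine_cpow (ν := ν) hκ hρ hz two_pos le_rfl
  rw [phaseLine_two, phaseLine, ← integral_const_mul,
    ← integral_sub (hA.integrable_quadLine_cpow hκ hρ hz hα hα2) (hi2.const_mul _), mul_comm]
  exact norm_integral_le_of_norm_le_const
    (ae_of_all _ fun r => (hz r).norm_cpow_sub_smul_le hκ hρ hα hα2 hX)

theorem Elliptic.norm_phaseLine_sub_le (hA : Elliptic K A) (hκ : 1 ≤ κ) (hρ : 0 < ρ)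
    (hz : ∀ r, Sectorial κ ρ (quadLine (A r) η e z)) (hα : 0 < α) (hα2 : α ≤ 2) :
    ‖phaseLine ν A α η e z - phaseLine ν A 2 η e z‖ ≤
      ν.real Set.univ * (κ * (κ + 4) * (2 - α) *
        ((1 + |Real.log ρ|) * (ρ ^ α + ρ ^ 2))) := by
  have := hA.norm_phaseLine_sub_smul_le (ν := ν) hκ hρ hz hα hα2 one_pos
  simpa using this

end Bounds

/-- Differentiation under the integral. The derivative contains the power `α/2 - 1 ≤ 0`, so
domination requires a neighbourhood on which the quadratic form is bounded below uniformly in `r`;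
this is the role of `n₀ / 2` in the set `s`. -/
theorem Elliptic.differentiableAt_phaseLine [IsFiniteMeasure ν] (hA : Elliptic K A)
    (he : ‖e‖ = 1) (hη : inner ℝ η e = 0) {α : ℝ} (hα : 0 < α) (hα2 : α ≤ 2) {z₀ : ℂ}
    (hz₀ : z₀ ∈ lineSector K η) : DifferentiableAt ℂ (phaseLine ν A α η e) z₀ := by
  have hK := hA.one_le
  have hκ : 1 ≤ 4 * K ^ 2 := by nlinarith
  set n₀ := z₀.re ^ 2 + ‖η‖ ^ 2 with hn₀
  have hn₀pos : 0 < n₀ := pos_of_mem_lineSector hz₀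
  set s : Set ℂ := lineSector K η ∩ {z | n₀ / 2 < z.re ^ 2 + ‖η‖ ^ 2} ∩ {z | ‖z‖ < ‖z₀‖ + 1}
  have hs : s ∈ 𝓝 z₀ := by
    refine IsOpen.mem_nhds (((isOpen_lineSector K η).inter ?_).inter ?_) ⟨⟨hz₀, ?_⟩, ?_⟩
    · exact isOpen_lt (by fun_prop) (by fun_prop)
    · exact isOpen_lt (by fun_prop) (by fun_prop)
    · simp only [Set.mem_ofPred_eq]; linarith
    · simp
  have hsec : ∀ z ∈ lineSector K η, ∀ r,
      Sectorial (4 * K ^ 2) √(z.re ^ 2 + ‖η‖ ^ 2) (quadLine (A r) η e z) :=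
    fun z hz r => hA.sectorial_lineSector he hη hz r
  have hsqrt : ∀ z ∈ lineSector K η, 0 < √(z.re ^ 2 + ‖η‖ ^ 2) :=
    fun z hz => Real.sqrt_pos.2 (pos_of_mem_lineSector hz)
  set a : ℝ := α / 2 with ha
  set F' : ℂ → ι → ℂ := fun z r => (a : ℂ) * quadLine (A r) η e z ^ ((a : ℂ) - 1) *
    (2 * ((inner ℝ (A r η) (A r e) : ℝ) : ℂ) + 2 * z * ((‖A r e‖ ^ 2 : ℝ) : ℂ))
  have hmeas' : Measurable (F' z₀) := by
    have h1 := hA.measurable η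
    have h2 := hA.measurable e
    have h3 := hA.measurable_quadLine_cpow (η := η) (e := e) z₀ ((a : ℂ) - 1)
    fun_prop
  refine (hasDerivAt_integral_of_dominated_loc_of_deriv_le (μ := ν) (F' := F')
    (bound := fun _ => a * (n₀ / 2 / (4 * K ^ 2)) ^ (a - 1) *
      (2 * K ^ 2 * (‖η‖ + (‖z₀‖ + 1)))) hs
    (Eventually.of_forall fun z => (hA.measurable_quadLine_cpow z _).aestronglyMeasurable)
    (hA.integrable_quadLine_cpow hκ (hsqrt z₀ hz₀) (hsec z₀ hz₀) hα hα2)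
    hmeas'.aestronglyMeasurable (ae_of_all _ fun r z hz => ?_) (integrable_const _)
    (ae_of_all _ fun r z hz => ?_)).2.differentiableAt
  · have hq := hsec z hz.1.1 r
    have hq0 := hq.ne_zero hκ (hsqrt z hz.1.1)
    have hlow : n₀ / 2 / (4 * K ^ 2) ≤ ‖quadLine (A r) η e z‖ := by
      refine le_trans ?_ hq.le_norm
      rw [Real.sq_sqrt (pos_of_mem_lineSector hz.1.1).le]
      have : n₀ / 2 < z.re ^ 2 + ‖η‖ ^ 2 := hz.1.2
      gcongr
    simp only [F']
    rw [norm_mul, norm_mul, Complex.norm_real, Real.norm_of_nonneg (by positivity)]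
    have e1 : (a : ℂ) - 1 = ((a - 1 : ℝ) : ℂ) := by push_cast; ring
    rw [e1, Complex.norm_cpow_real]
    have hb1 : ‖quadLine (A r) η e z‖ ^ (a - 1) ≤ (n₀ / 2 / (4 * K ^ 2)) ^ (a - 1) :=
      Real.rpow_le_rpow_of_nonpos (by positivity) hlow (by linarith)
    have hb2 : ‖2 * ((inner ℝ (A r η) (A r e) : ℝ) : ℂ) + 2 * z * ((‖A r e‖ ^ 2 : ℝ) : ℂ)‖ ≤
        2 * K ^ 2 * (‖η‖ + (‖z₀‖ + 1)) := by
      refine (norm_deriv_quadLine_le (by linarith) (hA.upper r) he z).trans ?_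
      have : ‖z‖ < ‖z₀‖ + 1 := hz.2
      gcongr
    exact mul_le_mul (mul_le_mul_of_nonneg_left hb1 (by positivity)) hb2 (norm_nonneg _)
      (by positivity)
  · have hq := (hsec z hz.1.1 r).re_pos hκ (hsqrt z hz.1.1)
    refine ((hasDerivAt_quadLine (B := A r) (η := η) (e := e) z).cpow_const
      (c := (a : ℂ)) (Or.inl hq)).congr_deriv ?_
    rfl

end StableKernel

/-! ### The oscillatory integral along one line -/

namespace StableKernel

variable {d k : ℕ} {ι : Type*} [MeasurableSpace ι] {ν : Measure ι} {A : ι → E d →L[ℝ] E d}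
  {K : ℝ} {η e : E d}

/-- The holomorphic extension of `u ↦ ∏ j, ⟪η + u • e, v j⟫`. -/
noncomputable def lineProd (η e : E d) (v : Fin k → E d) (z : ℂ) : ℂ :=
  ∏ j, (((inner ℝ η (v j) : ℝ) : ℂ) + z * ((inner ℝ e (v j) : ℝ) : ℂ))

theorem lineProd_ofReal (η e : E d) (v : Fin k → E d) (u : ℝ) :
    lineProd η e v u = ((∏ j, inner ℝ (η + u • e) (v j) : ℝ) : ℂ) := by
  simp [lineProd, inner_add_left, inner_smul_left]

theorem differentiable_lineProd (η e : E d) (v : Fin k → E d) :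
    Differentiable ℂ (lineProd η e v) := by
  unfold lineProd
  fun_prop

theorem norm_lineProd_le (he : ‖e‖ = 1) (v : Fin k → E d) {z : ℂ} {ρ : ℝ} (hz : ‖z‖ ≤ ρ)
    (hη : ‖η‖ ≤ ρ) : ‖lineProd η e v z‖ ≤ (2 * ρ) ^ k * ∏ j, ‖v j‖ := by
  have h1 : (2 * ρ) ^ k * ∏ j, ‖v j‖ = ∏ j : Fin k, (2 * ρ * ‖v j‖) := by
    rw [Finset.prod_mul_distrib]; simp
  have h0 : 0 ≤ ρ := (norm_nonneg z).trans hz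
  rw [lineProd, norm_prod, h1]
  refine Finset.prod_le_prod (fun _ _ => norm_nonneg _) fun j _ => ?_
  refine (norm_add_le _ _).trans ?_
  rw [norm_mul, Complex.norm_real, Complex.norm_real]
  have h2 : ‖inner ℝ η (v j)‖ ≤ ρ * ‖v j‖ :=
    (norm_inner_le_norm η (v j)).trans (by gcongr)
  have h3 : ‖z‖ * ‖inner ℝ e (v j)‖ ≤ ρ * ‖v j‖ := by
    have := norm_inner_le_norm (𝕜 := ℝ) e (v j)
    rw [he, one_mul] at this
    gcongr
  linarith

/-- The radial majorant of the integrand on the deformed contour. -/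
noncomputable def farKernel (κ s t α X : ℝ) (k : ℕ) (ρ : ℝ) : ℝ :=
  Real.exp (-(X * s * ρ)) * (2 * ρ) ^ k *
    (t * (κ * (κ + 4) * (2 - α) * X ^ (-α) *
        ((1 + |Real.log (X * ρ)|) * ((X * ρ) ^ α + (X * ρ) ^ 2))) +
      t * (κ * (κ + 4) * (2 - α) * ((1 + |Real.log ρ|) * (ρ ^ α + ρ ^ 2))) *
        (t * (κ * ρ ^ α) + t * (κ * ρ ^ 2)))

theorem norm_exp_neg_mul_I (X : ℝ) (z : ℂ) :
    ‖Complex.exp (-(X * z) * Complex.I)‖ = Real.exp (X * z.im) := by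
  rw [Complex.norm_exp]
  simp

/-- Two spare powers of decay are traded for the factor `(1 + ρ ^ 2)⁻¹` required on the contours. -/
theorem one_add_pow_mul_le {C ρ y : ℝ} {N : ℕ} (hρ : 0 ≤ ρ) (hy : 0 ≤ y)
    (h : (1 + ρ) ^ (N + 2) * y ≤ C) : ρ ^ N * y ≤ C * (1 + ρ ^ 2)⁻¹ := by
  rw [← div_eq_mul_inv, le_div_iff₀ (by positivity)]
  refine le_trans ?_ h
  rw [pow_add]
  have h1 : ρ ^ N ≤ (1 + ρ) ^ N := by gcongr; linarith
  have h2 : 1 + ρ ^ 2 ≤ (1 + ρ) ^ 2 := by nlinarith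
  calc ρ ^ N * y * (1 + ρ ^ 2) ≤ (1 + ρ) ^ N * y * (1 + ρ) ^ 2 := by gcongr
    _ = _ := by ring

section

variable [IsFiniteMeasure ν]

/-- For exponent `2` the phase is a polynomial of degree at most two in `z`. Being entire, it can be
followed beyond the sector, up to the angle `π / 2`. -/
theorem Elliptic.differentiable_phaseLine_two (hA : Elliptic K A) :
    Differentiable ℂ (phaseLine ν A 2 η e) := by
  have hb : ∀ ξ r, ‖A r ξ‖ ≤ K * ‖ξ‖ := fun ξ r => hA.upper r ξ
  have i1 : Integrable (fun r => ((‖A r η‖ ^ 2 : ℝ) : ℂ)) ν := by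
    refine Integrable.of_bound (C := (K * ‖η‖) ^ 2) ?_ (ae_of_all _ fun r => ?_)
    · have := hA.measurable η
      exact Measurable.aestronglyMeasurable (by fun_prop)
    · rw [Complex.norm_real, Real.norm_of_nonneg (sq_nonneg _)]
      gcongr; exact hb η r
  have i2 : Integrable (fun r => ((‖A r e‖ ^ 2 : ℝ) : ℂ)) ν := by
    refine Integrable.of_bound (C := (K * ‖e‖) ^ 2) ?_ (ae_of_all _ fun r => ?_)
    · have := hA.measurable e
      exact Measurable.aestronglyMeasurable (by fun_prop)
    · rw [Complex.norm_real, Real.norm_of_nonneg (sq_nonneg _)]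
      gcongr; exact hb e r
  have i3 : Integrable (fun r => ((inner ℝ (A r η) (A r e) : ℝ) : ℂ)) ν := by
    refine Integrable.of_bound (C := (K * ‖η‖) * (K * ‖e‖)) ?_ (ae_of_all _ fun r => ?_)
    · have := hA.measurable e
      have := hA.measurable η
      exact Measurable.aestronglyMeasurable (by fun_prop)
    · rw [Complex.norm_real]
      exact (norm_inner_le_norm _ _).trans
        (mul_le_mul (hb η r) (hb e r) (norm_nonneg _) ((norm_nonneg _).trans (hb η r)))
  have heq : phaseLine ν A 2 η e = fun z => ∫ r, ((‖A r η‖ ^ 2 : ℝ) : ℂ) ∂ν +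
      2 * z * ∫ r, ((inner ℝ (A r η) (A r e) : ℝ) : ℂ) ∂ν +
      z ^ 2 * ∫ r, ((‖A r e‖ ^ 2 : ℝ) : ℂ) ∂ν := by
    funext z
    rw [phaseLine_two, ← integral_const_mul, ← integral_const_mul,
      ← integral_add i1 (i3.const_mul _)]
    exact integral_add (i1.add (i3.const_mul (2 * z))) (i2.const_mul (z ^ 2))
  rw [heq]
  fun_prop

theorem Elliptic.norm_phaseLine_two_contour_le (hA : Elliptic K A) (he : ‖e‖ = 1)
    (hη : inner ℝ η e = 0) (θ u : ℝ) : ‖phaseLine ν A 2 η e (contour ‖η‖ θ u)‖ ≤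
      ν.real Set.univ * (4 * K ^ 2 * √(u ^ 2 + ‖η‖ ^ 2) ^ 2) := by
  rw [phaseLine_two, mul_comm (ν.real _)]
  refine norm_integral_le_of_norm_le_const (ae_of_all _ fun r => ?_)
  refine (norm_quadLine_le (hA.upper r) he hη _).trans ?_
  rw [contour_re, contour_im, neg_sq, mul_pow, mul_pow, Real.sq_sqrt (by positivity)]
  have h2 := Real.sin_sq_add_cos_sq θ
  have h3 : (u ^ 2 * Real.cos θ ^ 2 + ‖η‖ ^ 2 + (u ^ 2 + ‖η‖ ^ 2) * Real.sin θ ^ 2) ≤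
      2 * (u ^ 2 + ‖η‖ ^ 2) := by
    nlinarith [sq_nonneg (u * Real.cos θ), sq_nonneg (‖η‖ * Real.cos θ)]
  nlinarith [sq_nonneg K]

/-- The holomorphic integrand along a line: the difference of the two symbols times an oscillating
factor and a product of linear forms. -/
noncomputable def diffLine (ν : Measure ι) (A : ι → E d →L[ℝ] E d) (α X : ℝ) (η e : E d)
    (v : Fin k → E d) (z : ℂ) : ℂ :=
  Complex.exp (-(X * z) * Complex.I) * lineProd η e v z *
    (Complex.exp (-phaseLine ν A α η e z) - Complex.exp (-phaseLine ν A 2 η e z))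

/-- The quadratic phase times an oscillating factor and a product of linear forms. -/
noncomputable def quadPhaseLine (ν : Measure ι) (A : ι → E d →L[ℝ] E d) (X : ℝ) (η e : E d)
    (v : Fin k → E d) (z : ℂ) : ℂ :=
  Complex.exp (-(X * z) * Complex.I) * lineProd η e v z * phaseLine ν A 2 η e z

omit [MeasurableSpace ι] [IsFiniteMeasure ν] in
theorem norm_lineProd_contour_le (he : ‖e‖ = 1) (v : Fin k → E d) (θ u : ℝ) :
    ‖lineProd η e v (contour ‖η‖ θ u)‖ ≤ (2 * √(u ^ 2 + ‖η‖ ^ 2)) ^ k * ∏ j, ‖v j‖ :=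
  norm_lineProd_le he v (norm_contour_le ‖η‖ θ u)
    (Real.le_sqrt_of_sq_le (by nlinarith [sq_nonneg u]))

theorem norm_exp_contour (X m θ u : ℝ) :
    ‖Complex.exp (-(X * contour m θ u) * Complex.I)‖ =
      Real.exp (-(X * Real.sin θ * √(u ^ 2 + m ^ 2))) := by
  rw [norm_exp_neg_mul_I, contour_im]
  ring_nf

theorem Elliptic.pow_mul_norm_exp_neg_phaseLine_le (hA : Elliptic K A) {κ ρ α β : ℝ} {z : ℂ}
    (hκ : 1 ≤ κ) (hρ : 0 < ρ) (hz : ∀ r, Sectorial κ ρ (quadLine (A r) η e z))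
    (hβ : 0 < β) (hαβ : α ≤ β) (hβ2 : β ≤ 2) {C : ℝ}
    (hC : ∀ ρ : ℝ, 0 < ρ → ∀ γ : ℝ, α ≤ γ →
      (1 + ρ) ^ (k + 2) * Real.exp (-(ν.real Set.univ / κ ^ 3 * ρ ^ γ)) ≤ C) :
    ρ ^ k * ‖Complex.exp (-phaseLine ν A β η e z)‖ ≤ C * (1 + ρ ^ 2)⁻¹ := by
  rw [Complex.norm_exp, Complex.neg_re]
  have h3 := hA.re_phaseLine_ge (ν := ν) hκ hρ hz hβ hβ2
  have h4 : Real.exp (-(phaseLine ν A β η e z).re) ≤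
      Real.exp (-(ν.real Set.univ / κ ^ 3 * ρ ^ β)) := by
    refine Real.exp_le_exp.2 (neg_le_neg (le_trans (le_of_eq ?_) h3))
    ring
  refine le_trans ?_ (one_add_pow_mul_le hρ.le (Real.exp_pos _).le (hC ρ hρ β hαβ))
  gcongr

/-- The angle `0` is included, so the oscillating factor is only bounded by `1`, and the decay comes
from the real parts of the two phases, which are positive in the sector. -/
theorem Elliptic.exists_norm_diffLine_le (hA : Elliptic K A) (he : ‖e‖ = 1)
    (hη : inner ℝ η e = 0) {α X : ℝ} (hα : 0 < α) (hα2 : α ≤ 2) (hX : 0 < X)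
    (hν : 0 < ν.real Set.univ) (v : Fin k → E d) :
    ∃ C : ℝ, ∀ θ ∈ Set.Icc 0 (sectorAngle K), ∀ u : ℝ, 0 < u ^ 2 + ‖η‖ ^ 2 →
      ‖diffLine ν A α X η e v (contour ‖η‖ θ u)‖ ≤ C * (1 + (u ^ 2 + ‖η‖ ^ 2))⁻¹ := by
  have hK := hA.one_le
  have hκ : 1 ≤ 4 * K ^ 2 := by nlinarith
  obtain ⟨C₁, hC₁, hC₁b⟩ := exists_pow_mul_exp_neg_rpow_le (k + 2)
    (c := ν.real Set.univ / (4 * K ^ 2) ^ 3) (by positivity) hα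
  refine ⟨2 ^ k * (∏ j, ‖v j‖) * 2 * C₁, fun θ hθ u hu => ?_⟩
  have hsec := hA.sectorial_contour he hη hθ hu
  have hP := norm_lineProd_contour_le (η := η) he v θ u
  have h1 : ‖Complex.exp (-(X * contour ‖η‖ θ u) * Complex.I)‖ ≤ 1 := by
    rw [norm_exp_contour]
    refine Real.exp_le_one_iff.2 (neg_nonpos.2 ?_)
    have := (sin_le_of_le_sectorAngle hθ).1
    positivity
  have hρp : 0 < √(u ^ 2 + ‖η‖ ^ 2) := Real.sqrt_pos.2 hu
  have hρsq : √(u ^ 2 + ‖η‖ ^ 2) ^ 2 = u ^ 2 + ‖η‖ ^ 2 := Real.sq_sqrt hu.le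
  rw [← hρsq]
  clear hρsq
  generalize contour ‖η‖ θ u = z at *
  generalize √(u ^ 2 + ‖η‖ ^ 2) = ρ at *
  have h5 := hA.pow_mul_norm_exp_neg_phaseLine_le (ν := ν) hκ hρp hsec hα le_rfl hα2 hC₁b
  have h6 := hA.pow_mul_norm_exp_neg_phaseLine_le (ν := ν) hκ hρp hsec two_pos hα2 le_rfl hC₁b
  have hB0 : 0 ≤ ∏ j, ‖v j‖ := Finset.prod_nonneg fun _ _ => norm_nonneg _
  rw [diffLine, norm_mul, norm_mul]
  generalize ∏ j, ‖v j‖ = B at *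
  calc _ ≤ 1 * ((2 * ρ) ^ k * B) * (‖Complex.exp (-phaseLine ν A α η e z)‖ +
        ‖Complex.exp (-phaseLine ν A 2 η e z)‖) := by
        gcongr
        exact norm_sub_le _ _
    _ = 2 ^ k * B * (ρ ^ k * ‖Complex.exp (-phaseLine ν A α η e z)‖ +
        ρ ^ k * ‖Complex.exp (-phaseLine ν A 2 η e z)‖) := by rw [mul_pow]; ring
    _ ≤ 2 ^ k * B * (C₁ * (1 + ρ ^ 2)⁻¹ + C₁ * (1 + ρ ^ 2)⁻¹) := by gcongr
    _ = _ := by ring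

/-- A polynomial has no decay of its own: here the oscillating factor provides it, at a rate `X sin
θ` that stays positive because the angles start at `sectorAngle K`. -/
theorem Elliptic.exists_norm_quadPhaseLine_le (hA : Elliptic K A) (he : ‖e‖ = 1)
    (hη : inner ℝ η e = 0) {X : ℝ} (hX : 0 < X) (v : Fin k → E d) :
    ∃ C : ℝ, ∀ θ ∈ Set.Icc (sectorAngle K) (Real.pi / 2), ∀ u : ℝ, 0 < u ^ 2 + ‖η‖ ^ 2 →
      ‖quadPhaseLine ν A X η e v (contour ‖η‖ θ u)‖ ≤ C * (1 + (u ^ 2 + ‖η‖ ^ 2))⁻¹ := by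
  have hK := hA.one_le
  have hs := sin_sectorAngle_pos hK
  have hθ₀ := sectorAngle_pos hK
  obtain ⟨C₂, hC₂, hC₂b⟩ := exists_pow_mul_exp_neg_rpow_le (k + 2 + 2)
    (c := X * Real.sin (sectorAngle K)) (by positivity) one_pos
  refine ⟨2 ^ k * (∏ j, ‖v j‖) * ν.real Set.univ * (4 * K ^ 2) * C₂, fun θ hθ u hu => ?_⟩
  have hP := norm_lineProd_contour_le (η := η) he v θ u
  have hsin : Real.sin (sectorAngle K) ≤ Real.sin θ :=
    Real.sin_le_sin_of_le_of_le_pi_div_two (by linarith [Real.pi_pos]) hθ.2 hθ.1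
  have h1 : ‖Complex.exp (-(X * contour ‖η‖ θ u) * Complex.I)‖ ≤
      Real.exp (-(X * Real.sin (sectorAngle K) * √(u ^ 2 + ‖η‖ ^ 2) ^ (1 : ℝ))) := by
    rw [norm_exp_contour, Real.rpow_one]
    refine Real.exp_le_exp.2 (neg_le_neg ?_)
    gcongr
  have h3 := hA.norm_phaseLine_two_contour_le (ν := ν) he hη θ u
  have hρp : 0 < √(u ^ 2 + ‖η‖ ^ 2) := Real.sqrt_pos.2 hu
  have hρsq : √(u ^ 2 + ‖η‖ ^ 2) ^ 2 = u ^ 2 + ‖η‖ ^ 2 := Real.sq_sqrt hu.le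
  rw [← hρsq]
  clear hρsq
  generalize contour ‖η‖ θ u = z at *
  generalize √(u ^ 2 + ‖η‖ ^ 2) = ρ at *
  have h2 := one_add_pow_mul_le hρp.le (Real.exp_pos _).le (hC₂b ρ hρp 1 le_rfl)
  have hB0 : 0 ≤ ∏ j, ‖v j‖ := Finset.prod_nonneg fun _ _ => norm_nonneg _
  rw [quadPhaseLine, norm_mul, norm_mul]
  generalize ∏ j, ‖v j‖ = B at *
  calc _ ≤ Real.exp (-(X * Real.sin (sectorAngle K) * ρ ^ (1 : ℝ))) *
        ((2 * ρ) ^ k * B) * (ν.real Set.univ * (4 * K ^ 2 * ρ ^ 2)) := by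
        gcongr
    _ = 2 ^ k * B * ν.real Set.univ * (4 * K ^ 2) * (ρ ^ (k + 2) *
        Real.exp (-(X * Real.sin (sectorAngle K) * ρ ^ (1 : ℝ)))) := by
        rw [mul_pow, pow_add]; ring
    _ ≤ 2 ^ k * B * ν.real Set.univ * (4 * K ^ 2) * (C₂ * (1 + ρ ^ 2)⁻¹) := by
        gcongr
    _ = _ := by ring

/-- With phases `φ` and `ψ`, subtracting `(1 - X ^ (2 - α)) ψ` from `exp (-φ) - exp (-ψ)` leaves
`-(φ - X ^ (2 - α) ψ)` plus the difference of the second order remainders. The two summands of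
`farKernel` bound these: the first is linear in `t` with logarithm at `X * ρ`, the second quadratic
in `t` with logarithm at `ρ`. -/
theorem Elliptic.norm_diffLine_sub_le (hA : Elliptic K A) (he : ‖e‖ = 1)
    (hη : inner ℝ η e = 0) {α X : ℝ} (hα : 0 < α) (hα2 : α ≤ 2) (hX : 0 < X)
    (v : Fin k → E d) {u : ℝ} (hu : 0 < u ^ 2 + ‖η‖ ^ 2) :
    ‖diffLine ν A α X η e v (contour ‖η‖ (sectorAngle K) u) -
      (1 - (X ^ (2 - α) : ℝ) : ℂ) *
        quadPhaseLine ν A X η e v (contour ‖η‖ (sectorAngle K) u)‖ ≤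
      (∏ j, ‖v j‖) * farKernel (4 * K ^ 2) (Real.sin (sectorAngle K))
        (ν.real Set.univ) α X k √(u ^ 2 + ‖η‖ ^ 2) := by
  have hK := hA.one_le
  have hκ : 1 ≤ 4 * K ^ 2 := by nlinarith
  have hmem : sectorAngle K ∈ Set.Icc 0 (sectorAngle K) := ⟨(sectorAngle_pos hK).le, le_rfl⟩
  have hsz := hA.sectorial_contour he hη hmem hu
  have hP := norm_lineProd_contour_le (η := η) he v (sectorAngle K) u
  have ho := norm_exp_contour X ‖η‖ (sectorAngle K) u
  have hn2 := hA.norm_phaseLine_two_contour_le (ν := ν) he hη (sectorAngle K) u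
  have hρp : 0 < √(u ^ 2 + ‖η‖ ^ 2) := Real.sqrt_pos.2 hu
  generalize contour ‖η‖ (sectorAngle K) u = z at *
  generalize √(u ^ 2 + ‖η‖ ^ 2) = ρ at *
  generalize 4 * K ^ 2 = κ at *
  have hre : ∀ β : ℝ, 0 < β → β ≤ 2 → 0 ≤ (phaseLine ν A β η e z).re := fun β hβ hβ2 =>
    le_trans (by positivity) (hA.re_phaseLine_ge (ν := ν) hκ hρp hsz hβ hβ2)
  have hl := hA.norm_phaseLine_sub_smul_le (ν := ν) hκ hρp hsz hα hα2 hX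
  have hd := hA.norm_phaseLine_sub_le (ν := ν) hκ hρp hsz hα hα2
  have hn1 := norm_phaseLine_le (ν := ν) hκ hρp hsz hα hα2
  have hr := norm_exp_neg_remainder_sub_le (hre α hα hα2) (hre 2 two_pos le_rfl)
  rw [diffLine, quadPhaseLine]
  generalize phaseLine ν A α η e z = φ at *
  generalize phaseLine ν A 2 η e z = ψ at *
  generalize Real.sin (sectorAngle K) = s at *
  have e1 : Complex.exp (-(X * z) * Complex.I) * lineProd η e v z *
      (Complex.exp (-φ) - Complex.exp (-ψ)) - (1 - (X ^ (2 - α) : ℝ) : ℂ) *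
      (Complex.exp (-(X * z) * Complex.I) * lineProd η e v z * ψ) =
      Complex.exp (-(X * z) * Complex.I) * lineProd η e v z *
        (-(φ - (X ^ (2 - α) : ℝ) * ψ) +
        ((Complex.exp (-φ) - 1 + φ) - (Complex.exp (-ψ) - 1 + ψ))) := by ring
  have hsum := (norm_add_le (-(φ - (X ^ (2 - α) : ℝ) * ψ))
    ((Complex.exp (-φ) - 1 + φ) - (Complex.exp (-ψ) - 1 + ψ))).trans
    (add_le_add ((norm_neg _).trans_le hl) (hr.trans (mul_le_mul hd (add_le_add hn1 hn2)
      (by positivity) ((norm_nonneg _).trans hd))))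
  have hB0 : 0 ≤ ∏ j, ‖v j‖ := Finset.prod_nonneg fun _ _ => norm_nonneg _
  rw [e1, norm_mul, norm_mul, ho, farKernel]
  generalize ∏ j, ‖v j‖ = B at *
  refine (mul_le_mul (mul_le_mul_of_nonneg_left hP (Real.exp_pos _).le) hsum (norm_nonneg _)
    (by positivity)).trans_eq ?_
  ring

/-- The one dimensional Fourier integral of the difference of the two symbols, along a line, is
bounded by the integral of `farKernel`. -/
theorem Elliptic.norm_integral_diffLine_le (hA : Elliptic K A) (he : ‖e‖ = 1)
    (hη : inner ℝ η e = 0) {α X : ℝ} (hα : 0 < α) (hα2 : α ≤ 2) (hX : 0 < X)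
    (hν : 0 < ν.real Set.univ) (v : Fin k → E d)
    (hint : Integrable fun u : ℝ => farKernel (4 * K ^ 2) (Real.sin (sectorAngle K))
      (ν.real Set.univ) α X k √(u ^ 2 + ‖η‖ ^ 2)) :
    ‖∫ u : ℝ, diffLine ν A α X η e v u‖ ≤
      (∏ j, ‖v j‖) * ∫ u : ℝ, farKernel (4 * K ^ 2) (Real.sin (sectorAngle K))
        (ν.real Set.univ) α X k √(u ^ 2 + ‖η‖ ^ 2) := by
  have hK := hA.one_le
  have hosc : Differentiable ℂ fun z : ℂ => Complex.exp (-(X * z) * Complex.I) := by fun_prop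
  have hPd := differentiable_lineProd η e v
  have hψd : Differentiable ℂ (phaseLine ν A 2 η e) := hA.differentiable_phaseLine_two
  obtain ⟨C₁, hFb⟩ := hA.exists_norm_diffLine_le (ν := ν) he hη hα hα2 hX hν v
  obtain ⟨C₂, hHb⟩ := hA.exists_norm_quadPhaseLine_le (ν := ν) he hη hX v
  have hFd : ∀ θ ∈ Set.Icc 0 (sectorAngle K), ∀ u : ℝ, 0 < u ^ 2 + ‖η‖ ^ 2 →
      DifferentiableAt ℂ (diffLine ν A α X η e v) (contour ‖η‖ θ u) := by
    intro θ hθ u hu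
    have h1 : DifferentiableAt ℂ (phaseLine ν A α η e) (contour ‖η‖ θ u) :=
      hA.differentiableAt_phaseLine he hη hα hα2 (contour_mem_lineSector hK hθ hu)
    exact ((hosc _).mul (hPd _)).mul (h1.neg.cexp.sub (hψd _).neg.cexp)
  have hHd : ∀ θ ∈ Set.Icc (sectorAngle K) (Real.pi / 2), ∀ u : ℝ, 0 < u ^ 2 + ‖η‖ ^ 2 →
      DifferentiableAt ℂ (quadPhaseLine ν A X η e v) (contour ‖η‖ θ u) :=
    fun θ _ u _ => ((hosc _).mul (hPd _)).mul (hψd _)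
  have hFeq := integral_contour_eq (norm_nonneg η) (sectorAngle_pos hK).le hFd hFb
  have hHeq := integral_contour_eq (norm_nonneg η) (sectorAngle_lt_pi_div_two K).le hHd hHb
  rw [integral_contour_pi_div_two] at hHeq
  have hmem : sectorAngle K ∈ Set.Icc 0 (sectorAngle K) := ⟨(sectorAngle_pos hK).le, le_rfl⟩
  have hmem' : sectorAngle K ∈ Set.Icc (sectorAngle K) (Real.pi / 2) :=
    ⟨le_rfl, (sectorAngle_lt_pi_div_two K).le⟩
  have hFi := integrable_contour (hFd _ hmem) (hFb _ hmem)
  have hHi := integrable_contour (hHd _ hmem') (hHb _ hmem')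
  -- The integral of `quadPhaseLine` over the contour of angle `sectorAngle K` is zero, being equal
  -- to the one at `π / 2`. Any multiple of it may therefore be subtracted at no cost.
  have hkey : ∫ u : ℝ, diffLine ν A α X η e v u =
      ∫ u : ℝ, (diffLine ν A α X η e v (contour ‖η‖ (sectorAngle K) u) *
        contourDeriv ‖η‖ (sectorAngle K) u - (1 - (X ^ (2 - α) : ℝ) : ℂ) *
        (quadPhaseLine ν A X η e v (contour ‖η‖ (sectorAngle K) u) *
          contourDeriv ‖η‖ (sectorAngle K) u)) := by
    rw [integral_sub hFi (hHi.const_mul _), integral_const_mul, hHeq, mul_zero, sub_zero, ← hFeq]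
    simp [contour_zero_angle, contourDeriv_zero_angle]
  have hne : ∀ᵐ u : ℝ, u ≠ 0 := by simp [ae_iff]
  rw [hkey, ← integral_const_mul]
  refine norm_integral_le_of_norm_le (hint.const_mul _) ?_
  filter_upwards [hne] with u hu0
  have hu : 0 < u ^ 2 + ‖η‖ ^ 2 := by positivity
  rw [← mul_assoc, ← sub_mul, norm_mul]
  calc _ ≤ _ * 1 := mul_le_mul (hA.norm_diffLine_sub_le he hη hα hα2 hX v hu)
        (norm_contourDeriv_le _ _ _) (norm_nonneg _)
        ((norm_nonneg _).trans (hA.norm_diffLine_sub_le he hη hα hα2 hX v hu))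
    _ = _ := mul_one _

end

end StableKernel

/-! ### Slicing frequency space into lines parallel to a direction -/

namespace StableKernel

/-- Orthonormal coordinates of `E (n + 1)` whose first axis is spanned by a given unit vector. -/
theorem exists_measurePreserving_add_smul {n : ℕ} {e : E (n + 1)} (he : ‖e‖ = 1) :
    ∃ (T : (Fin n → ℝ) → E (n + 1)), (∀ y, inner ℝ (T y) e = 0) ∧
      MeasurableEmbedding (fun p : ℝ × (Fin n → ℝ) => T p.2 + p.1 • e) ∧
      MeasurePreserving (fun p : ℝ × (Fin n → ℝ) => T p.2 + p.1 • e) := by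
  obtain ⟨b, hb⟩ := Orthonormal.exists_orthonormalBasis_extension_of_card_eq (𝕜 := ℝ)
    (E := E (n + 1)) (ι := Fin (n + 1)) (v := fun _ => e) (s := {0}) (by simp) (by
      rw [orthonormal_iff_ite]
      rintro ⟨i, hi⟩ ⟨j, hj⟩
      have h1 : i = 0 := hi
      have h2 : j = 0 := hj
      subst h1 h2
      simp [he])
  have hb0 : b 0 = e := hb 0 rfl
  let φ : ℝ × (Fin n → ℝ) ≃ᵐ (Fin (n + 1) → ℝ) :=
    (MeasurableEquiv.piFinSuccAbove (fun _ : Fin (n + 1) => ℝ) 0).symm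
  have hφ : MeasurePreserving φ :=
    (volume_preserving_piFinSuccAbove (fun _ : Fin (n + 1) => ℝ) 0).symm _
  let ψ : (Fin (n + 1) → ℝ) ≃ᵐ E (n + 1) := MeasurableEquiv.toLp 2 _
  have hψ : MeasurePreserving ψ := PiLp.volume_preserving_toLp (Fin (n + 1))
  have hχ := b.measurePreserving_repr_symm
  have hφ_apply : ∀ p : ℝ × (Fin n → ℝ), φ p = Fin.cons p.1 p.2 := fun p => by
    simp [φ, MeasurableEquiv.piFinSuccAbove]
    rfl
  have hψ_apply : ∀ f : Fin (n + 1) → ℝ, ψ f = WithLp.toLp 2 f := fun _ => rfl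
  have heq : (fun p : ℝ × (Fin n → ℝ) => b.repr.symm (ψ (φ (0, p.2))) + p.1 • e) =
      fun p => b.repr.symm (ψ (φ p)) := by
    funext p
    rw [hφ_apply, hφ_apply, ← hb0, ← b.repr_symm_single 0, ← map_smul, ← map_add]
    congr 1
    ext i
    refine Fin.cases ?_ (fun j => ?_) i
    · simp [hψ_apply]
    · simp [hψ_apply]
  refine ⟨fun y => b.repr.symm (ψ (φ (0, y))), fun y => ?_, ?_, ?_⟩
  · rw [← hb0, real_inner_comm, ← b.repr_apply_apply, LinearIsometryEquiv.apply_symm_apply,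
      hφ_apply]
    simp [hψ_apply]
  · rw [heq]
    exact (b.repr.symm.toHomeomorph.toMeasurableEquiv.measurableEmbedding).comp
      (ψ.measurableEmbedding.comp φ.measurableEmbedding)
  · rw [heq]
    exact hχ.comp (hψ.comp hφ)

variable {n k : ℕ} {ι : Type*} [MeasurableSpace ι] {ν : Measure ι}

/-- The exponent `∫ ‖A r ξ‖ ^ α` of the characteristic function. -/
noncomputable def phase {d : ℕ} (ν : Measure ι) (A : ι → E d →L[ℝ] E d) (α : ℝ) (ξ : E d) : ℝ :=
  ∫ r, ‖A r ξ‖ ^ α ∂ν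

theorem phaseLine_ofReal {d : ℕ} (A : ι → E d →L[ℝ] E d) (α : ℝ) (η e : E d) (u : ℝ) :
    phaseLine ν A α η e u = (phase ν A α (η + u • e) : ℝ) := by
  rw [phaseLine, phase, ← integral_complex_ofReal]
  congr 1
  funext r
  rw [quadLine_ofReal, ← Complex.ofReal_cpow (by positivity), ← Real.rpow_natCast,
    ← Real.rpow_mul (norm_nonneg _)]
  congr 2
  push_cast; ring

/-- The difference of the two symbols times a product of linear forms. -/
noncomputable def symbolDiff {d : ℕ} (ν : Measure ι) (A : ι → E d →L[ℝ] E d) (α : ℝ)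
    (v : Fin k → E d) (ξ : E d) : ℝ :=
  (∏ j, inner ℝ ξ (v j)) * (Real.exp (-phase ν A α ξ) - Real.exp (-phase ν A 2 ξ))

/-- The Fourier integral of the difference of the two symbols is bounded by the integral of the
radial function `farKernel`. -/
theorem Elliptic.norm_integral_symbolDiff_le_farKernel [IsFiniteMeasure ν]
    {A : ι → E (n + 1) →L[ℝ] E (n + 1)} {K : ℝ} (hA : Elliptic K A) {e : E (n + 1)}
    (he : ‖e‖ = 1) {α X : ℝ} (hα : 0 < α) (hα2 : α ≤ 2) (hX : 0 < X)
    (hν : 0 < ν.real Set.univ) (v : Fin k → E (n + 1))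
    (hs : Integrable (symbolDiff ν A α v))
    (hint : Integrable fun ξ : E (n + 1) => farKernel (4 * K ^ 2) (Real.sin (sectorAngle K))
      (ν.real Set.univ) α X k ‖ξ‖) :
    ‖∫ ξ : E (n + 1), Complex.exp (-(X * (inner ℝ e ξ : ℝ)) * Complex.I) *
        (symbolDiff ν A α v ξ : ℂ)‖ ≤
      (∏ j, ‖v j‖) * ∫ ξ : E (n + 1), farKernel (4 * K ^ 2) (Real.sin (sectorAngle K))
        (ν.real Set.univ) α X k ‖ξ‖ := by
  obtain ⟨T, hT, hemb, hmp⟩ := exists_measurePreserving_add_smul he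
  have hnorm : ∀ p : ℝ × (Fin n → ℝ), ‖T p.2 + p.1 • e‖ = √(p.1 ^ 2 + ‖T p.2‖ ^ 2) := by
    intro p
    rw [← norm_add_smul_sq he (hT p.2), Real.sqrt_sq (norm_nonneg _)]
  have hi1 : Integrable fun ξ : E (n + 1) => Complex.exp (-(X * (inner ℝ e ξ : ℝ)) * Complex.I) *
      (symbolDiff ν A α v ξ : ℂ) := by
    refine hs.ofReal.bdd_mul (c := 1) (Continuous.aestronglyMeasurable (by fun_prop))
      (ae_of_all _ fun ξ => ?_)
    have := norm_exp_neg_mul_I X ((inner ℝ e ξ : ℝ) : ℂ)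
    rw [Complex.ofReal_im, mul_zero, Real.exp_zero] at this
    exact this.le
  have hi1' := (hmp.integrable_comp_emb hemb).2 hi1
  have hi2' := (hmp.integrable_comp_emb hemb).2 hint
  rw [← hmp.integral_comp hemb, ← hmp.integral_comp hemb, Measure.volume_eq_prod]
  rw [Measure.volume_eq_prod] at hi1' hi2'
  simp only [Function.comp_def] at hi1' hi2'
  -- Fubini with the coordinate along `e` as inner variable: since `T y ⟂ e`, the oscillating factor
  -- depends on `u` only. The majorant, being radial, is reassembled into an integral over the whole
  -- space.
  rw [integral_prod_symm _ hi1', integral_prod_symm _ hi2', ← integral_const_mul]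
  have hi2r := hi2'.integral_prod_right
  refine norm_integral_le_of_norm_le (hi2r.const_mul _) ?_
  filter_upwards [hi2'.prod_left_ae] with y hy
  simp only [hnorm (_, y)] at hy ⊢
  refine le_trans (le_of_eq ?_)
    (hA.norm_integral_diffLine_le he (hT y) hα hα2 hX hν v hy)
  congr 2
  funext u
  have h1 : inner ℝ e (T y + u • e) = u := by
    rw [inner_add_right, inner_smul_right, real_inner_comm, hT, real_inner_self_eq_norm_sq, he]
    simp
  rw [h1, diffLine, lineProd_ofReal, phaseLine_ofReal, phaseLine_ofReal, symbolDiff]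
  push_cast
  ring

end StableKernel

/-! ### Scaling of the radial majorants -/

namespace StableKernel

section Weight

/-- The integral of the weight `(1 + ‖ξ‖) ^ (-(d + 1))`. -/
noncomputable def weightIntegral (d : ℕ) : ℝ := ∫ ξ : E d, ((1 + ‖ξ‖) ^ (d + 1))⁻¹

theorem weightIntegral_nonneg (d : ℕ) : 0 ≤ weightIntegral d :=
  integral_nonneg fun _ => by positivity

theorem integrable_weight (d : ℕ) : Integrable fun ξ : E d => ((1 + ‖ξ‖) ^ (d + 1))⁻¹ := by
  have h := integrable_one_add_norm (E := E d) (μ := volume) (r := (d + 1 : ℕ)) (by simp)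
  refine h.congr (ae_of_all _ fun ξ => ?_)
  simp only
  rw [Real.rpow_neg (by positivity), Real.rpow_natCast]

theorem integrable_weight_scaled (d : ℕ) {X : ℝ} (hX : 0 < X) :
    Integrable fun ξ : E d => ((1 + X * ‖ξ‖) ^ (d + 1))⁻¹ := by
  refine ((integrable_weight d).comp_smul hX.ne').congr (ae_of_all _ fun ξ => ?_)
  simp only
  rw [norm_smul, Real.norm_of_nonneg hX.le]

theorem integral_weight_scaled (d : ℕ) {X : ℝ} (hX : 0 < X) :
    ∫ ξ : E d, ((1 + X * ‖ξ‖) ^ (d + 1))⁻¹ = (X ^ d)⁻¹ * weightIntegral d := by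
  have h := Measure.integral_comp_smul_of_nonneg volume
    (fun ξ : E d => ((1 + ‖ξ‖) ^ (d + 1))⁻¹) X (hR := hX.le)
  simp only [norm_smul, Real.norm_of_nonneg hX.le, smul_eq_mul, finrank_euclideanSpace,
    Fintype.card_fin] at h
  exact h

end Weight

section Radial

theorem one_add_abs_log_div_le {r X : ℝ} (hr : 0 < r) (hX : 0 < X) :
    1 + |Real.log (r / X)| ≤ (1 + |Real.log X|) * (1 + |Real.log r|) := by
  rw [Real.log_div hr.ne' hX.ne']
  have := abs_sub (Real.log r) (Real.log X)
  nlinarith [abs_nonneg (Real.log r), abs_nonneg (Real.log X),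
    mul_nonneg (abs_nonneg (Real.log r)) (abs_nonneg (Real.log X))]

theorem div_rpow_add_div_sq {r X α : ℝ} (hr : 0 < r) (hX : 0 < X) :
    (r / X) ^ α + (r / X) ^ 2 = X ^ (-α) * r ^ α + X ^ (-2 : ℝ) * r ^ 2 := by
  rw [Real.div_rpow hr.le hX.le, Real.rpow_neg hX.le, Real.rpow_neg hX.le, div_pow]
  norm_cast
  field_simp

theorem div_rpow_add_div_sq_le {r X α : ℝ} (hr : 0 < r) (hX : 0 < X) :
    (r / X) ^ α + (r / X) ^ 2 ≤ (X ^ (-α) + X ^ (-2 : ℝ)) * (r ^ α + r ^ 2) := by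
  rw [div_rpow_add_div_sq hr hX]
  have h1 := Real.rpow_pos_of_pos hX (-α)
  have h2 := Real.rpow_pos_of_pos hX (-2)
  have h3 := Real.rpow_pos_of_pos hr α
  nlinarith [mul_pos h1 (pow_pos hr 2), mul_pos h2 h3]

/-- The dependence of the far bound on `t` and the scale `X`. -/
noncomputable def farFactor (t α X : ℝ) : ℝ :=
  t * X ^ (-α) + t ^ 2 * (1 + |Real.log X|) * (X ^ (-α) + X ^ (-2 : ℝ)) ^ 2

theorem farFactor_nonneg {t α X : ℝ} (ht : 0 ≤ t) (hX : 0 < X) : 0 ≤ farFactor t α X := by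
  unfold farFactor
  positivity

/-- Substituting `ρ = r / X` separates the variables: the exponential becomes `exp (-s r)`, the
linear forms give `X ^ (-k)`, the first order term only `t X ^ (-α)` with no `log X`, and the
remainder the second summand of `farFactor`. -/
theorem exists_farKernel_le (d k : ℕ) {α₀ κ s : ℝ} (hα₀ : 0 < α₀) (hκ : 1 ≤ κ) (hs : 0 < s) :
    ∃ C : ℝ, 0 < C ∧ ∀ t α X ρ : ℝ, 0 ≤ t → α₀ ≤ α → α ≤ 2 → 0 < X → 0 ≤ ρ →
      0 ≤ farKernel κ s t α X k ρ ∧ farKernel κ s t α X k ρ ≤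
        C * ((2 - α) * (X ^ k)⁻¹ * farFactor t α X) * ((1 + X * ρ) ^ (d + 1))⁻¹ := by
  -- Powers to be absorbed: `k` from the linear forms, `6` from using the cubic bound
  -- `one_add_abs_log_mul_le` twice in the remainder, and `d + 1` for an integrable weight.
  obtain ⟨C, hC, hCb⟩ := exists_pow_mul_exp_neg_rpow_le (k + 6 + (d + 1)) hs one_pos
  set c₁ := 2 + 2 / α₀ with hc₁
  have hc₁1 : 1 ≤ c₁ := by
    have : 0 ≤ 2 / α₀ := by positivity
    linarith
  refine ⟨2 ^ k * (κ * (κ + 4) * κ * c₁ ^ 2) * C, by positivity,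
    fun t α X ρ ht hα hα2 hX hρ => ⟨?_, ?_⟩⟩
  · have : 0 ≤ 2 - α := by linarith
    unfold farKernel
    positivity
  rcases hρ.eq_or_lt with rfl | hρ
  · have h0 : (0 : ℝ) ^ α = 0 := Real.zero_rpow (by linarith)
    have h2 : 0 ≤ 2 - α := by linarith
    have := farFactor_nonneg (α := α) ht hX
    have : farKernel κ s t α X k 0 = 0 := by
      simp [farKernel, h0]
    rw [this]
    positivity
  obtain ⟨r, hr, rfl⟩ : ∃ r, 0 < r ∧ ρ = r / X := ⟨X * ρ, by positivity, by field_simp⟩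
  have hXr : X * (r / X) = r := by field_simp
  have hlog := one_add_abs_log_div_le hr hX
  have hpow := div_rpow_add_div_sq_le (α := α) hr hX
  have hL := one_add_abs_log_mul_le hα₀ hα hα2 hr
  have hP : r ^ α + r ^ 2 ≤ (1 + |Real.log r|) * (r ^ α + r ^ 2) :=
    le_mul_of_one_le_left (by positivity) (by linarith [abs_nonneg (Real.log r)])
  have h2α : 0 ≤ 2 - α := by linarith
  have hE := hCb r hr 1 le_rfl
  rw [Real.rpow_one] at hE
  set L := (1 + |Real.log r|) * (r ^ α + r ^ 2) with hLd
  have hL0 : 0 ≤ L := by positivity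
  set q := X ^ (-α) + X ^ (-2 : ℝ) with hq
  have hq0 : 0 ≤ q := by positivity
  have hlin : t * (κ * (κ + 4) * (2 - α) * X ^ (-α) * L) ≤
      κ * (κ + 4) * κ * c₁ ^ 2 * (1 + r) ^ 6 * (2 - α) * (t * X ^ (-α)) := by
    have h1 : L ≤ κ * c₁ ^ 2 * (1 + r) ^ 6 := by
      calc L ≤ 1 * (c₁ * 1) * ((1 + r) ^ 3 * 1) := by linarith
        _ ≤ κ * (c₁ * c₁) * ((1 + r) ^ 3 * (1 + r) ^ 3) := by
            gcongr
            exact one_le_pow₀ (by linarith)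
        _ = _ := by ring
    calc t * (κ * (κ + 4) * (2 - α) * X ^ (-α) * L)
        = κ * (κ + 4) * (2 - α) * (t * X ^ (-α)) * L := by ring
      _ ≤ κ * (κ + 4) * (2 - α) * (t * X ^ (-α)) * (κ * c₁ ^ 2 * (1 + r) ^ 6) := by
          gcongr
      _ = _ := by ring
  have hquad : t * (κ * (κ + 4) * (2 - α) * ((1 + |Real.log (r / X)|) *
        ((r / X) ^ α + (r / X) ^ 2))) * (t * (κ * (r / X) ^ α) + t * (κ * (r / X) ^ 2)) ≤
      κ * (κ + 4) * κ * c₁ ^ 2 * (1 + r) ^ 6 * (2 - α) *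
        (t ^ 2 * (1 + |Real.log X|) * q ^ 2) := by
    have h1 : (1 + |Real.log (r / X)|) * ((r / X) ^ α + (r / X) ^ 2) ≤
        (1 + |Real.log X|) * q * L := by
      calc _ ≤ ((1 + |Real.log X|) * (1 + |Real.log r|)) * (q * (r ^ α + r ^ 2)) := by gcongr
        _ = _ := by rw [hLd]; ring
    have h2 : (r / X) ^ α + (r / X) ^ 2 ≤ q * L := hpow.trans (by gcongr)
    have h3 : L * L ≤ c₁ ^ 2 * (1 + r) ^ 6 := by
      calc L * L ≤ (c₁ * (1 + r) ^ 3) * (c₁ * (1 + r) ^ 3) := by gcongr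
        _ = _ := by ring
    calc _ = κ * (κ + 4) * κ * (2 - α) * t ^ 2 * (((1 + |Real.log (r / X)|) *
          ((r / X) ^ α + (r / X) ^ 2)) * ((r / X) ^ α + (r / X) ^ 2)) := by ring
      _ ≤ κ * (κ + 4) * κ * (2 - α) * t ^ 2 * (((1 + |Real.log X|) * q * L) * (q * L)) := by
          gcongr
      _ = κ * (κ + 4) * κ * (2 - α) * (t ^ 2 * (1 + |Real.log X|) * q ^ 2) * (L * L) := by ring
      _ ≤ κ * (κ + 4) * κ * (2 - α) * (t ^ 2 * (1 + |Real.log X|) * q ^ 2) *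
          (c₁ ^ 2 * (1 + r) ^ 6) := by gcongr
      _ = _ := by ring
  have hexp : Real.exp (-(s * r)) * r ^ k * (1 + r) ^ 6 ≤ C * ((1 + r) ^ (d + 1))⁻¹ := by
    rw [← div_eq_mul_inv, le_div_iff₀ (by positivity)]
    refine le_trans ?_ hE
    calc Real.exp (-(s * r)) * r ^ k * (1 + r) ^ 6 * (1 + r) ^ (d + 1)
        ≤ Real.exp (-(s * r)) * (1 + r) ^ k * (1 + r) ^ 6 * (1 + r) ^ (d + 1) := by
          gcongr; linarith
      _ = _ := by rw [pow_add, pow_add]; ring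
  have hfac := farFactor_nonneg (α := α) ht hX
  rw [farKernel, hXr]
  have e1 : X * s * (r / X) = s * r := by field_simp
  have e2 : (2 * (r / X)) ^ k = 2 ^ k * (X ^ k)⁻¹ * r ^ k := by
    rw [mul_pow, div_pow]; field_simp
  rw [e1, e2]
  calc _ ≤ Real.exp (-(s * r)) * (2 ^ k * (X ^ k)⁻¹ * r ^ k) *
        (κ * (κ + 4) * κ * c₁ ^ 2 * (1 + r) ^ 6 * (2 - α) * (t * X ^ (-α)) +
        κ * (κ + 4) * κ * c₁ ^ 2 * (1 + r) ^ 6 * (2 - α) *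
          (t ^ 2 * (1 + |Real.log X|) * q ^ 2)) := by gcongr
    _ = 2 ^ k * (κ * (κ + 4) * κ * c₁ ^ 2) * ((2 - α) * (X ^ k)⁻¹ * farFactor t α X) *
        (Real.exp (-(s * r)) * r ^ k * (1 + r) ^ 6) := by rw [farFactor, ← hq]; ring
    _ ≤ 2 ^ k * (κ * (κ + 4) * κ * c₁ ^ 2) * ((2 - α) * (X ^ k)⁻¹ * farFactor t α X) *
        (C * ((1 + r) ^ (d + 1))⁻¹) := by gcongr
    _ = _ := by ring

theorem measurable_farKernel (κ s t α X : ℝ) (k : ℕ) : Measurable (farKernel κ s t α X k) := by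
  unfold farKernel
  have h1 : Measurable fun ρ : ℝ => ρ ^ α := measurable_id.pow_const α
  have h2 : Measurable fun ρ : ℝ => (X * ρ) ^ α := (measurable_id.const_mul X).pow_const α
  fun_prop

/-- The dependence of the near bound on `t`. -/
theorem exists_near_radial_le (d k : ℕ) {α₀ c : ℝ} (hα₀ : 0 < α₀) (hc : 0 < c) :
    ∃ C : ℝ, 0 < C ∧ ∀ t α γ ρ : ℝ, 0 < t → α₀ ≤ α → α ≤ 2 → α₀ ≤ γ → 0 < ρ →
      ρ ^ k * (t * ((1 + |Real.log ρ|) * (ρ ^ α + ρ ^ 2))) * Real.exp (-(c * (t * ρ ^ γ))) ≤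
        C * ((t ^ (k / γ))⁻¹ * (1 + |Real.log t|) * (t ^ (1 - α / γ) + t ^ (1 - 2 / γ))) *
          ((1 + t ^ (1 / γ) * ρ) ^ (d + 1))⁻¹ := by
  obtain ⟨C, hC, hCb⟩ := exists_pow_mul_exp_neg_rpow_le (k + 3 + (d + 1)) hc hα₀
  refine ⟨(1 + 1 / α₀) * (2 + 2 / α₀) * C, by positivity,
    fun t α γ ρ ht hα hα2 hγ hρ => ?_⟩
  have hγ0 : 0 < γ := hα₀.trans_le hγ
  -- At this scale `t ρ ^ γ = r ^ γ`, so the exponential no longer depends on `t`. The lemma is used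
  -- with `γ = α` and with `γ = 2`.
  set X := t ^ (1 / γ) with hXd
  have hX : 0 < X := Real.rpow_pos_of_pos ht _
  have hlogX : |Real.log X| ≤ 1 / α₀ * |Real.log t| := by
    rw [hXd, Real.log_rpow ht, abs_mul, abs_of_pos (by positivity)]
    gcongr
  obtain ⟨r, hr, rfl⟩ : ∃ r, 0 < r ∧ ρ = r / X := ⟨X * ρ, by positivity, by field_simp⟩
  have hXr : X * (r / X) = r := by field_simp
  have hXγ : X ^ γ = t := by
    rw [hXd, ← Real.rpow_mul ht.le, one_div_mul_cancel hγ0.ne', Real.rpow_one]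
  have hXk : X ^ k = t ^ (k / γ) := by
    rw [hXd, ← Real.rpow_natCast, ← Real.rpow_mul ht.le]; congr 1; ring
  have hXα : ∀ β : ℝ, t * X ^ (-β) = t ^ (1 - β / γ) := by
    intro β
    rw [hXd, ← Real.rpow_mul ht.le, sub_eq_add_neg, Real.rpow_add ht, Real.rpow_one]
    congr 2; ring
  have hlog := one_add_abs_log_div_le hr hX
  have hpow := div_rpow_add_div_sq_le (α := α) hr hX
  have hL := one_add_abs_log_mul_le hα₀ hα hα2 hr
  have hE := hCb r hr γ hγ
  have e1 : t * (r / X) ^ γ = r ^ γ := by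
    rw [Real.div_rpow hr.le hX.le, hXγ]; field_simp
  have hexp : r ^ k * (1 + r) ^ 3 * Real.exp (-(c * r ^ γ)) ≤ C * ((1 + r) ^ (d + 1))⁻¹ := by
    rw [← div_eq_mul_inv, le_div_iff₀ (by positivity)]
    refine le_trans ?_ hE
    calc r ^ k * (1 + r) ^ 3 * Real.exp (-(c * r ^ γ)) * (1 + r) ^ (d + 1)
        ≤ (1 + r) ^ k * (1 + r) ^ 3 * Real.exp (-(c * r ^ γ)) * (1 + r) ^ (d + 1) := by
          gcongr; linarith
      _ = _ := by rw [pow_add, pow_add]; ring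
  have h1X : 1 + |Real.log X| ≤ (1 + 1 / α₀) * (1 + |Real.log t|) := by
    have : 0 ≤ 1 / α₀ := by positivity
    nlinarith [abs_nonneg (Real.log t)]
  rw [e1, hXr, div_pow, ← hXk, ← hXα, ← hXα, ← mul_add]
  calc _ ≤ r ^ k / X ^ k * (t * (((1 + 1 / α₀) * (1 + |Real.log t|) * (1 + |Real.log r|)) *
        ((X ^ (-α) + X ^ (-2 : ℝ)) * (r ^ α + r ^ 2)))) * Real.exp (-(c * r ^ γ)) := by
        gcongr
        exact hlog.trans (by gcongr)
    _ = (1 + 1 / α₀) * ((X ^ k)⁻¹ * (1 + |Real.log t|) * (t * (X ^ (-α) + X ^ (-2 : ℝ)))) *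
        (r ^ k * Real.exp (-(c * r ^ γ))) * ((1 + |Real.log r|) * (r ^ α + r ^ 2)) := by
        ring
    _ ≤ (1 + 1 / α₀) * ((X ^ k)⁻¹ * (1 + |Real.log t|) * (t * (X ^ (-α) + X ^ (-2 : ℝ)))) *
        (r ^ k * Real.exp (-(c * r ^ γ))) * ((2 + 2 / α₀) * (1 + r) ^ 3) := by gcongr
    _ = (1 + 1 / α₀) * (2 + 2 / α₀) * ((X ^ k)⁻¹ * (1 + |Real.log t|) *
        (t * (X ^ (-α) + X ^ (-2 : ℝ)))) * (r ^ k * (1 + r) ^ 3 * Real.exp (-(c * r ^ γ))) := by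
        ring
    _ ≤ (1 + 1 / α₀) * (2 + 2 / α₀) * ((X ^ k)⁻¹ * (1 + |Real.log t|) *
        (t * (X ^ (-α) + X ^ (-2 : ℝ)))) * (C * ((1 + r) ^ (d + 1))⁻¹) := by gcongr
    _ = _ := by ring

end Radial

end StableKernel

/-! ### Size and integrability of the real symbols -/

namespace StableKernel

variable {d k : ℕ} {ι : Type*} [MeasurableSpace ι] {ν : Measure ι} [IsFiniteMeasure ν]
  {A : ι → E d →L[ℝ] E d} {K α : ℝ}

/-- A nonzero real frequency is the point `‖ξ‖` on the line through the origin with direction `ξ /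
‖ξ‖`, so the complex estimates specialize to the real phase. -/
theorem Elliptic.sectorial_real (hA : Elliptic K A) {ξ : E d} (hξ : ξ ≠ 0) (r : ι) :
    Sectorial (4 * K ^ 2) ‖ξ‖ (quadLine (A r) 0 (‖ξ‖⁻¹ • ξ) (‖ξ‖ : ℝ)) := by
  have hn : 0 < ‖ξ‖ := norm_pos_iff.2 hξ
  have he : ‖‖ξ‖⁻¹ • ξ‖ = 1 := by
    rw [norm_smul, norm_inv, norm_norm, inv_mul_cancel₀ hn.ne']
  have := hA.sectorial_contour (η := 0) (θ := 0) (u := ‖ξ‖) he (by simp)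
    ⟨le_rfl, (sectorAngle_pos hA.one_le).le⟩ (by positivity) r
  rw [contour_zero_angle] at this
  simpa [Real.sqrt_sq hn.le] using this

omit [IsFiniteMeasure ν] in
theorem phaseLine_norm {ξ : E d} (hξ : ξ ≠ 0) :
    phaseLine ν A α 0 (‖ξ‖⁻¹ • ξ) (‖ξ‖ : ℝ) = (phase ν A α ξ : ℝ) := by
  have hn : 0 < ‖ξ‖ := norm_pos_iff.2 hξ
  rw [phaseLine_ofReal, zero_add, smul_smul, mul_inv_cancel₀ hn.ne', one_smul]

theorem Elliptic.phase_ge (hA : Elliptic K A) (hα : 0 < α) (hα2 : α ≤ 2) (ξ : E d) :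
    1 / (4 * K ^ 2) ^ 3 * (ν.real Set.univ * ‖ξ‖ ^ α) ≤ phase ν A α ξ := by
  have hK := hA.one_le
  rcases eq_or_ne ξ 0 with rfl | hξ
  · simp [phase, Real.zero_rpow hα.ne']
  have := hA.re_phaseLine_ge (ν := ν) (by nlinarith) (norm_pos_iff.2 hξ) (hA.sectorial_real hξ)
    hα hα2
  rw [phaseLine_norm hξ, Complex.ofReal_re] at this
  refine le_trans (le_of_eq ?_) this
  ring

theorem Elliptic.abs_phase_sub_le (hA : Elliptic K A) (hα : 0 < α) (hα2 : α ≤ 2) {ξ : E d}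
    (hξ : ξ ≠ 0) : |phase ν A α ξ - phase ν A 2 ξ| ≤
      4 * K ^ 2 * (4 * K ^ 2 + 4) * (2 - α) *
        (ν.real Set.univ * ((1 + |Real.log ‖ξ‖|) * (‖ξ‖ ^ α + ‖ξ‖ ^ 2))) := by
  have hK := hA.one_le
  have := hA.norm_phaseLine_sub_le (ν := ν) (by nlinarith) (norm_pos_iff.2 hξ)
    (hA.sectorial_real hξ) hα hα2
  rw [phaseLine_norm hξ, phaseLine_norm hξ, ← Complex.ofReal_sub, Complex.norm_real,
    Real.norm_eq_abs] at this
  refine this.trans (le_of_eq ?_)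
  ring

theorem Elliptic.measurable_phase (hA : Elliptic K A) : Measurable (phase ν A α) := by
  have h1 : StronglyMeasurable (Function.uncurry fun (ξ : E d) (r : ι) => A r ξ) :=
    stronglyMeasurable_uncurry_of_continuous_of_stronglyMeasurable
      (fun r => (A r).continuous) (fun ξ => (hA.measurable ξ).stronglyMeasurable)
  have h2 : StronglyMeasurable (Function.uncurry fun (ξ : E d) (r : ι) => ‖A r ξ‖ ^ α) :=
    (h1.norm.measurable.pow_const α).stronglyMeasurable
  exact h2.integral_prod_right.measurable

theorem Elliptic.integrable_norm_pow_mul_exp_neg_phase (hA : Elliptic K A) (hα : 0 < α)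
    (hα2 : α ≤ 2) (hν : 0 < ν.real Set.univ) (m : ℕ) :
    Integrable fun ξ : E d => ‖ξ‖ ^ m * Real.exp (-phase ν A α ξ) := by
  have hK := hA.one_le
  have hm := hA.measurable_phase (ν := ν) (α := α)
  obtain ⟨C, hC, hCb⟩ := exists_pow_mul_exp_neg_rpow_le (m + (d + 1))
    (c := 1 / (4 * K ^ 2) ^ 3 * ν.real Set.univ) (by positivity) hα
  have h0 : ∀ᵐ ξ : E d, 0 < ‖ξ‖ ∨ ‖ξ‖ = 0 := ae_of_all _ fun ξ =>
    (norm_nonneg ξ).eq_or_lt.elim (fun h => Or.inr h.symm) Or.inl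
  -- The extra `1` covers the origin, where the bound with constant `C` is not available.
  refine ((integrable_weight d).const_mul (C + 1)).mono'
    (Measurable.aestronglyMeasurable (by fun_prop)) ?_
  filter_upwards [h0] with ξ hξ
  rw [Real.norm_of_nonneg (by positivity), ← div_eq_mul_inv, le_div_iff₀ (by positivity)]
  have hle : Real.exp (-phase ν A α ξ) ≤
      Real.exp (-(1 / (4 * K ^ 2) ^ 3 * ν.real Set.univ * ‖ξ‖ ^ α)) := by
    refine Real.exp_le_exp.2 (neg_le_neg ?_)
    rw [mul_assoc]
    exact hA.phase_ge hα hα2 ξ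
  rcases hξ with hξ | hξ
  · refine le_trans ?_ ((hCb ‖ξ‖ hξ α le_rfl).trans (by linarith))
    calc _ ≤ (1 + ‖ξ‖) ^ m * Real.exp (-(1 / (4 * K ^ 2) ^ 3 * ν.real Set.univ * ‖ξ‖ ^ α)) *
          (1 + ‖ξ‖) ^ (d + 1) := by gcongr; linarith
      _ = _ := by rw [pow_add]; ring
  · have h1 : Real.exp (-phase ν A α ξ) ≤ 1 := by
      refine hle.trans (Real.exp_le_one_iff.2 ?_)
      simp only [Left.neg_nonpos_iff]
      positivity
    rw [hξ] at *
    have h2 : (0 : ℝ) ^ m ≤ 1 := pow_le_one₀ le_rfl zero_le_one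
    simp only [add_zero, one_pow, mul_one]
    have := mul_le_mul h2 h1 (Real.exp_pos _).le zero_le_one
    linarith

omit [IsFiniteMeasure ν] in
theorem abs_prod_inner_le (v : Fin k → E d) (ξ : E d) :
    |∏ j, inner ℝ ξ (v j)| ≤ (∏ j, ‖v j‖) * ‖ξ‖ ^ k := by
  have h1 : (∏ j, ‖v j‖) * ‖ξ‖ ^ k = ∏ j : Fin k, (‖ξ‖ * ‖v j‖) := by
    rw [Finset.prod_mul_distrib]; simp; ring
  rw [Finset.abs_prod, h1]
  exact Finset.prod_le_prod (fun _ _ => abs_nonneg _) fun j _ => abs_real_inner_le_norm _ _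

omit [IsFiniteMeasure ν] in
theorem abs_symbolDiff_le (v : Fin k → E d) (ξ : E d) :
    |symbolDiff ν A α v ξ| ≤ (∏ j, ‖v j‖) *
      (‖ξ‖ ^ k * |Real.exp (-phase ν A α ξ) - Real.exp (-phase ν A 2 ξ)|) := by
  rw [symbolDiff, abs_mul, ← mul_assoc]
  gcongr
  exact abs_prod_inner_le v ξ

theorem Elliptic.measurable_symbolDiff (hA : Elliptic K A) (v : Fin k → E d) :
    Measurable (symbolDiff ν A α v) := by
  have h1 := hA.measurable_phase (ν := ν) (α := α)
  have h2 := hA.measurable_phase (ν := ν) (α := 2)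
  unfold symbolDiff
  fun_prop

theorem Elliptic.integrable_norm_pow_mul_abs_sub (hA : Elliptic K A) (hα : 0 < α)
    (hα2 : α ≤ 2) (hν : 0 < ν.real Set.univ) (m : ℕ) :
    Integrable fun ξ : E d =>
      ‖ξ‖ ^ m * |Real.exp (-phase ν A α ξ) - Real.exp (-phase ν A 2 ξ)| := by
  have h1 := hA.measurable_phase (ν := ν) (α := α)
  have h2 := hA.measurable_phase (ν := ν) (α := 2)
  refine ((hA.integrable_norm_pow_mul_exp_neg_phase hα hα2 hν m).add
    (hA.integrable_norm_pow_mul_exp_neg_phase two_pos le_rfl hν m)).mono'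
    (Measurable.aestronglyMeasurable (by fun_prop)) (ae_of_all _ fun ξ => ?_)
  rw [Real.norm_of_nonneg (by positivity)]
  simp only [Pi.add_apply]
  rw [← mul_add]
  gcongr
  refine (abs_sub _ _).trans_eq ?_
  rw [abs_of_pos (Real.exp_pos _), abs_of_pos (Real.exp_pos _)]

theorem Elliptic.integrable_symbolDiff (hA : Elliptic K A) (hα : 0 < α)
    (hα2 : α ≤ 2) (hν : 0 < ν.real Set.univ) (v : Fin k → E d) :
    Integrable (symbolDiff ν A α v) :=
  ((hA.integrable_norm_pow_mul_abs_sub hα hα2 hν k).const_mul (∏ j, ‖v j‖)).mono'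
    (hA.measurable_symbolDiff v).aestronglyMeasurable (ae_of_all _ fun ξ => abs_symbolDiff_le v ξ)

end StableKernel

/-! ### The near bound -/

namespace StableKernel

theorem rate_nonneg {α t : ℝ} (hα2 : α ≤ 2) (ht : 0 < t) : 0 ≤ rate α t := by
  have : 0 ≤ 2 - α := by linarith
  unfold rate
  positivity

theorem rpow_le_rpow_of_le_max {t T a b : ℝ} (ht : 0 < t) (htT : t ≤ T) (hT : 1 ≤ T)
    (ha : 0 ≤ a) (hab : a ≤ b) : t ^ a ≤ T ^ b :=
  (Real.rpow_le_rpow ht.le htT ha).trans (Real.rpow_le_rpow_of_exponent_le hT hab)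

variable (ι : Type*) [MeasurableSpace ι]

/-- The difference of the exponentials is at most `|Φ_α - Φ_2|` times their sum, and each summand is
integrated at its own scale. The scale `t ^ (1/α)` gives exactly `rate α t * t ^ (-(d + k) / α)`,
the factor `1 + t ^ ((α - 2) / α)` being `t ^ (1 - α / α) + t ^ (1 - 2 / α)`. The scale `t ^ (1/2)`
gives something smaller up to powers of `T`. -/
theorem exists_near_integral_le (d k : ℕ) {T α₀ K : ℝ} (hT : 1 ≤ T) (hα₀ : 0 < α₀)
    (hK : 1 ≤ K) :
    ∃ C : ℝ, 0 < C ∧ ∀ (ν : Measure ι) [IsFiniteMeasure ν] (A : ι → E d →L[ℝ] E d),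
      Elliptic K A → ∀ α t : ℝ, α₀ ≤ α → α ≤ 2 → 0 < t → t ≤ T → ν.real Set.univ = t →
      ∫ ξ : E d, ‖ξ‖ ^ k * |Real.exp (-phase ν A α ξ) - Real.exp (-phase ν A 2 ξ)| ≤
        C * rate α t * t ^ (-((d : ℝ) + k) / α) := by
  obtain ⟨C, hC, hCb⟩ := exists_near_radial_le d k hα₀
    (c := 1 / (4 * K ^ 2) ^ 3) (by positivity)
  set κ' := 4 * K ^ 2 * (4 * K ^ 2 + 4) with hκ'
  have hκ'0 : 0 < κ' := by positivity
  set I := weightIntegral d with hI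
  have hI0 : 0 ≤ I := weightIntegral_nonneg d
  refine ⟨κ' * C * (I + 1) * (1 + 2 * T * T ^ (((d : ℝ) + k) / α₀)), by positivity,
    fun ν _ A hA α t hα hα2 ht htT hν => ?_⟩
  have hα0 : 0 < α := hα₀.trans_le hα
  have h2α : 0 ≤ 2 - α := by linarith
  set f : ℝ → ℝ := fun γ =>
    (t ^ (k / γ))⁻¹ * (1 + |Real.log t|) * (t ^ (1 - α / γ) + t ^ (1 - 2 / γ)) with hf
  have hf0 : ∀ γ, 0 ≤ f γ := fun γ => by
    simp only [hf]; positivity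
  have hw : ∀ γ : ℝ, 0 < t ^ (1 / γ) := fun γ => Real.rpow_pos_of_pos ht _
  have hpt : ∀ ξ : E d, ξ ≠ 0 →
      ‖ξ‖ ^ k * |Real.exp (-phase ν A α ξ) - Real.exp (-phase ν A 2 ξ)| ≤
      κ' * (2 - α) * (C * f α * ((1 + t ^ (1 / α) * ‖ξ‖) ^ (d + 1))⁻¹ +
        C * f 2 * ((1 + t ^ (1 / (2 : ℝ)) * ‖ξ‖) ^ (d + 1))⁻¹) := by
    intro ξ hξ
    have hn : 0 < ‖ξ‖ := norm_pos_iff.2 hξ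
    have h1 := abs_exp_neg_sub_exp_neg_le (phase ν A α ξ) (phase ν A 2 ξ)
    have h2 := hA.abs_phase_sub_le (ν := ν) hα0 hα2 hξ
    have h3 := hA.phase_ge (ν := ν) hα0 hα2 ξ
    have h4 := hA.phase_ge (ν := ν) two_pos le_rfl ξ
    have h5 := hCb t α α ‖ξ‖ ht hα hα2 hα hn
    have h6 := hCb t α 2 ‖ξ‖ ht hα hα2 (hα.trans hα2) hn
    rw [hν] at h2 h3 h4
    set S := t * ((1 + |Real.log ‖ξ‖|) * (‖ξ‖ ^ α + ‖ξ‖ ^ 2)) with hS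
    have hS0 : 0 ≤ S := by positivity
    calc _ ≤ ‖ξ‖ ^ k * ((κ' * (2 - α) * S) *
          (Real.exp (-(1 / (4 * K ^ 2) ^ 3 * (t * ‖ξ‖ ^ α))) +
            Real.exp (-(1 / (4 * K ^ 2) ^ 3 * (t * ‖ξ‖ ^ (2 : ℝ)))))) := by
          gcongr
          refine h1.trans ?_
          gcongr
      _ = κ' * (2 - α) *
          (‖ξ‖ ^ k * S * Real.exp (-(1 / (4 * K ^ 2) ^ 3 * (t * ‖ξ‖ ^ α))) +
          ‖ξ‖ ^ k * S * Real.exp (-(1 / (4 * K ^ 2) ^ 3 * (t * ‖ξ‖ ^ (2 : ℝ))))) := by ring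
      _ ≤ _ := by gcongr
  have hi : Integrable fun ξ : E d => κ' * (2 - α) *
      (C * f α * ((1 + t ^ (1 / α) * ‖ξ‖) ^ (d + 1))⁻¹ +
        C * f 2 * ((1 + t ^ (1 / (2 : ℝ)) * ‖ξ‖) ^ (d + 1))⁻¹) :=
    (((integrable_weight_scaled d (hw α)).const_mul _).add
      ((integrable_weight_scaled d (hw 2)).const_mul _)).const_mul _
  have hpow : ∀ γ : ℝ, 0 < γ → ((t ^ (1 / γ)) ^ d)⁻¹ * (t ^ (k / γ))⁻¹ =
      t ^ (-((d : ℝ) + k) / γ) := by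
    intro γ hγ
    rw [← Real.rpow_natCast, ← Real.rpow_mul ht.le, ← Real.rpow_neg ht.le, ← Real.rpow_neg ht.le,
      ← Real.rpow_add ht]
    congr 1
    field_simp
    ring
  -- The quotient of the two powers is `t` to an exponent between `0` and `(d + k) / α₀`, hence
  -- bounded for `t ≤ T`.
  have hmono : t ^ (-((d : ℝ) + k) / 2) ≤
      T ^ (((d : ℝ) + k) / α₀) * t ^ (-((d : ℝ) + k) / α) := by
    have e : t ^ (-((d : ℝ) + k) / 2) =
        t ^ (((d : ℝ) + k) / α - ((d : ℝ) + k) / 2) * t ^ (-((d : ℝ) + k) / α) := by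
      rw [← Real.rpow_add ht]; congr 1; ring
    rw [e]
    gcongr
    refine rpow_le_rpow_of_le_max ht htT hT ?_ ?_
    · rw [sub_nonneg]; gcongr
    · have h1 : ((d : ℝ) + k) / α ≤ ((d : ℝ) + k) / α₀ := by gcongr
      have h2 : 0 ≤ ((d : ℝ) + k) / 2 := by positivity
      linarith
  have hfα : ((t ^ (1 / α)) ^ d)⁻¹ * f α =
      (1 + |Real.log t|) * (1 + t ^ ((α - 2) / α)) * t ^ (-((d : ℝ) + k) / α) := by
    have e1 : (1 : ℝ) - α / α = 0 := by rw [div_self hα0.ne', sub_self]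
    have e2 : (1 : ℝ) - 2 / α = (α - 2) / α := by field_simp
    simp only [hf]
    rw [e1, e2, Real.rpow_zero, ← hpow α hα0]
    ring
  have hf2 : ((t ^ (1 / (2 : ℝ))) ^ d)⁻¹ * f 2 ≤
      2 * T * T ^ (((d : ℝ) + k) / α₀) *
        ((1 + |Real.log t|) * (1 + t ^ ((α - 2) / α)) * t ^ (-((d : ℝ) + k) / α)) := by
    have e1 : (1 : ℝ) - 2 / 2 = 0 := by norm_num
    have e2 : t ^ (1 - α / 2) ≤ T := by
      calc t ^ (1 - α / 2) ≤ T ^ (1 : ℝ) :=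
            rpow_le_rpow_of_le_max ht htT hT (by linarith) (by linarith)
        _ = T := Real.rpow_one T
    have e3 : 0 ≤ t ^ ((α - 2) / α) := by positivity
    simp only [hf]
    rw [e1, Real.rpow_zero]
    calc _ = (((t ^ (1 / (2 : ℝ))) ^ d)⁻¹ * (t ^ ((k : ℝ) / 2))⁻¹) * (1 + |Real.log t|) *
          (t ^ (1 - α / 2) + 1) := by ring
      _ ≤ (T ^ (((d : ℝ) + k) / α₀) * t ^ (-((d : ℝ) + k) / α)) * (1 + |Real.log t|) *
          (2 * T) := by
          rw [hpow 2 two_pos]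
          gcongr
          linarith
      _ = 2 * T * T ^ (((d : ℝ) + k) / α₀) *
        ((1 + |Real.log t|) * 1 * t ^ (-((d : ℝ) + k) / α)) := by ring
      _ ≤ _ := by
          gcongr
          linarith
  have hne : ∀ᵐ ξ : E d, ξ ≠ 0 ∨ d = 0 := by
    rcases Nat.eq_zero_or_pos d with h | h
    · exact ae_of_all _ fun _ => Or.inr h
    · have : Nonempty (Fin d) := ⟨⟨0, h⟩⟩
      have : ∀ᵐ ξ : E d, ξ ≠ 0 := by simp [ae_iff]
      exact this.mono fun ξ h => Or.inl h
  have hle : ∫ ξ : E d, ‖ξ‖ ^ k * |Real.exp (-phase ν A α ξ) - Real.exp (-phase ν A 2 ξ)| ≤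
      ∫ ξ : E d, κ' * (2 - α) *
      (C * f α * ((1 + t ^ (1 / α) * ‖ξ‖) ^ (d + 1))⁻¹ +
        C * f 2 * ((1 + t ^ (1 / (2 : ℝ)) * ‖ξ‖) ^ (d + 1))⁻¹) := by
    refine integral_mono_ae
      (hA.integrable_norm_pow_mul_abs_sub hα0 hα2 (by rw [hν]; exact ht) k) hi ?_
    filter_upwards [hne] with ξ hξ
    by_cases h0 : ξ = 0
    · subst h0
      have : ∀ β : ℝ, 0 < β → phase ν A β (0 : E d) = 0 := fun β hβ => by
        simp [phase, Real.zero_rpow hβ.ne']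
      have hfα0 := hf0 α
      have hf20 := hf0 2
      simp only [this α hα0, this 2 two_pos, sub_self, abs_zero, mul_zero]
      positivity
    · exact hpt ξ h0
  refine hle.trans ?_
  rw [integral_const_mul, integral_add ((integrable_weight_scaled d (hw α)).const_mul _)
    ((integrable_weight_scaled d (hw 2)).const_mul _), integral_const_mul, integral_const_mul,
    integral_weight_scaled d (hw α), integral_weight_scaled d (hw 2), ← hI]
  calc κ' * (2 - α) * (C * f α * (((t ^ (1 / α)) ^ d)⁻¹ * I) +
        C * f 2 * (((t ^ (1 / (2 : ℝ))) ^ d)⁻¹ * I))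
      = κ' * (2 - α) * C * I * (((t ^ (1 / α)) ^ d)⁻¹ * f α +
        ((t ^ (1 / (2 : ℝ))) ^ d)⁻¹ * f 2) := by ring
    _ ≤ κ' * (2 - α) * C * I *
        ((1 + |Real.log t|) * (1 + t ^ ((α - 2) / α)) * t ^ (-((d : ℝ) + k) / α) +
        2 * T * T ^ (((d : ℝ) + k) / α₀) *
        ((1 + |Real.log t|) * (1 + t ^ ((α - 2) / α)) * t ^ (-((d : ℝ) + k) / α))) := by
        rw [hfα]
        gcongr
    _ = κ' * C * I * (1 + 2 * T * T ^ (((d : ℝ) + k) / α₀)) * rate α t *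
        t ^ (-((d : ℝ) + k) / α) := by rw [rate]; ring
    _ ≤ _ := by
        have := rate_nonneg hα2 ht
        gcongr
        linarith

end StableKernel

/-! ### The far bound -/

namespace StableKernel

variable (ι : Type*) [MeasurableSpace ι]

/-- The pointwise bound on `farKernel` is integrated; the weight at scale `1 / X` contributes the
volume factor `X ^ (-(n + 1))`. -/
theorem exists_far_integral_le (n k : ℕ) {α₀ K : ℝ} (hα₀ : 0 < α₀) (hK : 1 ≤ K) :
    ∃ C : ℝ, 0 < C ∧ ∀ (ν : Measure ι) [IsFiniteMeasure ν] (A : ι → E (n + 1) →L[ℝ] E (n + 1)),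
      Elliptic K A → ∀ α t X : ℝ, α₀ ≤ α → α ≤ 2 → 0 < t → ν.real Set.univ = t → 0 < X →
      ∀ (e : E (n + 1)), ‖e‖ = 1 → ∀ v : Fin k → E (n + 1),
      ‖∫ ξ : E (n + 1), Complex.exp (-(X * (inner ℝ e ξ : ℝ)) * Complex.I) *
        (symbolDiff ν A α v ξ : ℂ)‖ ≤
        C * (∏ j, ‖v j‖) * ((2 - α) * (X ^ (n + 1 + k))⁻¹ * farFactor t α X) := by
  have hκ : 1 ≤ 4 * K ^ 2 := by nlinarith
  obtain ⟨C, hC, hCb⟩ := exists_farKernel_le (n + 1) k hα₀ hκ (sin_sectorAngle_pos hK)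
  have hI0 := weightIntegral_nonneg (n + 1)
  refine ⟨C * (weightIntegral (n + 1) + 1), by positivity,
    fun ν _ A hA α t X hα hα2 ht hν hX e he v => ?_⟩
  have hα0 : 0 < α := hα₀.trans_le hα
  have hb : ∀ ξ : E (n + 1), _ := fun ξ => hCb t α X ‖ξ‖ ht.le hα hα2 hX (norm_nonneg ξ)
  have hdom := (integrable_weight_scaled (n + 1) hX).const_mul
    (C * ((2 - α) * (X ^ k)⁻¹ * farFactor t α X))
  have hint : Integrable fun ξ : E (n + 1) => farKernel (4 * K ^ 2) (Real.sin (sectorAngle K))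
      t α X k ‖ξ‖ := by
    refine hdom.mono' ((measurable_farKernel _ _ _ _ _ _).comp measurable_norm).aestronglyMeasurable
      (ae_of_all _ fun ξ => ?_)
    rw [Real.norm_of_nonneg (hb ξ).1]
    exact (hb ξ).2
  have hB : 0 ≤ ∏ j, ‖v j‖ := Finset.prod_nonneg fun _ _ => norm_nonneg _
  have hmain := hA.norm_integral_symbolDiff_le_farKernel (ν := ν) he hα0 hα2 hX
    (by rw [hν]; exact ht) v (hA.integrable_symbolDiff hα0 hα2 (by rw [hν]; exact ht) v)
    (by rw [hν]; exact hint)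
  rw [hν] at hmain
  refine hmain.trans ?_
  have hle := integral_mono hint hdom fun ξ => (hb ξ).2
  rw [integral_const_mul, integral_weight_scaled (n + 1) hX] at hle
  have hff := farFactor_nonneg (α := α) ht.le hX
  have h2α : 0 ≤ 2 - α := by linarith
  have hW : 0 ≤ ((2 - α) * (X ^ (n + 1 + k))⁻¹ * farFactor t α X) := by positivity
  refine (mul_le_mul_of_nonneg_left hle hB).trans ?_
  generalize (∏ j, ‖v j‖) = B at hB ⊢
  generalize farFactor t α X = F at hff hW ⊢
  generalize weightIntegral (n + 1) = I at hI0 ⊢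
  calc B * (C * ((2 - α) * (X ^ k)⁻¹ * F) *
        ((X ^ (n + 1))⁻¹ * I))
      = C * I * B * ((2 - α) * (X ^ (n + 1 + k))⁻¹ * F) := by
        rw [pow_add X (n + 1) k, mul_inv]; ring
    _ ≤ _ := by
        refine mul_le_mul_of_nonneg_right ?_ hW
        refine mul_le_mul_of_nonneg_right ?_ hB
        exact mul_le_mul_of_nonneg_left (by linarith) hC.le

/-- In the far region the logarithm and the second order term are absorbed by `rate`. -/
theorem farFactor_le {T α₀ α t X : ℝ} (hT : 1 ≤ T) (hα₀ : 0 < α₀) (hα : α₀ ≤ α) (hα2 : α ≤ 2)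
    (ht : 0 < t) (htT : t ≤ T) (hX : t ^ (1 / α) ≤ X) :
    (2 - α) * farFactor t α X ≤
      (1 + 2 * T * (1 + 1 / α₀)) * rate α t * (t * (X ^ (-α) + X ^ (-2 : ℝ))) := by
  have hα0 : 0 < α := hα₀.trans_le hα
  have hX0 : 0 < X := (Real.rpow_pos_of_pos ht _).trans_le hX
  have h2α : 0 ≤ 2 - α := by linarith
  have hi0 : 0 ≤ 1 / α₀ := by positivity
  have hl0 := abs_nonneg (Real.log t)
  set q := X ^ (-α) + X ^ (-2 : ℝ) with hq
  set b := (1 + |Real.log t|) * (1 + t ^ ((α - 2) / α)) with hb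
  have ht2 : 0 ≤ t ^ ((α - 2) / α) := by positivity
  have hb1 : 1 ≤ b := by
    rw [hb]
    exact one_le_mul_of_one_le_of_one_le (by linarith) (by linarith)
  have hq0 : 0 < q := by positivity
  -- The excess of the second order term over `t q`. If `X ≤ 1`, then `X ≥ t ^ (1/α)` bounds `t X ^
  -- (-2)` by `t ^ ((α - 2) / α)` and `|log X|` by `|log t| / α₀`, whence the shape of `rate`. If `X
  -- ≥ 1`, then `X ^ (-α₀)` absorbs the logarithm and `t ≤ T` suffices.
  have key : t * (1 + |Real.log X|) * q ≤ 2 * T * (1 + 1 / α₀) * b := by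
    rcases le_total X 1 with h1 | h1
    · have h2 : X ^ (-α) ≤ X ^ (-2 : ℝ) :=
        Real.rpow_le_rpow_of_exponent_ge hX0 h1 (by linarith)
      have h3 : t * X ^ (-2 : ℝ) ≤ t ^ ((α - 2) / α) := by
        calc t * X ^ (-2 : ℝ) ≤ t * (t ^ (1 / α)) ^ (-2 : ℝ) := by
              refine mul_le_mul_of_nonneg_left ?_ ht.le
              exact Real.rpow_le_rpow_of_nonpos (by positivity) hX (by norm_num)
          _ = t ^ (1 : ℝ) * t ^ (1 / α * (-2)) := by rw [← Real.rpow_mul ht.le, Real.rpow_one]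
          _ = t ^ ((α - 2) / α) := by
              rw [← Real.rpow_add ht]
              congr 1
              field_simp
              ring
      have h4 : |Real.log X| ≤ |Real.log t| * (1 / α₀) := by
        have hlX : Real.log X ≤ 0 := Real.log_nonpos hX0.le h1
        have h5 : 1 / α * Real.log t ≤ Real.log X := by
          rw [← Real.log_rpow ht]
          exact Real.log_le_log (by positivity) hX
        have h6 : 1 / α ≤ 1 / α₀ := one_div_le_one_div_of_le hα₀ hα
        have h7 : (1 / α) * (-Real.log t) ≤ (1 / α₀) * |Real.log t| :=
          (mul_le_mul_of_nonneg_left (neg_le_abs _) (by positivity)).trans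
            (mul_le_mul_of_nonneg_right h6 hl0)
        rw [abs_of_nonpos hlX]
        linarith
      calc t * (1 + |Real.log X|) * q ≤ t * (1 + |Real.log X|) * (2 * X ^ (-2 : ℝ)) := by
            refine mul_le_mul_of_nonneg_left (by linarith) (by positivity)
        _ = 2 * (1 + |Real.log X|) * (t * X ^ (-2 : ℝ)) := by ring
        _ ≤ 2 * ((1 + 1 / α₀) * (1 + |Real.log t|)) * t ^ ((α - 2) / α) := by
            refine mul_le_mul ?_ h3 (by positivity) (by positivity)
            nlinarith
        _ ≤ 2 * ((1 + 1 / α₀) * (1 + |Real.log t|)) * (1 + t ^ ((α - 2) / α)) := by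
            refine mul_le_mul_of_nonneg_left (by linarith) (by positivity)
        _ = 1 * (2 * (1 + 1 / α₀) * b) := by rw [hb]; ring
        _ ≤ T * (2 * (1 + 1 / α₀) * b) := mul_le_mul_of_nonneg_right hT (by positivity)
        _ = _ := by ring
    · have h2 : X ^ (-2 : ℝ) ≤ X ^ (-α₀) :=
        Real.rpow_le_rpow_of_exponent_le h1 (by linarith)
      have h2' : X ^ (-α) ≤ X ^ (-α₀) :=
        Real.rpow_le_rpow_of_exponent_le h1 (by linarith)
      have h3 : X ^ (-α₀) ≤ 1 := Real.rpow_le_one_of_one_le_of_nonpos h1 (by linarith)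
      have h4 : |Real.log X| * X ^ (-α₀) ≤ 1 / α₀ := by
        have h5 := Real.log_le_rpow_div hX0.le hα₀
        rw [abs_of_nonneg (Real.log_nonneg h1)]
        calc _ ≤ X ^ α₀ / α₀ * X ^ (-α₀) := mul_le_mul_of_nonneg_right h5 (by positivity)
          _ = 1 / α₀ := by
            rw [Real.rpow_neg hX0.le]
            have : X ^ α₀ ≠ 0 := (Real.rpow_pos_of_pos hX0 _).ne'
            field_simp
      calc t * (1 + |Real.log X|) * q ≤ t * (1 + |Real.log X|) * (2 * X ^ (-α₀)) := by
            refine mul_le_mul_of_nonneg_left (by linarith) (by positivity)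
        _ = 2 * t * (X ^ (-α₀) + |Real.log X| * X ^ (-α₀)) := by ring
        _ ≤ 2 * T * (1 + 1 / α₀) := by
            refine mul_le_mul (by linarith) (by linarith) (by positivity) (by positivity)
        _ ≤ _ := le_mul_of_one_le_right (by positivity) hb1
  have hXα : X ^ (-α) ≤ q := by rw [hq]; linarith [Real.rpow_nonneg hX0.le (-2 : ℝ)]
  calc (2 - α) * farFactor t α X
      = (2 - α) * (t * X ^ (-α) + (t * q) * (t * (1 + |Real.log X|) * q)) := by
        rw [farFactor, ← hq]; ring
    _ ≤ (2 - α) * (t * q * b + (t * q) * (2 * T * (1 + 1 / α₀) * b)) := by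
        refine mul_le_mul_of_nonneg_left (add_le_add ?_ ?_) h2α
        · exact (mul_le_mul_of_nonneg_left hXα ht.le).trans
            (le_mul_of_one_le_right (by positivity) hb1)
        · exact mul_le_mul_of_nonneg_left key (by positivity)
    _ = _ := by rw [rate, hb]; ring

end StableKernel

/-! ### Combining the two regimes into `rhoSum` -/

namespace StableKernel

section rho

variable {d : ℕ} {k α t : ℝ} {x : E d}

theorem rho_nonneg (γ₁ γ₂ : ℝ) (ht : 0 < t) : 0 ≤ rho k γ₁ γ₂ t x := by
  unfold rho
  split_ifs <;> positivity

theorem rho_le_rhoSum (ht : 0 < t) {γ₁ γ₂ : ℝ} (h₁ : γ₁ ∈ ({α, 2} : Finset ℝ))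
    (h₂ : γ₂ ∈ ({α, 2} : Finset ℝ)) : rho k γ₁ γ₂ t x ≤ rhoSum k α t x := by
  refine (Finset.single_le_sum (f := fun γ₂ => rho k γ₁ γ₂ t x)
    (fun _ _ => rho_nonneg _ _ ht) h₂).trans ?_
  exact Finset.single_le_sum (f := fun γ₁ => ∑ γ₂ ∈ ({α, 2} : Finset ℝ), rho k γ₁ γ₂ t x)
    (fun _ _ => Finset.sum_nonneg fun _ _ => rho_nonneg _ _ ht) h₁

theorem rhoSum_nonneg (ht : 0 < t) : 0 ≤ rhoSum k α t x :=
  Finset.sum_nonneg fun _ _ => Finset.sum_nonneg fun _ _ => rho_nonneg _ _ ht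

/-- A near-diagonal and an off-diagonal bound combine to a bound by `rhoSum`. -/
theorem le_mul_rhoSum (hk : 0 ≤ k) (hα : 0 < α) (ht : 0 < t) {Q D : ℝ} (hQ : 0 ≤ Q)
    (h1 : D ≤ Q * t ^ (-(d + k) / α))
    (h2 : t ^ (1 / α) ≤ ‖x‖ → D ≤ Q * (t / ‖x‖ ^ (d + k + α) + t / ‖x‖ ^ (d + k + 2))) :
    D ≤ 2 * Q * rhoSum k α t x := by
  have hm : α ∈ ({α, 2} : Finset ℝ) := by simp
  have hm2 : (2 : ℝ) ∈ ({α, 2} : Finset ℝ) := by simp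
  have hαα := rho_le_rhoSum (k := k) (x := x) ht hm hm
  have hα2 := rho_le_rhoSum (k := k) (x := x) ht hm hm2
  have hS := rhoSum_nonneg (k := k) (α := α) (x := x) ht
  rcases le_or_gt (t ^ (1 / α)) ‖x‖ with h | h
  · have hx : 0 < ‖x‖ := (Real.rpow_pos_of_pos ht _).trans_le h
    have hx0 : x ≠ 0 := norm_pos_iff.1 hx
    have hb : 0 ≤ t / ‖x‖ ^ (d + k + α) := by positivity
    have hc : 0 ≤ t / ‖x‖ ^ (d + k + 2) := by positivity
    have ha : 0 ≤ t ^ (-(d + k) / α) := by positivity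
    rw [rho, if_neg hx0] at hαα hα2
    -- If one of the two minima is attained at the diagonal value, that value suffices. Otherwise
    -- both off-diagonal terms are at most `rhoSum`, which costs the factor `2`.
    have h3 : min (t ^ (-(d + k) / α)) (t / ‖x‖ ^ (d + k + α) + t / ‖x‖ ^ (d + k + 2)) ≤
        2 * rhoSum k α t x := by
      rcases min_choice (t ^ (-(d + k) / α)) (t / ‖x‖ ^ (d + k + α)) with e | e <;>
      rcases min_choice (t ^ (-(d + k) / α)) (t / ‖x‖ ^ (d + k + 2)) with e' | e' <;>
      rw [e] at hαα <;> rw [e'] at hα2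
      · exact (min_le_left _ _).trans (by linarith)
      · exact (min_le_left _ _).trans (by linarith)
      · exact (min_le_left _ _).trans (by linarith)
      · exact (min_le_right _ _).trans (by linarith)
    calc D ≤ Q * min (t ^ (-(d + k) / α))
          (t / ‖x‖ ^ (d + k + α) + t / ‖x‖ ^ (d + k + 2)) := by
          rw [mul_min_of_nonneg _ _ hQ]
          exact le_min h1 (h2 h)
      _ ≤ Q * (2 * rhoSum k α t x) := mul_le_mul_of_nonneg_left h3 hQ
      _ = _ := by ring
  -- For `‖x‖ < t ^ (1/α)` the minimum in `rho k α α` is attained at the diagonal value.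
  · have h3 : t ^ (-(d + k) / α) ≤ rhoSum k α t x := by
      refine le_trans ?_ hαα
      unfold rho
      split_ifs with hx0
      · exact le_rfl
      · have hx : 0 < ‖x‖ := norm_pos_iff.2 hx0
        refine le_min le_rfl ?_
        rw [le_div_iff₀ (by positivity)]
        calc t ^ (-(d + k) / α) * ‖x‖ ^ (d + k + α)
            ≤ t ^ (-(d + k) / α) * (t ^ (1 / α)) ^ (d + k + α) := by gcongr
          _ = t ^ (1 : ℝ) := by
              rw [← Real.rpow_mul ht.le, ← Real.rpow_add ht]
              congr 1
              field_simp
              ring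
          _ = t := Real.rpow_one t
    calc D ≤ Q * t ^ (-(d + k) / α) := h1
      _ ≤ Q * rhoSum k α t x := mul_le_mul_of_nonneg_left h3 hQ
      _ ≤ 2 * Q * rhoSum k α t x := by nlinarith [mul_nonneg hQ hS]

end rho

variable {ι : Type*} [MeasurableSpace ι]

/-- The Fourier integral of `symbolDiff`. -/
noncomputable def symbolTransform {d k : ℕ} (ν : Measure ι) (A : ι → E d →L[ℝ] E d) (α : ℝ)
    (v : Fin k → E d) (x : E d) : ℂ :=
  ∫ ξ : E d, Complex.exp (-((2 * Real.pi * inner ℝ ξ x : ℝ) : ℂ) * Complex.I) *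
    (symbolDiff ν A α v ξ : ℂ)

variable {d k : ℕ} {ν : Measure ι} {A : ι → E d →L[ℝ] E d} {K α : ℝ}

theorem norm_symbolTransform_le (v : Fin k → E d) (x : E d)
    (hi : Integrable fun ξ : E d =>
      ‖ξ‖ ^ k * |Real.exp (-phase ν A α ξ) - Real.exp (-phase ν A 2 ξ)|) :
    ‖symbolTransform ν A α v x‖ ≤ (∏ j, ‖v j‖) *
      ∫ ξ : E d, ‖ξ‖ ^ k * |Real.exp (-phase ν A α ξ) - Real.exp (-phase ν A 2 ξ)| := by
  rw [← integral_const_mul]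
  refine norm_integral_le_of_norm_le (hi.const_mul _) (ae_of_all _ fun ξ => ?_)
  rw [norm_mul, ← Complex.ofReal_neg, Complex.norm_exp_ofReal_mul_I, one_mul, Complex.norm_real,
    Real.norm_eq_abs]
  exact abs_symbolDiff_le v ξ

theorem phase_neg (ξ : E d) : phase ν A α (-ξ) = phase ν A α ξ := by
  simp [phase]

theorem integral_symbolDiff_odd (v : Fin 1 → E d) : ∫ ξ : E d, symbolDiff ν A α v ξ = 0 := by
  have h : ∀ ξ, symbolDiff ν A α v (-ξ) = -symbolDiff ν A α v ξ := fun ξ => by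
    simp [symbolDiff, phase_neg]
  have h1 := integral_neg_eq_self (symbolDiff ν A α v) volume
  simp only [h, integral_neg] at h1
  linarith

/-- For an odd symbol one can gain a factor `‖x‖` at the price of a power of `‖ξ‖`. -/
theorem norm_symbolTransform_le_of_odd (v : Fin 1 → E d) (x : E d)
    (hs : Integrable (symbolDiff ν A α v))
    (hi : Integrable fun ξ : E d =>
      ‖ξ‖ ^ 2 * |Real.exp (-phase ν A α ξ) - Real.exp (-phase ν A 2 ξ)|) :
    ‖symbolTransform ν A α v x‖ ≤ 2 * Real.pi * ‖x‖ * (∏ j, ‖v j‖) *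
      ∫ ξ : E d, ‖ξ‖ ^ 2 * |Real.exp (-phase ν A α ξ) - Real.exp (-phase ν A 2 ξ)| := by
  have hs' : Integrable fun ξ => (symbolDiff ν A α v ξ : ℂ) := hs.ofReal
  have h0 : ∫ ξ : E d, (symbolDiff ν A α v ξ : ℂ) = 0 := by
    rw [integral_complex_ofReal, integral_symbolDiff_odd, Complex.ofReal_zero]
  have hint : Integrable fun ξ : E d =>
      Complex.exp (-((2 * Real.pi * inner ℝ ξ x : ℝ) : ℂ) * Complex.I) *
        (symbolDiff ν A α v ξ : ℂ) := by
    refine hs'.norm.mono' ((Continuous.aestronglyMeasurable (by fun_prop)).mul hs'.1)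
      (ae_of_all _ fun ξ => ?_)
    rw [norm_mul, ← Complex.ofReal_neg, Complex.norm_exp_ofReal_mul_I, one_mul]
  -- The symbol has integral zero, so the character may be replaced by the character minus `1`,
  -- which is at most `2π ‖ξ‖ ‖x‖`.
  have heq : symbolTransform ν A α v x = ∫ ξ : E d,
      (Complex.exp (-((2 * Real.pi * inner ℝ ξ x : ℝ) : ℂ) * Complex.I) - 1) *
        (symbolDiff ν A α v ξ : ℂ) := by
    simp only [sub_mul, one_mul]
    rw [integral_sub hint hs', h0, sub_zero, symbolTransform]
  rw [heq, ← integral_const_mul]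
  refine norm_integral_le_of_norm_le (hi.const_mul _) (ae_of_all _ fun ξ => ?_)
  have h1 : ‖Complex.exp (-((2 * Real.pi * inner ℝ ξ x : ℝ) : ℂ) * Complex.I) - 1‖ ≤
      2 * Real.pi * (‖ξ‖ * ‖x‖) := by
    have := Real.norm_exp_I_mul_ofReal_sub_one_le (x := -(2 * Real.pi * inner ℝ ξ x))
    rw [← Complex.ofReal_neg, mul_comm]
    refine this.trans ?_
    rw [norm_neg, norm_mul, Real.norm_of_nonneg (by positivity)]
    gcongr
    exact abs_real_inner_le_norm _ _
  have h2 := abs_symbolDiff_le (ν := ν) (A := A) (α := α) v ξ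
  rw [norm_mul, Complex.norm_real, Real.norm_eq_abs]
  calc _ ≤ 2 * Real.pi * (‖ξ‖ * ‖x‖) * ((∏ j, ‖v j‖) *
        (‖ξ‖ ^ 1 * |Real.exp (-phase ν A α ξ) - Real.exp (-phase ν A 2 ξ)|)) := by
        gcongr
    _ = _ := by ring

/-- The slicing direction is `x / ‖x‖` and the frequency of oscillation is `X = 2π ‖x‖`. As `X ≥
‖x‖`, it can be replaced by `‖x‖` in negative powers. -/
theorem exists_norm_symbolTransform_far_le (ι : Type*) [MeasurableSpace ι] (n k : ℕ)
    {T α₀ K : ℝ} (hT : 1 ≤ T) (hα₀ : 0 < α₀) (hK : 1 ≤ K) :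
    ∃ C : ℝ, 0 < C ∧ ∀ (ν : Measure ι) [IsFiniteMeasure ν] (A : ι → E (n + 1) →L[ℝ] E (n + 1)),
      Elliptic K A → ∀ α t : ℝ, α₀ ≤ α → α ≤ 2 → 0 < t → t ≤ T → ν.real Set.univ = t →
      ∀ (v : Fin k → E (n + 1)) (x : E (n + 1)), t ^ (1 / α) ≤ ‖x‖ →
      ‖symbolTransform ν A α v x‖ ≤ C * (∏ j, ‖v j‖) * rate α t *
        (t / ‖x‖ ^ (((n + 1 : ℕ) : ℝ) + k + α) + t / ‖x‖ ^ (((n + 1 : ℕ) : ℝ) + k + 2)) := by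
  obtain ⟨C, hC, hCb⟩ := exists_far_integral_le ι n k hα₀ hK
  refine ⟨C * (1 + 2 * T * (1 + 1 / α₀)), by positivity,
    fun ν _ A hA α t hα hα2 ht htT hν v x hx => ?_⟩
  have hα0 : 0 < α := hα₀.trans_le hα
  have hx0 : 0 < ‖x‖ := (Real.rpow_pos_of_pos ht _).trans_le hx
  set X := 2 * Real.pi * ‖x‖ with hXdef
  have hxX : ‖x‖ ≤ X := by
    have := Real.pi_gt_three
    rw [hXdef]
    nlinarith
  have hX : 0 < X := hx0.trans_le hxX
  have he : ‖‖x‖⁻¹ • x‖ = 1 := by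
    rw [norm_smul, norm_inv, norm_norm, inv_mul_cancel₀ hx0.ne']
  have hmain := hCb ν A hA α t X hα hα2 ht hν hX _ he v
  have heq : symbolTransform ν A α v x = ∫ ξ : E (n + 1),
      Complex.exp (-(X * (inner ℝ (‖x‖⁻¹ • x) ξ : ℝ)) * Complex.I) *
        (symbolDiff ν A α v ξ : ℂ) := by
    unfold symbolTransform
    congr 1
    ext ξ
    have : X * inner ℝ (‖x‖⁻¹ • x) ξ = 2 * Real.pi * inner ℝ ξ x := by
      rw [real_inner_smul_left, real_inner_comm, hXdef]
      field_simp
    rw [← this]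
    push_cast
    rfl
  rw [heq]
  refine hmain.trans ?_
  have hff := farFactor_le hT hα₀ hα hα2 ht htT (hx.trans hxX)
  have hB : 0 ≤ ∏ j, ‖v j‖ := Finset.prod_nonneg fun _ _ => norm_nonneg _
  have hr := rate_nonneg hα2 ht
  have hpow : ∀ γ : ℝ, 0 < γ → (X ^ (n + 1 + k))⁻¹ * X ^ (-γ) ≤
      1 / ‖x‖ ^ (((n + 1 : ℕ) : ℝ) + k + γ) := by
    intro γ hγ
    have e : (X ^ (n + 1 + k))⁻¹ * X ^ (-γ) = 1 / X ^ (((n + 1 : ℕ) : ℝ) + k + γ) := by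
      rw [Real.rpow_add hX, ← Nat.cast_add, Real.rpow_natCast, Real.rpow_neg hX.le, one_div,
        mul_inv]
    rw [e]
    gcongr
  have h1 := hpow α hα0
  have h2 := hpow 2 two_pos
  generalize (∏ j, ‖v j‖) = B at hB ⊢
  generalize farFactor t α X = F at hff ⊢
  calc C * B * ((2 - α) * (X ^ (n + 1 + k))⁻¹ * F)
      = C * B * ((X ^ (n + 1 + k))⁻¹ * ((2 - α) * F)) := by ring
    _ ≤ C * B * ((X ^ (n + 1 + k))⁻¹ * ((1 + 2 * T * (1 + 1 / α₀)) * rate α t *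
          (t * (X ^ (-α) + X ^ (-2 : ℝ))))) := by
        refine mul_le_mul_of_nonneg_left ?_ (by positivity)
        exact mul_le_mul_of_nonneg_left hff (by positivity)
    _ = C * (1 + 2 * T * (1 + 1 / α₀)) * B * rate α t * (t * ((X ^ (n + 1 + k))⁻¹ * X ^ (-α) +
          (X ^ (n + 1 + k))⁻¹ * X ^ (-2 : ℝ))) := by ring
    _ ≤ C * (1 + 2 * T * (1 + 1 / α₀)) * B * rate α t *
        (t * (1 / ‖x‖ ^ (((n + 1 : ℕ) : ℝ) + k + α) +
          1 / ‖x‖ ^ (((n + 1 : ℕ) : ℝ) + k + 2))) := by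
        refine mul_le_mul_of_nonneg_left ?_ (by positivity)
        exact mul_le_mul_of_nonneg_left (add_le_add h1 h2) ht.le
    _ = _ := by ring

theorem exists_norm_symbolTransform_le (ι : Type*) [MeasurableSpace ι] (n k : ℕ)
    {T α₀ K : ℝ} (hT : 1 ≤ T) (hα₀ : 0 < α₀) (hK : 1 ≤ K) :
    ∃ C : ℝ, 0 < C ∧ ∀ (ν : Measure ι) [IsFiniteMeasure ν] (A : ι → E (n + 1) →L[ℝ] E (n + 1)),
      Elliptic K A → ∀ α t : ℝ, α₀ ≤ α → α ≤ 2 → 0 < t → t ≤ T → ν.real Set.univ = t →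
      ∀ (v : Fin k → E (n + 1)) (x : E (n + 1)),
      ‖symbolTransform ν A α v x‖ ≤ C * (∏ j, ‖v j‖) * rate α t * rhoSum k α t x := by
  obtain ⟨C₁, hC₁, h₁⟩ := exists_near_integral_le ι (n + 1) k hT hα₀ hK
  obtain ⟨C₂, hC₂, h₂⟩ := exists_norm_symbolTransform_far_le ι n k hT hα₀ hK
  refine ⟨2 * (C₁ + C₂), by positivity, fun ν _ A hA α t hα hα2 ht htT hν v x => ?_⟩
  have hα0 : 0 < α := hα₀.trans_le hα
  have hB : 0 ≤ ∏ j, ‖v j‖ := Finset.prod_nonneg fun _ _ => norm_nonneg _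
  have hr := rate_nonneg hα2 ht
  have hν' : 0 < ν.real Set.univ := by rw [hν]; exact ht
  have hn := norm_symbolTransform_le v x (hA.integrable_norm_pow_mul_abs_sub hα0 hα2 hν' k)
  have hn' := h₁ ν A hA α t hα hα2 ht htT hν
  have hf := h₂ ν A hA α t hα hα2 ht htT hν v x
  generalize (∏ j, ‖v j‖) = B at hB hn hf ⊢
  have := le_mul_rhoSum (k := k) (x := x) (D := ‖symbolTransform ν A α v x‖)
    (Q := (C₁ + C₂) * B * rate α t) (Nat.cast_nonneg k) hα0 ht (by positivity) ?_ ?_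
  · refine this.trans (le_of_eq ?_)
    ring
  · refine hn.trans ((mul_le_mul_of_nonneg_left hn' hB).trans ?_)
    have : 0 ≤ C₂ * B * rate α t * t ^ (-(((n + 1 : ℕ) : ℝ) + k) / α) := by positivity
    linarith
  · intro hx
    refine (hf hx).trans (mul_le_mul_of_nonneg_right ?_ (by positivity))
    have : 0 ≤ C₁ * B * rate α t := by positivity
    linarith

/-- In the near regime oddness trades `‖ξ‖` for `‖x‖`, so the integral is that of order two. In the
far regime the order one bound already has the right form, since `t / ‖x‖ ^ (d + 1 + γ) = ‖x‖ * (t /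
‖x‖ ^ (d + 2 + γ))`. -/
theorem exists_norm_symbolTransform_le_of_odd (ι : Type*) [MeasurableSpace ι] (n : ℕ)
    {T α₀ K : ℝ} (hT : 1 ≤ T) (hα₀ : 0 < α₀) (hK : 1 ≤ K) :
    ∃ C : ℝ, 0 < C ∧ ∀ (ν : Measure ι) [IsFiniteMeasure ν] (A : ι → E (n + 1) →L[ℝ] E (n + 1)),
      Elliptic K A → ∀ α t : ℝ, α₀ ≤ α → α ≤ 2 → 0 < t → t ≤ T → ν.real Set.univ = t →
      ∀ (v : Fin 1 → E (n + 1)) (x : E (n + 1)),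
      ‖symbolTransform ν A α v x‖ ≤
        C * (∏ j, ‖v j‖) * rate α t * (‖x‖ * rhoSum 2 α t x) := by
  obtain ⟨C₁, hC₁, h₁⟩ := exists_near_integral_le ι (n + 1) 2 hT hα₀ hK
  obtain ⟨C₂, hC₂, h₂⟩ := exists_norm_symbolTransform_far_le ι n 1 hT hα₀ hK
  refine ⟨2 * (2 * Real.pi * C₁ + C₂), by positivity, fun ν _ A hA α t hα hα2 ht htT hν v x => ?_⟩
  have hα0 : 0 < α := hα₀.trans_le hα
  have hB : 0 ≤ ∏ j, ‖v j‖ := Finset.prod_nonneg fun _ _ => norm_nonneg _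
  have hr := rate_nonneg hα2 ht
  have hν' : 0 < ν.real Set.univ := by rw [hν]; exact ht
  have hn := norm_symbolTransform_le_of_odd v x (hA.integrable_symbolDiff hα0 hα2 hν' v)
    (hA.integrable_norm_pow_mul_abs_sub hα0 hα2 hν' 2)
  have hn' := h₁ ν A hA α t hα hα2 ht htT hν
  have hf := h₂ ν A hA α t hα hα2 ht htT hν v x
  generalize (∏ j, ‖v j‖) = B at hB hn hf ⊢
  have := le_mul_rhoSum (k := 2) (x := x) (D := ‖symbolTransform ν A α v x‖)
    (Q := (2 * Real.pi * C₁ + C₂) * B * rate α t * ‖x‖) two_pos.le hα0 ht (by positivity) ?_ ?_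
  · refine this.trans (le_of_eq ?_)
    ring
  · refine hn.trans ((mul_le_mul_of_nonneg_left hn' (by positivity)).trans ?_)
    have : 0 ≤ C₂ * B * rate α t * ‖x‖ * t ^ (-(((n + 1 : ℕ) : ℝ) + 2) / α) := by positivity
    push_cast at this ⊢
    linarith
  · intro hx
    have hx0 : 0 < ‖x‖ := (Real.rpow_pos_of_pos ht _).trans_le hx
    have e : ∀ γ : ℝ, t / ‖x‖ ^ (((n + 1 : ℕ) : ℝ) + (1 : ℕ) + γ) =
        ‖x‖ * (t / ‖x‖ ^ (((n + 1 : ℕ) : ℝ) + 2 + γ)) := fun γ => by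
      have : ((n + 1 : ℕ) : ℝ) + 2 + γ = ((n + 1 : ℕ) : ℝ) + (1 : ℕ) + γ + 1 := by
        push_cast; ring
      rw [this, Real.rpow_add_one hx0.ne']
      field_simp
    have h3 := hf hx
    rw [e, e] at h3
    refine h3.trans ?_
    have : 0 ≤ 2 * Real.pi * C₁ * B * rate α t * ‖x‖ *
      (t / ‖x‖ ^ (((n + 1 : ℕ) : ℝ) + 2 + α) + t / ‖x‖ ^ (((n + 1 : ℕ) : ℝ) + 2 + 2)) := by
      positivity
    linarith

end StableKernel

/-! ### The kernels and their derivatives -/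

namespace StableKernel

open scoped FourierTransform

variable {d k : ℕ} {ι : Type*} [MeasurableSpace ι] {ν : Measure ι} [IsFiniteMeasure ν]
  {A : ι → E d →L[ℝ] E d} {K α : ℝ}

/-- The function with Fourier transform `exp (-phase ν A α)`. -/
noncomputable def kernel (ν : Measure ι) (A : ι → E d →L[ℝ] E d) (α : ℝ) (x : E d) : ℝ :=
  (𝓕 (fun ξ : E d => (Real.exp (-phase ν A α ξ) : ℂ)) x).re

theorem Elliptic.integrable_norm_pow_mul_norm_exp (hA : Elliptic K A) (hα : 0 < α) (hα2 : α ≤ 2)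
    (hν : 0 < ν.real Set.univ) (m : ℕ) :
    Integrable fun ξ : E d => ‖ξ‖ ^ m * ‖(Real.exp (-phase ν A α ξ) : ℂ)‖ := by
  refine (hA.integrable_norm_pow_mul_exp_neg_phase hα hα2 hν m).congr (ae_of_all _ fun ξ => ?_)
  simp only
  rw [Complex.norm_real, Real.norm_of_nonneg (Real.exp_nonneg _)]

theorem Elliptic.integrable_exp (hA : Elliptic K A) (hα : 0 < α) (hα2 : α ≤ 2)
    (hν : 0 < ν.real Set.univ) :
    Integrable fun ξ : E d => (Real.exp (-phase ν A α ξ) : ℂ) := by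
  have := hA.integrable_norm_pow_mul_exp_neg_phase hα hα2 hν 0
  simp only [pow_zero, one_mul] at this
  exact this.ofReal

theorem Elliptic.contDiff_fourier_exp (hA : Elliptic K A) (hα : 0 < α) (hα2 : α ≤ 2)
    (hν : 0 < ν.real Set.univ) : ContDiff ℝ ((⊤ : ℕ∞) : WithTop ℕ∞)
      (𝓕 (fun ξ : E d => (Real.exp (-phase ν A α ξ) : ℂ))) :=
  Real.contDiff_fourier fun m _ => hA.integrable_norm_pow_mul_norm_exp hα hα2 hν m

theorem Elliptic.contDiff_kernel (hA : Elliptic K A) (hα : 0 < α) (hα2 : α ≤ 2)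
    (hν : 0 < ν.real Set.univ) : ContDiff ℝ ((⊤ : ℕ∞) : WithTop ℕ∞) (kernel ν A α) :=
  Complex.reCLM.contDiff.comp (hA.contDiff_fourier_exp hα hα2 hν)

/-- The `k`-th derivative of a Fourier transform, evaluated at `v`, is `(-2πi) ^ k` times the
transform of the symbol multiplied by `∏ ⟨ξ, v j⟩`. A bound on `symbolTransform` that is
multiplicative in the `‖v j‖` is therefore an operator norm bound. -/
theorem Elliptic.norm_iteratedFDeriv_kernel_sub_le (hA : Elliptic K A) (hα : 0 < α) (hα2 : α ≤ 2)
    (hν : 0 < ν.real Set.univ) (x : E d) {M : ℝ} (hM : 0 ≤ M)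
    (h : ∀ v : Fin k → E d, ‖symbolTransform ν A α v x‖ ≤ M * ∏ j, ‖v j‖) :
    ‖iteratedFDeriv ℝ k (kernel ν A α) x - iteratedFDeriv ℝ k (kernel ν A 2) x‖ ≤
      (2 * Real.pi) ^ k * M := by
  set g : E d → ℂ := fun ξ =>
    (Real.exp (-phase ν A α ξ) : ℂ) - (Real.exp (-phase ν A 2 ξ) : ℂ) with hg
  have hgi : ∀ m : ℕ, Integrable fun ξ : E d => ‖ξ‖ ^ m * ‖g ξ‖ := fun m => by
    refine (hA.integrable_norm_pow_mul_abs_sub hα hα2 hν m).congr (ae_of_all _ fun ξ => ?_)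
    simp only [hg]
    rw [← Complex.ofReal_sub, Complex.norm_real, Real.norm_eq_abs]
  have hgm : AEStronglyMeasurable g volume :=
    (hA.integrable_exp hα hα2 hν).1.sub (hA.integrable_exp two_pos le_rfl hν).1
  have hc : ∀ β : ℝ, 0 < β → β ≤ 2 → ContDiffAt ℝ k (kernel ν A β) x := fun β h1 h2 =>
    ((hA.contDiff_kernel h1 h2 hν).of_le (by exact_mod_cast le_top)).contDiffAt
  have hgc : ContDiff ℝ k (𝓕 g) :=
    (Real.contDiff_fourier (N := ⊤) fun m _ => hgi m).of_le (by exact_mod_cast le_top)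
  have heq : kernel ν A α - kernel ν A 2 = Complex.reCLM ∘ 𝓕 g := by
    ext y
    simp only [Pi.sub_apply, kernel, Function.comp_apply, Complex.reCLM_apply]
    rw [← Complex.sub_re]
    congr 1
    simp only [Real.fourier_eq]
    rw [← integral_sub]
    · simp only [hg, smul_sub]
    · exact (Real.fourierIntegral_convergent_iff y).2 (hA.integrable_exp hα hα2 hν)
    · exact (Real.fourierIntegral_convergent_iff y).2 (hA.integrable_exp two_pos le_rfl hν)
  rw [← iteratedFDeriv_sub_apply (hc α hα hα2) (hc 2 two_pos le_rfl), heq]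
  refine (Complex.reCLM.norm_iteratedFDeriv_comp_left hgc.contDiffAt le_rfl).trans ?_
  rw [Complex.reCLM_norm, one_mul]
  refine ContinuousMultilinearMap.opNorm_le_bound (by positivity) fun v => ?_
  rw [Real.iteratedFDeriv_fourier (N := ⊤) (fun m _ => hgi m) hgm le_top,
    Real.fourier_continuousMultilinearMap_apply
      (VectorFourier.integrable_fourierPowSMulRight _ (hgi k) hgm)]
  have h1 : 𝓕 (fun ξ => VectorFourier.fourierPowSMulRight (innerSL ℝ) g ξ k v) x =
      (-(2 * Real.pi * Complex.I)) ^ k * symbolTransform ν A α v x := by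
    rw [symbolTransform, ← integral_const_mul, Real.fourier_eq']
    congr 1
    ext ξ
    rw [VectorFourier.fourierPowSMulRight_apply]
    have hin : ∀ i, (innerSL ℝ ξ) (v i) = inner ℝ ξ (v i) := fun _ => rfl
    simp only [symbolDiff, hg, smul_eq_mul, Complex.real_smul, hin]
    push_cast
    ring_nf
  rw [h1, norm_mul, norm_pow, norm_neg, norm_mul, norm_mul, Complex.norm_I, mul_one,
    Complex.norm_real, Complex.norm_ofNat, Real.norm_of_nonneg Real.pi_pos.le, mul_assoc]
  exact mul_le_mul_of_nonneg_left (h v) (by positivity)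

end StableKernel

namespace StableKernel

/-- The two bounds of the theorem for the Fourier transforms of `exp (-phase ν A α)`. -/
theorem exists_kernel_sub_le (ι : Type*) [MeasurableSpace ι] (n : ℕ)
    {T α₀ K : ℝ} (hT : 1 ≤ T) (hα₀ : 0 < α₀) (hK : 1 ≤ K) :
    ∃ C : ℝ, 0 < C ∧ ∀ (ν : Measure ι) [IsFiniteMeasure ν] (A : ι → E (n + 1) →L[ℝ] E (n + 1)),
      Elliptic K A → ∀ α t : ℝ, α₀ ≤ α → α ≤ 2 → 0 < t → t ≤ T → ν.real Set.univ = t →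
      (∀ x, |kernel ν A α x - kernel ν A 2 x| ≤ C * rate α t * rhoSum 0 α t x) ∧
      ∀ k : ℕ, k = 1 ∨ k = 2 → ∀ x,
        ‖iteratedFDeriv ℝ k (kernel ν A α) x - iteratedFDeriv ℝ k (kernel ν A 2) x‖ ≤
          C * rate α t * ∑ k₁ ∈ Finset.Icc 1 k,
            ‖x‖ ^ (2 * k₁ - k) * rhoSum (2 * k₁ : ℕ) α t x := by
  obtain ⟨C₀, hC₀, h₀⟩ := exists_norm_symbolTransform_le ι n 0 hT hα₀ hK
  obtain ⟨C₁, hC₁, h₁⟩ := exists_norm_symbolTransform_le_of_odd ι n hT hα₀ hK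
  obtain ⟨C₂, hC₂, h₂⟩ := exists_norm_symbolTransform_le ι n 2 hT hα₀ hK
  have hπ := Real.pi_pos
  refine ⟨C₀ + 2 * Real.pi * C₁ + (2 * Real.pi) ^ 2 * C₂, by positivity,
    fun ν _ A hA α t hα hα2 ht htT hν => ?_⟩
  have hα0 : 0 < α := hα₀.trans_le hα
  have hr := rate_nonneg hα2 ht
  have hν' : 0 < ν.real Set.univ := by rw [hν]; exact ht
  have hS : ∀ (k : ℝ) (x : E (n + 1)), 0 ≤ rhoSum k α t x := fun _ _ => rhoSum_nonneg ht
  refine ⟨fun x => ?_, ?_⟩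
  · have hS0 := hS 0 x
    have hS0' := hS (0 : ℕ) x
    have h := hA.norm_iteratedFDeriv_kernel_sub_le (ν := ν) (k := 0) hα0 hα2 hν' x
      (M := C₀ * rate α t * rhoSum (0 : ℕ) α t x) (by positivity) fun v => by
        refine (h₀ ν A hA α t hα hα2 ht htT hν v x).trans (le_of_eq ?_)
        ring
    -- The value of a function is its zeroth derivative applied to the empty tuple.
    have h' := (ContinuousMultilinearMap.le_opNorm
      (iteratedFDeriv ℝ 0 (kernel ν A α) x - iteratedFDeriv ℝ 0 (kernel ν A 2) x) ![])
    rw [sub_apply, iteratedFDeriv_zero_apply, iteratedFDeriv_zero_apply,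
      Real.norm_eq_abs] at h'
    simp only [Finset.univ_eq_empty, Finset.prod_empty, mul_one] at h'
    refine h'.trans (h.trans ?_)
    rw [pow_zero, one_mul, Nat.cast_zero, mul_assoc, mul_assoc]
    refine mul_le_mul_of_nonneg_right ?_ (by positivity)
    have : 0 ≤ 2 * Real.pi * C₁ + (2 * Real.pi) ^ 2 * C₂ := by positivity
    linarith
  · rintro k (rfl | rfl) x
    · have hS2 := hS 2 x
      have h := hA.norm_iteratedFDeriv_kernel_sub_le (ν := ν) (k := 1) hα0 hα2 hν' x
        (M := C₁ * rate α t * (‖x‖ * rhoSum 2 α t x)) (by positivity) fun v => by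
          refine (h₁ ν A hA α t hα hα2 ht htT hν v x).trans (le_of_eq ?_)
          ring
      refine h.trans ?_
      have e : ∑ k₁ ∈ Finset.Icc 1 1, ‖x‖ ^ (2 * k₁ - 1) * rhoSum (2 * k₁ : ℕ) α t x =
          ‖x‖ * rhoSum 2 α t x := by
        simp
      rw [e]
      have hR : 0 ≤ ‖x‖ * rhoSum 2 α t x := by positivity
      calc _ = 2 * Real.pi * C₁ * rate α t * (‖x‖ * rhoSum 2 α t x) := by ring
        _ ≤ _ := by
          refine mul_le_mul_of_nonneg_right (mul_le_mul_of_nonneg_right ?_ hr) hR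
          have : 0 ≤ C₀ + (2 * Real.pi) ^ 2 * C₂ := by positivity
          linarith
    · have hS2 := hS 2 x
      have hS2' := hS (2 : ℕ) x
      have hS4 := hS 4 x
      have h := hA.norm_iteratedFDeriv_kernel_sub_le (ν := ν) (k := 2) hα0 hα2 hν' x
        (M := C₂ * rate α t * rhoSum (2 : ℕ) α t x) (by positivity) fun v => by
          refine (h₂ ν A hA α t hα hα2 ht htT hν v x).trans (le_of_eq ?_)
          ring
      refine h.trans ?_
      -- The summand `k₁ = 1` alone dominates the second derivative: its factor is `‖x‖ ^ 0`, equal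
      -- to `1` also at `x = 0`.
      have e : ∑ k₁ ∈ Finset.Icc 1 2, ‖x‖ ^ (2 * k₁ - 2) * rhoSum (2 * k₁ : ℕ) α t x =
          rhoSum (2 : ℕ) α t x + ‖x‖ ^ 2 * rhoSum 4 α t x := by
        rw [show Finset.Icc 1 2 = {1, 2} from rfl, Finset.sum_pair (by norm_num)]
        norm_num
      rw [e, ← mul_assoc, ← mul_assoc]
      refine mul_le_mul (mul_le_mul_of_nonneg_right ?_ hr) ?_ (by positivity) (by positivity)
      · have : 0 ≤ C₀ + 2 * Real.pi * C₁ := by positivity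
        linarith
      · have : 0 ≤ ‖x‖ ^ 2 * rhoSum 4 α t x := by positivity
        linarith

end StableKernel

/-! ### Fourier inversion for probability measures -/

namespace StableKernel

open scoped FourierTransform SchwartzMap ComplexConjugate

section inversion

variable {d : ℕ} {f : E d → ℝ} {μ : Measure (E d)}

theorem fourier_ofReal_of_even (hf : ∀ ξ, f (-ξ) = f ξ) (x : E d) :
    𝓕 (fun ξ => (f ξ : ℂ)) x = ((𝓕 (fun ξ => (f ξ : ℂ)) x).re : ℂ) := by
  rw [eq_comm, ← Complex.conj_eq_iff_re, Real.fourier_eq', ← integral_conj,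
    ← integral_neg_eq_self]
  congr 1
  ext ξ
  simp only [smul_eq_mul, map_mul, Complex.conj_ofReal, ← Complex.exp_conj, Complex.conj_I, hf,
    inner_neg_left]
  push_cast
  ring_nf

/-- Parseval's identity for a finite measure and a smooth test function. -/
theorem integral_eq_integral_fourier_mul [IsFiniteMeasure μ] (hfi : Integrable f)
    (hf : ∀ ξ, f (-ξ) = f ξ) (hμ : ∀ ξ, charFun μ ((2 * Real.pi) • ξ) = (f ξ : ℂ))
    {G : E d → ℝ} (hGc : HasCompactSupport G) (hG : ContDiff ℝ ((⊤ : ℕ∞) : WithTop ℕ∞) G) :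
    ∫ x, G x ∂μ = ∫ x, (𝓕 (fun ξ => (f ξ : ℂ)) x).re * G x := by
  have hF : Integrable fun ξ => (f ξ : ℂ) := hfi.ofReal
  have hGc' : HasCompactSupport fun x => (G x : ℂ) := hGc.comp_left Complex.ofReal_zero
  let S : 𝓢(E d, ℂ) := hGc'.toSchwartzMap (Complex.ofRealCLM.contDiff.comp hG)
  have hS : ∀ x, S x = (G x : ℂ) := fun x => rfl
  have hL : Continuous fun p : E d × E d => (innerₗ (E d)) p.1 p.2 := continuous_inner
  -- The Fourier transform is moved across the pairing twice: from `μ` onto the inverse transform of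
  -- the test function, and from `f` onto the test function itself. Evenness of `f` identifies the
  -- two results.
  have h1 := VectorFourier.integral_fourierIntegral_smul_eq_flip (μ := μ) (ν := volume)
    (f := (1 : E d → ℂ)) (g := ((𝓕⁻ S : 𝓢(E d, ℂ)) : E d → ℂ)) Real.continuous_fourierChar hL
    (integrable_const (1 : ℂ)) (SchwartzMap.integrable _)
  have h2 := VectorFourier.integral_fourierIntegral_smul_eq_flip (μ := volume) (ν := volume)
    (f := fun ξ => (f ξ : ℂ)) (g := (S : E d → ℂ)) Real.continuous_fourierChar hL
    hF (SchwartzMap.integrable _)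
  rw [flip_innerₗ] at h1 h2
  have e1 : ∀ ξ : E d, VectorFourier.fourierIntegral 𝐞 μ (innerₗ (E d)) 1 ξ = (f ξ : ℂ) := by
    intro ξ
    have := charFun_eq_fourierIntegral' (μ := μ) ((2 * Real.pi) • (-ξ))
    rw [hμ, hf, smul_smul] at this
    rw [this]
    congr 1
    rw [neg_mul, inv_mul_cancel₀ (by positivity)]
    simp
  have e2 : VectorFourier.fourierIntegral 𝐞 volume (innerₗ (E d))
      ((𝓕⁻ S : 𝓢(E d, ℂ)) : E d → ℂ) = S := by
    have : (𝓕 (𝓕⁻ S) : 𝓢(E d, ℂ)) = S := FourierTransform.fourier_fourierInv_eq S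
    exact congrArg (fun g : 𝓢(E d, ℂ) => (g : E d → ℂ)) this
  simp only [e1, e2, Pi.one_apply, smul_eq_mul, one_mul] at h1 h2
  have e3 : ∫ ξ : E d, (f ξ : ℂ) * (𝓕⁻ S : 𝓢(E d, ℂ)) ξ =
      ∫ ξ : E d, (f ξ : ℂ) * 𝓕 (S : E d → ℂ) ξ := by
    rw [← integral_neg_eq_self]
    congr 1
    ext ξ
    rw [hf, SchwartzMap.fourierInv_coe, Real.fourierInv_eq_fourier_neg, neg_neg]
  have h3 : ∫ x, (G x : ℂ) ∂μ = ∫ x, 𝓕 (fun ξ => (f ξ : ℂ)) x * (G x : ℂ) := by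
    refine h1.symm.trans (e3.trans ?_)
    exact h2.symm
  rw [integral_complex_ofReal] at h3
  have h4 : ∫ x, 𝓕 (fun ξ => (f ξ : ℂ)) x * (G x : ℂ) =
      ((∫ x, (𝓕 (fun ξ => (f ξ : ℂ)) x).re * G x : ℝ) : ℂ) := by
    rw [← integral_complex_ofReal]
    congr 1
    ext x
    rw [Complex.ofReal_mul, ← fourier_ofReal_of_even hf]
  rw [h4] at h3
  exact_mod_cast h3

/-- Were the continuous candidate density negative at a point, a bump function around it would have
a nonnegative `μ`-integral and, by Parseval, a negative one. -/
theorem fourier_re_nonneg [IsFiniteMeasure μ] (hfi : Integrable f)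
    (hf : ∀ ξ, f (-ξ) = f ξ) (hμ : ∀ ξ, charFun μ ((2 * Real.pi) • ξ) = (f ξ : ℂ))
    (hp : Continuous fun x => (𝓕 (fun ξ => (f ξ : ℂ)) x).re) (x : E d) :
    0 ≤ (𝓕 (fun ξ => (f ξ : ℂ)) x).re := by
  set p := fun x => (𝓕 (fun ξ => (f ξ : ℂ)) x).re with hpdef
  by_contra! hx
  obtain ⟨ε, hε, hb⟩ := Metric.isOpen_iff.1 (isOpen_lt hp continuous_const) x hx
  let G : ContDiffBump x := ⟨ε / 2, ε, by positivity, by linarith⟩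
  have h1 := integral_eq_integral_fourier_mul hfi hf hμ G.hasCompactSupport G.contDiff
  have h2 : 0 ≤ ∫ y, G y ∂μ := integral_nonneg fun y => G.nonneg
  have h3 : 0 < ∫ y, -(p y * G y) := by
    refine Continuous.integral_pos_of_hasCompactSupport_nonneg_nonzero (x := x)
      (by have := G.continuous; fun_prop) (G.hasCompactSupport.mul_left.neg) (fun y => ?_) ?_
    · by_cases hy : y ∈ Metric.ball x ε
      · have : p y < 0 := hb hy
        have := G.nonneg (x := y)
        simp only [Pi.zero_apply]
        nlinarith
      · have : G y = 0 := G.zero_of_le_dist (by simpa using hy)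
        simp [this]
    · have : G x = 1 := G.one_of_mem_closedBall (Metric.mem_closedBall_self G.rIn_pos.le)
      rw [this]
      have : p x < 0 := hx
      linarith
  rw [integral_neg] at h3
  linarith

/-- Bump functions equal to `1` on growing balls bound the mass of the candidate density on each
ball by the mass of `μ`. -/
theorem integrable_fourier_re [IsProbabilityMeasure μ] (hfi : Integrable f)
    (hf : ∀ ξ, f (-ξ) = f ξ) (hμ : ∀ ξ, charFun μ ((2 * Real.pi) • ξ) = (f ξ : ℂ))
    (hp : Continuous fun x => (𝓕 (fun ξ => (f ξ : ℂ)) x).re) :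
    Integrable fun x => (𝓕 (fun ξ => (f ξ : ℂ)) x).re := by
  have hp0 := fourier_re_nonneg hfi hf hμ hp
  set p := fun x => (𝓕 (fun ξ => (f ξ : ℂ)) x).re with hpdef
  refine AECover.integrable_of_lintegral_enorm_bounded (l := atTop)
    (φ := fun n : ℕ => Metric.closedBall (0 : E d) (n + 1 : ℝ))
    (aecover_closedBall (tendsto_natCast_atTop_atTop.atTop_add tendsto_const_nhds)) 1
    hp.aestronglyMeasurable (Eventually.of_forall fun n => ?_)
  let G : ContDiffBump (0 : E d) := ⟨n + 1, n + 2, by positivity, by linarith⟩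
  have h1 := integral_eq_integral_fourier_mul hfi hf hμ G.hasCompactSupport G.contDiff
  have hGi : Integrable (fun y => G y) μ :=
    G.continuous.integrable_of_hasCompactSupport G.hasCompactSupport
  have h2 : ∫ y, G y ∂μ ≤ 1 := by
    refine (integral_mono hGi (integrable_const 1) fun y => G.le_one).trans ?_
    simp
  have h3 : Integrable fun y => p y * G y := by
    refine Continuous.integrable_of_hasCompactSupport ?_ G.hasCompactSupport.mul_left
    have := G.continuous
    fun_prop
  calc ∫⁻ y in Metric.closedBall (0 : E d) (n + 1 : ℝ), ‖p y‖ₑ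
      ≤ ∫⁻ y in Metric.closedBall (0 : E d) (n + 1 : ℝ), ENNReal.ofReal (p y * G y) := by
        refine setLIntegral_mono' measurableSet_closedBall fun y hy => ?_
        rw [G.one_of_mem_closedBall hy, mul_one, Real.enorm_of_nonneg (hp0 y)]
    _ ≤ ∫⁻ y, ENNReal.ofReal (p y * G y) := setLIntegral_le_lintegral _ _
    _ = ENNReal.ofReal (∫ y, p y * G y) :=
        (ofReal_integral_eq_lintegral_ofReal h3
          (ae_of_all _ fun y => mul_nonneg (hp0 y) G.nonneg)).symm
    _ ≤ _ := by
        rw [← h1]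
        simpa using ENNReal.ofReal_le_ofReal h2

/-- A probability measure with an integrable characteristic function, which is even and real, has
its Fourier transform as density. -/
theorem eq_withDensity_fourier [IsProbabilityMeasure μ] (hfi : Integrable f)
    (hf : ∀ ξ, f (-ξ) = f ξ) (hμ : ∀ ξ, charFun μ ((2 * Real.pi) • ξ) = (f ξ : ℂ))
    (hp : Continuous fun x => (𝓕 (fun ξ => (f ξ : ℂ)) x).re) :
    μ = volume.withDensity fun x => ENNReal.ofReal (𝓕 (fun ξ => (f ξ : ℂ)) x).re := by
  have hp0 := fourier_re_nonneg hfi hf hμ hp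
  have hpi := integrable_fourier_re hfi hf hμ hp
  have hFc : Continuous fun ξ => (f ξ : ℂ) := by
    have : (fun ξ => (f ξ : ℂ)) = fun ξ => charFun μ ((2 * Real.pi) • ξ) := by
      ext ξ; exact (hμ ξ).symm
    rw [this]
    exact continuous_charFun.comp (continuous_const_smul _)
  have hre : 𝓕 (fun ξ => (f ξ : ℂ)) = fun x => ((𝓕 (fun ξ => (f ξ : ℂ)) x).re : ℂ) :=
    funext (fourier_ofReal_of_even hf)
  have hFi : Integrable (𝓕 (fun ξ => (f ξ : ℂ))) := by
    rw [hre]; exact hpi.ofReal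
  have hinv := hFc.fourierInv_fourier_eq hfi.ofReal hFi
  set p := fun x => (𝓕 (fun ξ => (f ξ : ℂ)) x).re with hpdef
  have hfin : IsFiniteMeasure (volume.withDensity fun x => ENNReal.ofReal (p x)) :=
    isFiniteMeasure_withDensity_ofReal hpi.2
  refine Measure.ext_of_charFun (funext fun t => ?_)
  have h1 := hμ ((2 * Real.pi)⁻¹ • t)
  rw [smul_smul, mul_inv_cancel₀ (by positivity), one_smul] at h1
  have hm : Measurable fun x => ENNReal.ofReal (𝓕 (fun ξ => (f ξ : ℂ)) x).re :=
    ENNReal.measurable_ofReal.comp hp.measurable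
  rw [h1, charFun_apply, integral_withDensity_eq_integral_toReal_smul hm
    (ae_of_all _ fun _ => ENNReal.ofReal_lt_top)]
  have h2 := congrFun hinv ((2 * Real.pi)⁻¹ • t)
  rw [← h2, Real.fourierInv_eq']
  congr 1
  ext x
  have h3 : 2 * Real.pi * inner ℝ x ((2 * Real.pi)⁻¹ • t) = inner ℝ x t := by
    rw [inner_smul_right, ← mul_assoc, mul_inv_cancel₀ (by positivity), one_mul]
  rw [ENNReal.toReal_ofReal (hp0 x), congrFun hre x, smul_eq_mul, Complex.real_smul, mul_comm, h3,
    Complex.ofReal_re]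

end inversion

end StableKernel

/-! ### Characteristic functions of elementary integrals -/

namespace StableKernel

/-- A substitute for Hölder continuity that is valid for all `α > 0` and bounds only `b`. If `|a -
b|` is below a threshold `τ`, uniform continuity gives `δ`; otherwise `M ≤ (M / τ) |a - b|`, so both
`a` and `b` are controlled by `|a - b|`. -/
theorem exists_abs_rpow_sub_rpow_le {α M δ : ℝ} (hα : 0 < α) (hM : 0 ≤ M) (hδ : 0 < δ) :
    ∃ C : ℝ, 0 ≤ C ∧ ∀ a b : ℝ, 0 ≤ a → 0 ≤ b → b ≤ M →
      |a ^ α - b ^ α| ≤ δ + C * |a - b| ^ α := by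
  have huc : UniformContinuousOn (fun x : ℝ => x ^ α) (Set.Icc 0 (M + 1)) :=
    isCompact_Icc.uniformContinuousOn_of_continuous
      (Real.continuous_rpow_const hα.le).continuousOn
  obtain ⟨η, hη, h⟩ := Metric.uniformContinuousOn_iff.1 huc δ hδ
  set τ := min η 1 with hτ
  have hτ0 : 0 < τ := lt_min hη one_pos
  refine ⟨(M / τ + 1) ^ α, by positivity, fun a b ha hb hbM => ?_⟩
  have hC : 0 ≤ (M / τ + 1) ^ α * |a - b| ^ α := by positivity
  rcases lt_or_ge |a - b| τ with hab | hab
  · have h1 : |a - b| < 1 := hab.trans_le (min_le_right _ _)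
    have h2 := h a ⟨ha, by linarith [(abs_lt.1 h1).2]⟩ b ⟨hb, by linarith⟩
      (by rw [Real.dist_eq]; exact hab.trans_le (min_le_left _ _))
    rw [Real.dist_eq] at h2
    linarith
  · have hMτ : M ≤ M / τ * |a - b| := by
      calc M = M / τ * τ := by field_simp
        _ ≤ _ := by gcongr
    have hle : ∀ c, 0 ≤ c → c ≤ M + |a - b| → c ^ α ≤ (M / τ + 1) ^ α * |a - b| ^ α := by
      intro c hc hcM
      rw [← Real.mul_rpow (by positivity) (abs_nonneg _)]
      refine Real.rpow_le_rpow hc ?_ hα.le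
      linarith
    have h1 := hle a ha (by linarith [le_abs_self (a - b)])
    have h2 := hle b hb (by linarith [abs_nonneg (a - b)])
    have h3 : 0 ≤ a ^ α := by positivity
    have h4 : 0 ≤ b ^ α := by positivity
    rw [abs_le]
    constructor <;> linarith

variable {d : ℕ}

/-- The adjoint of the operator on `E d` with matrix `M`. -/
noncomputable def adj (M : Matrix (Fin d) (Fin d) ℝ) : E d →L[ℝ] E d :=
  ContinuousLinearMap.adjoint (Matrix.toEuclideanCLM (𝕜 := ℝ) M)

theorem adj_apply (M : Matrix (Fin d) (Fin d) ℝ) (ξ : E d) :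
    adj M ξ = WithLp.toLp 2 fun i => ∑ j, M j i * ξ j := by
  have h : adj M = Matrix.toEuclideanCLM (𝕜 := ℝ) Mᴴ := by
    rw [adj, ← ContinuousLinearMap.star_eq_adjoint, ← Matrix.star_eq_conjTranspose, map_star]
  ext i
  rw [h]
  simp [Matrix.ofLp_toEuclideanCLM, Matrix.mulVec, dotProduct]

theorem norm_adj_sub_le (M N : Matrix (Fin d) (Fin d) ℝ) (ξ : E d) :
    ‖adj M ξ - adj N ξ‖ ≤ ‖Matrix.toEuclideanCLM (𝕜 := ℝ) (M - N)‖ * ‖ξ‖ := by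
  have h : adj M ξ - adj N ξ =
      ContinuousLinearMap.adjoint (Matrix.toEuclideanCLM (𝕜 := ℝ) (M - N)) ξ := by
    rw [map_sub, map_sub]
    rfl
  rw [h]
  refine (ContinuousLinearMap.le_opNorm _ _).trans (le_of_eq ?_)
  rw [LinearIsometryEquiv.norm_map]

theorem measurable_adj {ι : Type*} [MeasurableSpace ι] {σ : ι → Matrix (Fin d) (Fin d) ℝ}
    (hσ : ∀ i j, Measurable fun r => σ r i j) (ξ : E d) : Measurable fun r => adj (σ r) ξ := by
  simp only [adj_apply]
  refine (WithLp.measurable_toLp 2 _).comp (measurable_pi_lambda _ fun i => ?_)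
  fun_prop

theorem charFun_map_toEuclideanCLM {Ω : Type*} [MeasurableSpace Ω] {P : Measure Ω}
    {X : Ω → E d} (hX : Measurable X) (M : Matrix (Fin d) (Fin d) ℝ) (ξ : E d) :
    charFun (P.map fun ω => Matrix.toEuclideanCLM (𝕜 := ℝ) M (X ω)) ξ =
      charFun (P.map X) (adj M ξ) := by
  rw [charFun_apply, charFun_apply, integral_map (by fun_prop) (by fun_prop),
    integral_map (by fun_prop) (by fun_prop)]
  simp only [adj, ContinuousLinearMap.adjoint_inner_right]

section step

variable {s t : ℝ≥0} (S : StepIntegrand d s t) {i : ℕ}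

theorem StepIntegrand.eval_eq (hi : i < S.n) {r : ℝ≥0}
    (hr : r ∈ Set.Ioc (S.node i) (S.node (i + 1))) : S.eval r = S.coeff i := by
  rw [StepIntegrand.eval, Finset.sum_eq_single_of_mem i (Finset.mem_range.2 hi)]
  · exact Set.indicator_of_mem hr _
  · intro j _ hji
    refine Set.indicator_of_notMem (fun hj => ?_) _
    rcases lt_or_gt_of_ne hji with h | h
    · exact absurd (hr.1.trans_le (hj.2.trans (S.mono (Nat.succ_le_of_lt h)))) (lt_irrefl _)
    · exact absurd (hj.1.trans_le (hr.2.trans (S.mono (Nat.succ_le_of_lt h)))) (lt_irrefl _)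

theorem StepIntegrand.integrable_and_integral_eq (g : Matrix (Fin d) (Fin d) ℝ → ℝ) :
    IntegrableOn (fun r : ℝ => g (S.eval r.toNNReal)) (Set.Ioc (s : ℝ) t) ∧
    ∫ r in Set.Ioc (s : ℝ) t, g (S.eval r.toNNReal) =
      ∑ i ∈ Finset.range S.n, ((S.node (i + 1) : ℝ) - S.node i) * g (S.coeff i) := by
  have hm : ∀ i, (S.node i : ℝ) ≤ S.node (i + 1) := fun i => S.mono i.le_succ
  have heq : ∀ i < S.n, Set.EqOn (fun r : ℝ => g (S.eval r.toNNReal)) (fun _ => g (S.coeff i))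
      (Set.Ioc (S.node i : ℝ) (S.node (i + 1))) := by
    intro i hi r hr
    have hr0 : 0 ≤ r := (S.node i).coe_nonneg.trans hr.1.le
    simp only
    rw [S.eval_eq hi]
    exact ⟨NNReal.coe_lt_coe.1 (by rw [Real.coe_toNNReal r hr0]; exact hr.1),
      NNReal.coe_le_coe.1 (by rw [Real.coe_toNNReal r hr0]; exact hr.2)⟩
  have hint : ∀ i < S.n, IntervalIntegrable (fun r : ℝ => g (S.eval r.toNNReal)) volume
      (S.node i) (S.node (i + 1)) := by
    intro i hi
    rw [intervalIntegrable_iff_integrableOn_Ioc_of_le (hm i)]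
    exact (integrableOn_const (by simp)).congr_fun (heq i hi).symm measurableSet_Ioc
  have hst : (s : ℝ) ≤ t := by
    have h := S.mono (Nat.zero_le S.n)
    rw [S.node_zero, S.node_last] at h
    exact h
  have h1 := IntervalIntegrable.trans_iterate (a := fun i => (S.node i : ℝ)) hint
  have h2 := intervalIntegral.sum_integral_adjacent_intervals (a := fun i => (S.node i : ℝ)) hint
  rw [S.node_zero, S.node_last] at h1 h2
  refine ⟨(intervalIntegrable_iff_integrableOn_Ioc_of_le hst).1 h1, ?_⟩
  rw [← intervalIntegral.integral_of_le hst, ← h2]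
  refine Finset.sum_congr rfl fun i hi => ?_
  rw [intervalIntegral.integral_of_le (hm i),
    setIntegral_congr_fun measurableSet_Ioc (heq i (Finset.mem_range.1 hi)), setIntegral_const,
    smul_eq_mul, Measure.real, Real.volume_Ioc, ENNReal.toReal_ofReal (by linarith [hm i])]

variable {Ω : Type*} [MeasurableSpace Ω] {P : Measure Ω} {α : ℝ}
  {L : ℝ≥0 → Ω → E d}

theorem StepIntegrand.measurable_integral (hL : ∀ t, Measurable (L t)) :
    Measurable (S.integral L) := by
  unfold StepIntegrand.integral
  refine Finset.measurable_sum _ fun i _ => ?_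
  exact (ContinuousLinearMap.measurable _).comp ((hL _).sub (hL _))

/-- Independent increments turn the characteristic function into a product; the matrix of each step
passes to `ξ` as its adjoint, and the exponents add up to a Riemann sum that is exact for step
functions. -/
theorem StepIntegrand.charFun_integral (hL : IsStableProcess α L P) (ξ : E d) :
    charFun (P.map (S.integral L)) ξ = (Real.exp
      (-∫ r in Set.Ioc (s : ℝ) t, ‖adj (S.eval r.toNNReal) ξ‖ ^ α) : ℂ) := by
  have hind := hL.indep.nat S.mono
  have hmi : ∀ i, Measurable fun ω => L (S.node (i + 1)) ω - L (S.node i) ω :=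
    fun i => (hL.measurable _).sub (hL.measurable _)
  have hind' := (hind.comp (fun i => Matrix.toEuclideanCLM (𝕜 := ℝ) (S.coeff i))
    fun i => ContinuousLinearMap.measurable _).precomp
    (g := fun i : (Finset.range S.n) => (i : ℕ)) Subtype.val_injective
  have h := iIndepFun.charFun_map_fun_finsetSum_eq_prod (P := P) (s := Finset.range S.n)
    (X := fun i ω => Matrix.toEuclideanCLM (𝕜 := ℝ) (S.coeff i)
      (L (S.node (i + 1)) ω - L (S.node i) ω))
    (fun i _ => ((ContinuousLinearMap.measurable _).comp (hmi i)).aemeasurable) hind'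
  have h' : charFun (P.map (S.integral L)) ξ = _ := congrFun h ξ
  rw [h', Finset.prod_apply, (S.integrable_and_integral_eq fun M => ‖adj M ξ‖ ^ α).2,
    ← Finset.sum_neg_distrib, Real.exp_sum, Complex.ofReal_prod]
  refine Finset.prod_congr rfl fun i _ => ?_
  rw [charFun_map_toEuclideanCLM (hmi i), hL.charFun_increment _ _ (S.mono i.le_succ)]

end step

end StableKernel

/-! ### Passage to the limit and identification of the density -/

namespace StableKernel

variable {d : ℕ} {α : ℝ}

/-- If step functions converge to `σ` in `L^α`, their characteristic exponents converge. -/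
theorem tendsto_integral_norm_adj_rpow {s t : ℝ≥0} (hα : 0 < α)
    {σ : ℝ≥0 → Matrix (Fin d) (Fin d) ℝ} (hσ : ∀ i j, Measurable fun r => σ r i j)
    (ξ : E d) {M : ℝ} (hM : 0 ≤ M) (hb : ∀ r, ‖adj (σ r) ξ‖ ≤ M) {S : ℕ → StepIntegrand d s t}
    (hS : Tendsto (fun n => ∫⁻ r in Set.Ioc (s : ℝ) (t : ℝ),
      ENNReal.ofReal
        (‖Matrix.toEuclideanCLM (𝕜 := ℝ) ((S n).eval r.toNNReal - σ r.toNNReal)‖ ^ α))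
      atTop (𝓝 0)) :
    Tendsto (fun n => ∫ r in Set.Ioc (s : ℝ) t, ‖adj ((S n).eval r.toNNReal) ξ‖ ^ α) atTop
      (𝓝 (∫ r in Set.Ioc (s : ℝ) t, ‖adj (σ r.toNNReal) ξ‖ ^ α)) := by
  have hmeas : Measurable fun r : ℝ => ‖adj (σ r.toNNReal) ξ‖ ^ α :=
    (((measurable_adj hσ ξ).comp measurable_real_toNNReal).norm).pow_const α
  have hint : IntegrableOn (fun r : ℝ => ‖adj (σ r.toNNReal) ξ‖ ^ α) (Set.Ioc (s : ℝ) t) := by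
    refine Integrable.mono' (g := fun _ => M ^ α) (integrableOn_const (by simp))
      hmeas.aestronglyMeasurable (ae_of_all _ fun r => ?_)
    rw [Real.norm_of_nonneg (by positivity)]
    exact Real.rpow_le_rpow (norm_nonneg _) (hb _) hα.le
  rw [tendsto_iff_edist_tendsto_0, ENNReal.tendsto_nhds_zero]
  intro ε hε
  rcases eq_or_ne ε ∞ with rfl | hε'
  · exact Eventually.of_forall fun _ => le_top
  have hε2 : 0 < ε.toReal := ENNReal.toReal_pos hε.ne' hε'
  -- Chosen so that the constant error integrates to at most half of `ε` over the interval; the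
  -- shift `t + 1` avoids division by zero.
  set δ := ε.toReal / 2 / (t + 1) with hδ
  have hδ0 : 0 < δ := by positivity
  obtain ⟨C, hC, hCb⟩ := exists_abs_rpow_sub_rpow_le hα hM hδ0
  have hlim := ENNReal.Tendsto.const_mul (a := ENNReal.ofReal (C * ‖ξ‖ ^ α)) hS
    (Or.inr ENNReal.ofReal_ne_top)
  rw [mul_zero] at hlim
  have hev := (ENNReal.tendsto_nhds_zero.1 hlim) (ENNReal.ofReal (ε.toReal / 2))
    (ENNReal.ofReal_pos.2 (by positivity))
  filter_upwards [hev] with n hn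
  rw [edist_eq_enorm_sub, ← integral_sub
    ((S n).integrable_and_integral_eq fun M => ‖adj M ξ‖ ^ α).1 hint]
  refine (enorm_integral_le_lintegral_enorm _).trans ?_
  calc _ ≤ ∫⁻ r in Set.Ioc (s : ℝ) (t : ℝ), (ENNReal.ofReal δ + ENNReal.ofReal (C * ‖ξ‖ ^ α) *
        ENNReal.ofReal
        (‖Matrix.toEuclideanCLM (𝕜 := ℝ) ((S n).eval r.toNNReal - σ r.toNNReal)‖ ^ α)) := by
        refine lintegral_mono fun r => ?_
        rw [← ENNReal.ofReal_mul (by positivity), ← ENNReal.ofReal_add hδ0.le (by positivity),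
          Real.enorm_eq_ofReal_abs]
        refine ENNReal.ofReal_le_ofReal ((hCb _ _ (norm_nonneg _) (norm_nonneg _) (hb _)).trans ?_)
        rw [mul_assoc, ← Real.mul_rpow (norm_nonneg _) (norm_nonneg _)]
        gcongr
        refine (abs_norm_sub_norm_le _ _).trans ?_
        rw [mul_comm]
        exact norm_adj_sub_le _ _ _
    _ = ENNReal.ofReal δ * ENNReal.ofReal (t - s) + ENNReal.ofReal (C * ‖ξ‖ ^ α) *
        ∫⁻ r in Set.Ioc (s : ℝ) (t : ℝ), ENNReal.ofReal
        (‖Matrix.toEuclideanCLM (𝕜 := ℝ) ((S n).eval r.toNNReal - σ r.toNNReal)‖ ^ α) := by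
        rw [lintegral_add_left measurable_const, lintegral_const_mul' _ _ ENNReal.ofReal_ne_top,
          setLIntegral_const, Real.volume_Ioc]
    _ ≤ ENNReal.ofReal (ε.toReal / 2) + ENNReal.ofReal (ε.toReal / 2) := by
        refine add_le_add ?_ hn
        rw [← ENNReal.ofReal_mul hδ0.le]
        refine ENNReal.ofReal_le_ofReal ?_
        calc δ * ((t : ℝ) - s) ≤ δ * (t + 1) := by
              refine mul_le_mul_of_nonneg_left ?_ hδ0.le
              linarith [s.coe_nonneg]
          _ = ε.toReal / 2 := by rw [hδ]; field_simp
    _ = ε := by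
        rw [← ENNReal.ofReal_add (by positivity) (by positivity), add_halves,
          ENNReal.ofReal_toReal hε']

variable {Ω : Type*} [MeasurableSpace Ω] {P : Measure Ω} [IsProbabilityMeasure P]

theorem tendsto_charFun_map {X : ℕ → Ω → E d} {Z : Ω → E d} (hX : ∀ n, Measurable (X n))
    (hZ : AEMeasurable Z P) (h : ∀ᵐ ω ∂P, Tendsto (fun n => X n ω) atTop (𝓝 (Z ω))) (ξ : E d) :
    Tendsto (fun n => charFun (P.map (X n)) ξ) atTop (𝓝 (charFun (P.map Z) ξ)) := by
  have hc : Continuous fun x : E d => Complex.exp ((inner ℝ x ξ : ℝ) * Complex.I) := by fun_prop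
  have e : ∀ {Y : Ω → E d}, AEMeasurable Y P → charFun (P.map Y) ξ =
      ∫ ω, Complex.exp ((inner ℝ (Y ω) ξ : ℝ) * Complex.I) ∂P := fun {Y} hY => by
    rw [charFun_apply, integral_map hY hc.aestronglyMeasurable]
  simp only [e (hX _).aemeasurable, e hZ]
  refine tendsto_integral_of_dominated_convergence (fun _ => (1 : ℝ))
    (fun n => (hc.measurable.comp (hX n)).aestronglyMeasurable) (integrable_const 1)
    (fun n => ae_of_all _ fun ω => by rw [Complex.norm_exp_ofReal_mul_I]) ?_
  filter_upwards [h] with ω hω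
  exact (hc.tendsto _).comp hω

/-- Convergence in probability gives almost sure convergence along a subsequence, hence convergence
of characteristic functions by domination. The exponents converge by the `L^α` approximation, and
the two limits must agree. -/
theorem charFun_map_of_isStableIntegral {L : ℝ≥0 → Ω → E d} {Z : Ω → E d} {s t : ℝ≥0}
    {σ : ℝ≥0 → Matrix (Fin d) (Fin d) ℝ} (hα : 0 < α) (hL : IsStableProcess α L P)
    (hσ : ∀ i j, Measurable fun r => σ r i j) (hZ : IsStableIntegral α L P σ s t Z)
    (ξ : E d) {M : ℝ} (hM : 0 ≤ M) (hb : ∀ r, ‖adj (σ r) ξ‖ ≤ M) :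
    charFun (P.map Z) ξ = (Real.exp
      (-∫ r in Set.Ioc (s : ℝ) t, ‖adj (σ r.toNNReal) ξ‖ ^ α) : ℂ) := by
  obtain ⟨hZm, S, hS, hSZ⟩ := hZ
  obtain ⟨ns, hns, hae⟩ := hSZ.exists_seq_tendsto_ae
  have h1 := tendsto_charFun_map (fun n => (S (ns n)).measurable_integral hL.measurable) hZm hae ξ
  have h2 := (tendsto_integral_norm_adj_rpow hα hσ ξ hM hb hS).comp hns.tendsto_atTop
  have h3 := (Complex.continuous_ofReal.tendsto _).comp ((Real.continuous_exp.tendsto _).comp h2.neg)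
  refine tendsto_nhds_unique (h1.congr fun n => ?_) h3
  rw [StepIntegrand.charFun_integral _ hL]
  rfl

/-- The family of operators in the exponent of the Fourier transform of the density. -/
noncomputable def scaledAdj (σ : ℝ≥0 → Matrix (Fin d) (Fin d) ℝ) (r : ℝ) : E d →L[ℝ] E d :=
  (2 * Real.pi) • adj (σ r.toNNReal)

theorem Nondegenerate.norm_adj_le {κ : ℝ} (hκ : 0 < κ) {σ : ℝ≥0 → Matrix (Fin d) (Fin d) ℝ}
    (hσ : Nondegenerate κ σ) (r : ℝ≥0) (ξ : E d) :
    ‖adj (σ r) ξ‖ ≤ √κ * ‖ξ‖ := by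
  refine (ContinuousLinearMap.le_opNorm _ _).trans ?_
  refine mul_le_mul_of_nonneg_right ?_ (norm_nonneg _)
  rw [adj, LinearIsometryEquiv.norm_map]
  refine ContinuousLinearMap.opNorm_le_bound _ (Real.sqrt_nonneg _) fun η => ?_
  refine (pow_le_pow_iff_left₀ (norm_nonneg _) (by positivity) two_ne_zero).1 ?_
  rw [mul_pow, Real.sq_sqrt hκ.le]
  exact (hσ r η).2

/-- In finite dimension the operator `B` is injective, hence onto. Writing `ξ = B η`, one has `‖B η‖
^ 2 = ⟨η, B* B η⟩ ≤ ‖η‖ ‖B* ξ‖`, and `‖η‖ ≤ √κ ‖B η‖` allows one factor to be cancelled. -/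
theorem Nondegenerate.le_norm_adj {κ : ℝ} (hκ : 0 < κ) {σ : ℝ≥0 → Matrix (Fin d) (Fin d) ℝ}
    (hσ : Nondegenerate κ σ) (r : ℝ≥0) (ξ : E d) :
    ‖ξ‖ ≤ √κ * ‖adj (σ r) ξ‖ := by
  set B := Matrix.toEuclideanCLM (𝕜 := ℝ) (σ r) with hB
  have hlow : ∀ η, ‖η‖ ≤ √κ * ‖B η‖ := fun η => by
    refine (pow_le_pow_iff_left₀ (norm_nonneg _) (by positivity) two_ne_zero).1 ?_
    rw [mul_pow, Real.sq_sqrt hκ.le]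
    have h := (hσ r η).1
    rw [inv_mul_le_iff₀ hκ] at h
    exact h
  have hinj : Function.Injective B := by
    refine (injective_iff_map_eq_zero B).2 fun η h => ?_
    have := hlow η
    rw [h, norm_zero, mul_zero] at this
    exact norm_le_zero_iff.1 this
  have hsurj : Function.Surjective B :=
    (LinearMap.injective_iff_surjective (f := (B : E d →ₗ[ℝ] E d))).1 hinj
  obtain ⟨η, rfl⟩ := hsurj ξ
  have h1 : ‖B η‖ ^ 2 ≤ ‖η‖ * ‖adj (σ r) (B η)‖ := by
    rw [← real_inner_self_eq_norm_sq, adj, ← ContinuousLinearMap.adjoint_inner_right]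
    exact real_inner_le_norm _ _
  rcases (norm_nonneg (B η)).eq_or_lt with h0 | h0
  · rw [← h0]; positivity
  · have h2 : ‖B η‖ * ‖B η‖ ≤ (√κ * ‖adj (σ r) (B η)‖) * ‖B η‖ := by
      calc ‖B η‖ * ‖B η‖ = ‖B η‖ ^ 2 := by ring
        _ ≤ ‖η‖ * ‖adj (σ r) (B η)‖ := h1
        _ ≤ (√κ * ‖B η‖) * ‖adj (σ r) (B η)‖ := by gcongr; exact hlow η
        _ = _ := by ring
    exact le_of_mul_le_mul_right h2 h0

theorem Nondegenerate.elliptic {κ : ℝ} (hκ : 1 < κ) {σ : ℝ≥0 → Matrix (Fin d) (Fin d) ℝ}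
    (hm : ∀ i j, Measurable fun r => σ r i j) (hσ : Nondegenerate κ σ) :
    Elliptic (2 * Real.pi * √κ) (scaledAdj σ) := by
  have hκ0 : 0 < κ := by linarith
  have h2π : 1 ≤ 2 * Real.pi := by linarith [Real.pi_gt_three]
  have hn : ∀ r ξ, ‖scaledAdj σ r ξ‖ = 2 * Real.pi * ‖adj (σ r.toNNReal) ξ‖ := fun r ξ => by
    rw [scaledAdj, smul_apply, norm_smul, Real.norm_of_nonneg (by positivity)]
  refine ⟨one_le_mul_of_one_le_of_one_le h2π (Real.one_le_sqrt.2 hκ.le), fun ξ => ?_,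
    fun r ξ => ?_, fun r ξ => ?_⟩
  · have h : Measurable fun r : ℝ => adj (σ r.toNNReal) ξ :=
      (measurable_adj hm ξ).comp measurable_real_toNNReal
    exact h.const_smul (2 * Real.pi)
  · rw [hn]
    refine (hσ.le_norm_adj hκ0 r.toNNReal ξ).trans ?_
    have h0 : 0 ≤ √κ * ‖adj (σ r.toNNReal) ξ‖ := by positivity
    calc _ ≤ (2 * Real.pi * (2 * Real.pi)) * (√κ * ‖adj (σ r.toNNReal) ξ‖) :=
          le_mul_of_one_le_left h0 (one_le_mul_of_one_le_of_one_le h2π h2π)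
      _ = _ := by ring
  · rw [hn, mul_assoc (2 * Real.pi)]
    exact mul_le_mul_of_nonneg_left (hσ.norm_adj_le hκ0 _ _) (by positivity)

/-- At `2πξ` the characteristic function is `exp (-phase)`, the factor 2π being built into
`scaledAdj`. Its fast decay makes the kernel smooth, and inversion makes it the density. -/
theorem isSmoothDensity_kernel {L : ℝ≥0 → Ω → E d} {Z : Ω → E d} {s t : ℝ≥0} (hst : s < t)
    {κ : ℝ} (hκ : 1 < κ) {σ : ℝ≥0 → Matrix (Fin d) (Fin d) ℝ} (hα : 0 < α) (hα2 : α ≤ 2)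
    (hm : ∀ i j, Measurable fun r => σ r i j) (hσ : Nondegenerate κ σ)
    (hL : IsStableProcess α L P) (hZ : IsStableIntegral α L P σ s t Z) :
    IsSmoothDensity P Z
      (kernel (volume.restrict (Set.Ioc (s : ℝ) t)) (scaledAdj σ) α) := by
  have hA := hσ.elliptic hκ hm
  have hν : 0 < (volume.restrict (Set.Ioc (s : ℝ) t)).real Set.univ := by
    rw [measureReal_restrict_apply_univ, Real.volume_real_Ioc_of_le (NNReal.coe_le_coe.2 hst.le),
      sub_pos]
    exact hst
  set ν := volume.restrict (Set.Ioc (s : ℝ) t) with hνdef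
  have hprob : IsProbabilityMeasure (P.map Z) := Measure.isProbabilityMeasure_map hZ.1
  have hchar : ∀ ξ : E d, charFun (P.map Z) ((2 * Real.pi) • ξ) =
      (Real.exp (-phase ν (scaledAdj σ) α ξ) : ℂ) := by
    intro ξ
    rw [charFun_map_of_isStableIntegral hα hL hm hZ _ (by positivity)
      (fun r => hσ.norm_adj_le (by linarith) r _), phase]
    simp only [scaledAdj, map_smul, smul_apply, hνdef]
  have hfi : Integrable fun ξ : E d => Real.exp (-phase ν (scaledAdj σ) α ξ) := by
    simpa using hA.integrable_norm_pow_mul_exp_neg_phase hα hα2 hν 0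
  have heven : ∀ ξ : E d, Real.exp (-phase ν (scaledAdj σ) α (-ξ)) =
      Real.exp (-phase ν (scaledAdj σ) α ξ) := fun ξ => by rw [phase_neg]
  have hsm := hA.contDiff_kernel hα hα2 hν
  have hc : Continuous (kernel ν (scaledAdj σ) α) := hsm.continuous
  exact ⟨hsm, fourier_re_nonneg hfi heven hchar hc, eq_withDensity_fourier hfi heven hchar hc⟩

end StableKernel

/-! ### The theorem -/

theorem theorem4p7 (d : ℕ) (hd : 1 ≤ d) (T : ℝ≥0) (hT : 0 < T) (α₀ : ℝ) (hα₀ : 0 < α₀)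
    (hα₀' : α₀ < 2) (κ₁ : ℝ) (hκ₁ : 1 < κ₁) :
    ∃ c : ℝ, 0 < c ∧
      ∀ σ : ℝ≥0 → Matrix (Fin d) (Fin d) ℝ, (∀ i j, Measurable fun r => σ r i j) →
      Nondegenerate κ₁ σ →
      ∀ α ∈ Set.Icc α₀ 2, ∀ s t : ℝ≥0, 0 < t → s + t ≤ T →
      -- `Z` is the integral of `σ` over `(s, s + t]` against the `α`-stable process `L`,
      -- `W` is the integral of `σ` over `(s, s + t]` against the `2`-stable process `B`
      ∀ {Ω : Type*} [MeasurableSpace Ω] (P : Measure Ω) [IsProbabilityMeasure P]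
        (L : ℝ≥0 → Ω → E d) (Z : Ω → E d),
        IsStableProcess α L P → IsStableIntegral α L P σ s (s + t) Z →
      ∀ {Ω' : Type*} [MeasurableSpace Ω'] (P' : Measure Ω') [IsProbabilityMeasure P']
        (B : ℝ≥0 → Ω' → E d) (W : Ω' → E d),
        IsStableProcess 2 B P' → IsStableIntegral 2 B P' σ s (s + t) W →
      -- the smooth densities `p` of `Z` and `q` of `W`
      ∃ p q : E d → ℝ, IsSmoothDensity P Z p ∧ IsSmoothDensity P' W q ∧
        (∀ x : E d, |p x - q x| ≤ c * rate α t * rhoSum 0 α t x) ∧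
        ((∀ r, (σ r * (σ r)ᵀ).IsDiag) → ∀ k : ℕ, k = 1 ∨ k = 2 → ∀ x : E d,
          ‖iteratedFDeriv ℝ k p x - iteratedFDeriv ℝ k q x‖ ≤
            c * rate α t * ∑ k₁ ∈ Finset.Icc 1 k,
              ‖x‖ ^ (2 * k₁ - k) * rhoSum (2 * k₁ : ℕ) α t x) := by
  obtain ⟨n, rfl⟩ : ∃ n, d = n + 1 := ⟨d - 1, by omega⟩
  -- The time horizon is raised to `max 1 T`, since powers of it are compared monotonically in the
  -- exponent. Lebesgue measure on `(s, s + t]` has total mass `t`, which is how time enters the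
  -- kernel bounds.
  obtain ⟨C, hC, hCb⟩ := exists_kernel_sub_le ℝ n (le_max_left 1 (T : ℝ)) hα₀
    (K := 2 * Real.pi * √κ₁) (one_le_mul_of_one_le_of_one_le (by linarith [Real.pi_gt_three])
      (Real.one_le_sqrt.2 hκ₁.le))
  refine ⟨C, hC, fun σ hm hσ α hα s t ht hst Ω _ P _ L Z hL hZ Ω' _ P' _ B W hB hW => ?_⟩
  have hlt : s < s + t := lt_add_of_pos_right s ht
  have hν : (volume.restrict (Set.Ioc (s : ℝ) (s + t : ℝ≥0))).real Set.univ = t := by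
    rw [measureReal_restrict_apply_univ, Real.volume_real_Ioc_of_le (NNReal.coe_le_coe.2 hlt.le)]
    push_cast
    ring
  have htT : (t : ℝ) ≤ max 1 (T : ℝ) :=
    (NNReal.coe_le_coe.2 ((le_add_of_nonneg_left s.2).trans hst)).trans (le_max_right _ _)
  obtain ⟨h₀, h₁⟩ := hCb (volume.restrict (Set.Ioc (s : ℝ) (s + t : ℝ≥0))) (scaledAdj σ)
    (hσ.elliptic hκ₁ hm) α t hα.1 hα.2 ht htT hν
  exact ⟨_, _, isSmoothDensity_kernel hlt hκ₁ (hα₀.trans_le hα.1) hα.2 hm hσ hL hZ,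
    isSmoothDensity_kernel hlt hκ₁ two_pos le_rfl hm hσ hB hW, h₀, fun _ => h₁⟩
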